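/- **Theorem (upper bound of the sub-optimality of the PRS policy).** *Model.* Let $\phi:\mathcal S\times\mathcal A\to\mathbb R^{d_\phi}$ be a measurable feature map and $\Theta^*\in\mathbb R^{d_x\times d_\phi}$ a matrix of rank $r\ge 1$ with largest and smallest non-zero singular values $\sigma_1\ge\sigma_r>0$. The reward is $r_{\Theta^*}(x,s,a)=x^\top\Theta^*\phi(s,a)$. The data are $N$ i.i.d. observations $(x_t,s_t,a_{t0},a_{t1},y_t)$ with $(x_t,s_t,a_{t0},a_{t1})\sim P$ and $$\mathbb P(y_t=1\mid x_t,s_t,a_{t0},a_{t1})=\frac{e^{r_{\Theta^*}(x_t,s_t,a_{t1})}}{e^{r_{\Theta^*}(x_t,s_t,a_{t0})}+e^{r_{\Theta^*}(x_t,s_t,a_{t1})}},\qquad y_t\in\{0,1\}.$$ Let $\rho$ be the evaluation distribution of $(x,s)$, with $\mathbb E_\rho\|x\|_2<\infty$, and let $\Pi$ be a class of measurable policies $\pi(x,s)\in\mathcal A$ (for instance all of them, or all those that depend on $s$ only). Put $J(\pi)=\mathbb E_{(x,s)\sim\rho}\,r_{\Theta^*}(x,s,\pi)$ and let $\pi^*\in\Pi$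 maximize $J$ over $\Pi$. *Algorithm.* For orthogonal $U,V$ and $M\in\mathbb R^{d_x\times d_\phi}$, the rotation-truncation-vectorization of $M$ is the vector in $\mathbb R^{(d_x+d_\phi)r-r^2}$ of the entries of $U^\top MV$ that lie in the first $r$ rows or in the first $r$ columns. Write $\ell(u,y)=\log(1+e^{-u})+(1-y)u$ and $Z_t=x_t(\phi(s_t,a_{t1})-\phi(s_t,a_{t0}))^\top$. 1. With $\mathcal L(\Theta)=\frac1{N_0}\sum_{t\le N_0}\ell(\langle Z_t,\Theta\rangle,y_t)$ and $\tilde{\mathcal L}(U,V)=\mathcal L(UV^\top)+\frac18\|U^\top U-V^\top V\|_F^2$ for $U\in\mathbb R^{d_x\times r}$, $V\in\mathbb R^{d_\phi\times r}$, take an SVD $\Theta_0=U_0D_0V_0^\top$ of an initial estimate, let $U^{(0)},V^{(0)}$ be the first $r$ columns of $U_0D_0^{1/2},V_0D_0^{1/2}$, and iterate $U^{(k+1)}=U^{(k)}-\eta\nabla_U\tilde{\mathcal L}(U^{(k)},V^{(k)})$, $V^{(k+1)}=V^{(k)}-\eta\nabla_V\tilde{\mathcal L}(U^{(k+1)},V^{(k)})$.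 Let $\hat\Theta=U^{(k)}(V^{(k)})^\top=\hat U\hat D\hat V^\top$ (full SVD). 2. Let $z_{t,rtv}$ and $z_{rtv}(x,s,\pi)$ be the rotation-truncation-vectorizations of $Z_t$ and of $x\phi(s,\pi(x,s))^\top$ with respect to $\hat U,\hat V$. Let $\hat\theta_{rtv}$ minimize $\theta\mapsto\frac1{N-N_0}\sum_{t>N_0}\ell(z_{t,rtv}^\top\theta,y_t)$, and let $W$ be the average of $z_{t,rtv}z_{t,rtv}^\top$ over one of the two splits $\{t\le N_0\}$, $\{t>N_0\}$. 3. For a radius $C$, let $\hat J(\pi)=\min\{\mathbb E_{(x,s)\sim\rho}\,z_{rtv}(x,s,\pi)^\top\theta:\|\theta-\hat\theta_{rtv}\|_W\le C\}$, where $\|v\|_W=\sqrt{v^\top Wv}$, and let $\hat\pi\in\Pi$ maximize $\hat J$ over $\Pi$. *Assumptions.* $\|x_t\|_2\le B_x$ almost surely; $\|\phi(s,a)\|_2\le B_\phi$ for all $s,a$; $\|\Theta\|_F\le B_\theta$ whenever $\|\Theta-\Theta^*\|_F\le1$; with $z_t=(\phi(s_t,a_{t1})-\phi(s_t,a_{t0}))\otimes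 x_t$, the matrix $\mathbb E_P z_tz_t^\top$ is positive definite, with smallest eigenvalue at least $\lambda>0$. Moreover, the mean $\mathbb E_{(x,s)\sim\rho}\,x\phi(s,\pi^*)^\top$ has a non-zero rotation-truncation-vectorization with respect to the singular vectors $U^*,V^*$ of $\Theta^*$ (this holds, for instance, whenever $J(\pi^*)\ne0$). *Conclusion.* For every $c>0$ there are constants $\kappa_0,K>0$, depending only on $B_x,B_\phi,B_\theta,c$, and constants $c_1,c_2>0$, which may depend also on $\lambda,\sigma_1,\sigma_r$, such that in every such problem and for every learning rate $0<\eta\le c_1/\sigma_1$ there is a number $N_1$ (depending on the problem, on $\eta$ and on the constants above, but not on $\delta$, $\kappa$, $N$, $N_0$) with the following property. Let $\delta\in(0,1)$, $\kappa\ge\kappa_0$, $N\ge N_1(1+\log(1/\delta))$, $N_0\ge cN$ and $N-N_0\ge cN$. Then there is $k_0$ such that, with probability at least $1-\delta$, for all initial estimates with $\|\Theta_0-\Theta^*\|_F\le c_2\sqrt{\sigma_r}$, all numbers of iterations $k\ge k_0$ and all choices in the algorithm with radius $C=\kappa\sqrt{\frac{(d_x+d_\phi)r+\log(1/\delta)}{N}}$: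 $W$ is positive definite, a minimizer $\hat\theta_{rtv}$ exists, and $$J(\pi^*)-J(\hat\pi)\le K\kappa\, C^*\sqrt{\frac{(d_x+d_\phi)r+\log(1/\delta)}{N}},\qquad C^*=\big\|\mathbb E_{(x,s)\sim\rho}\,z_{rtv}(x,s,\pi^*)\big\|_{W^{-1}}.$$ -/

import Mathlib

open MeasureTheory Matrix
open scoped Matrix.Norms.Frobenius

universe u v

namespace PRS

noncomputable section

/-! ## Linear algebra

On matrices, the norm is the Frobenius norm. -/

/-- The `m × n` matrix with diagonal entries `d 0, d 1, …` and zeros elsewhere. -/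
def rectDiag (m n : ℕ) (d : ℕ → ℝ) : Matrix (Fin m) (Fin n) ℝ :=
  Matrix.of fun i j => if i.val = j.val then d i.val else 0

/-- `M = U D Vᵀ` is a (full) singular value decomposition: `U` and `V` are square orthogonal
matrices, and `D` is rectangular diagonal with non-negative, non-increasing diagonal `d`. -/
structure IsSVD {m n : ℕ} (M : Matrix (Fin m) (Fin n) ℝ) (U : Matrix (Fin m) (Fin m) ℝ)
    (d : ℕ → ℝ) (V : Matrix (Fin n) (Fin n) ℝ) : Prop where
  left_orthogonal : U ∈ Matrix.orthogonalGroup (Fin m) ℝ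
  right_orthogonal : V ∈ Matrix.orthogonalGroup (Fin n) ℝ
  nonneg : ∀ i, 0 ≤ d i
  antitone : Antitone d
  eq : M = U * rectDiag m n d * Vᵀ

/-- The weighted norm `‖v‖_W = √(vᵀ W v)`. -/
def wNorm {ι : Type*} [Fintype ι] (W : Matrix ι ι ℝ) (v : ι → ℝ) : ℝ :=
  √(v ⬝ᵥ W *ᵥ v)

/-- Positions in the blocks `11`, `12`, `21` of an `m × n` matrix whose block `11` is `r × r`.
There are `(m + n) r - r²` of them when `r ≤ min m n`. -/
abbrev RtvIdx (m n r : ℕ) : Type :=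
  {p : Fin m × Fin n // p.1.val < r ∨ p.2.val < r}

/-- Rotation-truncation-vectorization: the vector of the entries of `Uᵀ M V` that lie in the
blocks `11`, `12`, `21`. -/
def rtv {m n : ℕ} (r : ℕ) (U : Matrix (Fin m) (Fin m) ℝ) (V : Matrix (Fin n) (Fin n) ℝ)
    (M : Matrix (Fin m) (Fin n) ℝ) : RtvIdx m n r → ℝ :=
  fun p => (Uᵀ * M * V) p.1.1 p.1.2

/-- The gradient of a real function of a matrix: the matrix of its partial derivatives. -/
def matGrad {m n : ℕ} (f : Matrix (Fin m) (Fin n) ℝ → ℝ) (M : Matrix (Fin m) (Fin n) ℝ) :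
    Matrix (Fin m) (Fin n) ℝ :=
  Matrix.of fun i j => deriv (fun t : ℝ => f (M + t • Matrix.single i j 1)) 0

/-! ## The contextual preference model -/

/-- A context, a state and two actions `(x, s, a₀, a₁)`. -/
abbrev Query (dx : ℕ) (S A : Type*) : Type _ :=
  EuclideanSpace ℝ (Fin dx) × S × A × A

/-- A query together with the answer `y` of the expert (`true` iff `a₁` is preferred). -/
abbrev Obs (dx : ℕ) (S A : Type*) : Type _ :=
  Query dx S A × Bool

section Model

variable {dx dφ : ℕ} {S A : Type*}

/-- The matrix `x vᵀ`. -/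
def outer (x : EuclideanSpace ℝ (Fin dx)) (v : EuclideanSpace ℝ (Fin dφ)) :
    Matrix (Fin dx) (Fin dφ) ℝ :=
  Matrix.of fun i j => x i * v j

/-- The bilinear form `xᵀ Θ v`. -/
def bilin (Θ : Matrix (Fin dx) (Fin dφ) ℝ) (x : EuclideanSpace ℝ (Fin dx))
    (v : EuclideanSpace ℝ (Fin dφ)) : ℝ :=
  ∑ i, ∑ j, x i * Θ i j * v j

variable (φ : S → A → EuclideanSpace ℝ (Fin dφ))

/-- The reward `r_Θ(x, s, a) = xᵀ Θ φ(s, a)`. -/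
def reward (Θ : Matrix (Fin dx) (Fin dφ) ℝ) (x : EuclideanSpace ℝ (Fin dx)) (s : S) (a : A) : ℝ :=
  bilin Θ x (φ s a)

/-- The feature difference `φ(s, a₁) - φ(s, a₀)` of a query `(x, s, a₀, a₁)`. -/
def featDiff (q : Query dx S A) : EuclideanSpace ℝ (Fin dφ) :=
  φ q.2.1 q.2.2.2 - φ q.2.1 q.2.2.1

/-- The probability that the expert prefers `a₁` to `a₀` (Bradley-Terry-Luce model). -/
def prefProb (Θ : Matrix (Fin dx) (Fin dφ) ℝ) (q : Query dx S A) : ℝ :=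
  Real.exp (reward φ Θ q.1 q.2.1 q.2.2.2) /
    (Real.exp (reward φ Θ q.1 q.2.1 q.2.2.1) + Real.exp (reward φ Θ q.1 q.2.1 q.2.2.2))

/-- The law of one observation: the query has law `P`, and given the query `q` the answer is
`true` with probability `prefProb φ Θ q`. -/
def obsLaw [MeasurableSpace S] [MeasurableSpace A] (Θ : Matrix (Fin dx) (Fin dφ) ℝ)
    (P : Measure (Query dx S A)) : Measure (Obs dx S A) :=
  (P.withDensity fun q => ENNReal.ofReal (prefProb φ Θ q)).map (fun q => (q, true)) +
    (P.withDensity fun q => ENNReal.ofReal (1 - prefProb φ Θ q)).map (fun q => (q, false))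

/-- The law of a dataset of `N` independent observations. -/
def dataLaw [MeasurableSpace S] [MeasurableSpace A] (Θ : Matrix (Fin dx) (Fin dφ) ℝ)
    (P : Measure (Query dx S A)) (N : ℕ) : Measure (Fin N → Obs dx S A) :=
  Measure.pi fun _ => obsLaw φ Θ P

/-- The vector `z = (φ(s, a₁) - φ(s, a₀)) ⊗ x`. -/
def zKron (q : Query dx S A) : Fin dφ × Fin dx → ℝ :=
  fun p => featDiff φ q p.1 * q.1 p.2

/-- The second moment matrix `E_P z zᵀ`. -/
def popSecondMoment [MeasurableSpace S] [MeasurableSpace A] (P : Measure (Query dx S A)) :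
    Matrix (Fin dφ × Fin dx) (Fin dφ × Fin dx) ℝ :=
  Matrix.of fun p p' => ∫ q, zKron φ q p * zKron φ q p' ∂P

/-! ## Policies -/

/-- A policy chooses an action from the context and the state. A policy that sees the state only
is a policy that does not depend on the context. -/
abbrev Policy (dx : ℕ) (S A : Type*) : Type _ :=
  EuclideanSpace ℝ (Fin dx) × S → A

/-- The value `J(π) = E_{(x,s) ∼ ρ} r_Θ(x, s, π(x, s))`. -/
def value [MeasurableSpace S] (Θ : Matrix (Fin dx) (Fin dφ) ℝ)
    (ρ : Measure (EuclideanSpace ℝ (Fin dx) × S)) (π : Policy dx S A) : ℝ :=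
  ∫ p, reward φ Θ p.1 p.2 (π p) ∂ρ

/-- The mean reduced feature `E_{(x,s) ∼ ρ} z_rtv(x, s, π)`, where `z_rtv(x, s, a)` is the
rotation-truncation-vectorization of `x φ(s, a)ᵀ` with respect to `U` and `V`. -/
def meanRtv [MeasurableSpace S] (r : ℕ) (U : Matrix (Fin dx) (Fin dx) ℝ)
    (V : Matrix (Fin dφ) (Fin dφ) ℝ) (ρ : Measure (EuclideanSpace ℝ (Fin dx) × S))
    (π : Policy dx S A) : RtvIdx dx dφ r → ℝ :=
  fun i => ∫ p, rtv r U V (outer p.1 (φ p.2 (π p))) i ∂ρ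

/-! ## Step 1: the low-rank subspace -/

/-- The first `N₀` indices. -/
def firstSplit (N N₀ : ℕ) : Finset (Fin N) := Finset.univ.filter fun t => t.val < N₀

/-- The remaining `N - N₀` indices. -/
def secondSplit (N N₀ : ℕ) : Finset (Fin N) := Finset.univ.filter fun t => N₀ ≤ t.val

/-- Negative log-likelihood of the answer `y` when the reward difference is `u`. -/
def logisticLoss (u : ℝ) (y : Bool) : ℝ :=
  Real.log (1 + Real.exp (-u)) + (if y then 0 else u)

/-- The average negative log-likelihood `𝓛(Θ)` over the observations with index in `T`. -/
def nll {N : ℕ} (ω : Fin N → Obs dx S A) (T : Finset (Fin N))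
    (Θ : Matrix (Fin dx) (Fin dφ) ℝ) : ℝ :=
  (T.card : ℝ)⁻¹ * ∑ t ∈ T, logisticLoss (bilin Θ (ω t).1.1 (featDiff φ (ω t).1)) (ω t).2

/-- The regularized factored loss `𝓛(U Vᵀ) + ‖Uᵀ U - Vᵀ V‖_F² / 8`. -/
def facLoss {N : ℕ} (ω : Fin N → Obs dx S A) (T : Finset (Fin N)) {r : ℕ}
    (U : Matrix (Fin dx) (Fin r) ℝ) (V : Matrix (Fin dφ) (Fin r) ℝ) : ℝ :=
  nll φ ω T (U * Vᵀ) + 1 / 8 * ‖Uᵀ * U - Vᵀ * V‖ ^ 2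

/-- One step of alternating factored gradient descent with learning rate `η`. -/
def fgdStep {N : ℕ} (ω : Fin N → Obs dx S A) (T : Finset (Fin N)) {r : ℕ} (η : ℝ)
    (UV : Matrix (Fin dx) (Fin r) ℝ × Matrix (Fin dφ) (Fin r) ℝ) :
    Matrix (Fin dx) (Fin r) ℝ × Matrix (Fin dφ) (Fin r) ℝ :=
  let U' := UV.1 - η • matGrad (fun U => facLoss φ ω T U UV.2) UV.1
  let V' := UV.2 - η • matGrad (fun V => facLoss φ ω T U' V) UV.2
  (U', V')

/-- The initial factors `U₀ D₀^{1/2}` and `V₀ D₀^{1/2}` (first `r` columns). -/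
def fgdInit (r : ℕ) (U₀ : Matrix (Fin dx) (Fin dx) ℝ) (d₀ : ℕ → ℝ)
    (V₀ : Matrix (Fin dφ) (Fin dφ) ℝ) :
    Matrix (Fin dx) (Fin r) ℝ × Matrix (Fin dφ) (Fin r) ℝ :=
  (U₀ * rectDiag dx r fun i => √(d₀ i), V₀ * rectDiag dφ r fun i => √(d₀ i))

/-- The low-rank estimate `Θ̂ = U⁽ᵏ⁾ (V⁽ᵏ⁾)ᵀ` after `k` steps, started from `U₀ D₀ V₀ᵀ`. -/
def fgdEstimate {N : ℕ} (ω : Fin N → Obs dx S A) (T : Finset (Fin N)) (r : ℕ) (η : ℝ)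
    (U₀ : Matrix (Fin dx) (Fin dx) ℝ) (d₀ : ℕ → ℝ) (V₀ : Matrix (Fin dφ) (Fin dφ) ℝ) (k : ℕ) :
    Matrix (Fin dx) (Fin dφ) ℝ :=
  let UV := (fgdStep φ ω T η)^[k] (fgdInit r U₀ d₀ V₀)
  UV.1 * UV.2ᵀ

/-! ## Step 2: reduction to the subspace -/

/-- `z_{t,rtv}`: the rotation-truncation-vectorization of `x_t (φ(s_t, a_{t1}) - φ(s_t, a_{t0}))ᵀ`. -/
def zRtv (r : ℕ) (U : Matrix (Fin dx) (Fin dx) ℝ) (V : Matrix (Fin dφ) (Fin dφ) ℝ)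
    (o : Obs dx S A) : RtvIdx dx dφ r → ℝ :=
  rtv r U V (outer o.1.1 (featDiff φ o.1))

/-- The average approximate negative log-likelihood in the reduced space. -/
def nllRtv {N : ℕ} (ω : Fin N → Obs dx S A) (T : Finset (Fin N)) (r : ℕ)
    (U : Matrix (Fin dx) (Fin dx) ℝ) (V : Matrix (Fin dφ) (Fin dφ) ℝ)
    (θ : RtvIdx dx dφ r → ℝ) : ℝ :=
  (T.card : ℝ)⁻¹ * ∑ t ∈ T, logisticLoss (zRtv φ r U V (ω t) ⬝ᵥ θ) (ω t).2

/-- The empirical second moment in the reduced space. -/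
def empSecondMoment {N : ℕ} (ω : Fin N → Obs dx S A) (T : Finset (Fin N)) (r : ℕ)
    (U : Matrix (Fin dx) (Fin dx) ℝ) (V : Matrix (Fin dφ) (Fin dφ) ℝ) :
    Matrix (RtvIdx dx dφ r) (RtvIdx dx dφ r) ℝ :=
  (T.card : ℝ)⁻¹ • ∑ t ∈ T, Matrix.vecMulVec (zRtv φ r U V (ω t)) (zRtv φ r U V (ω t))

/-! ## Step 3: pessimism -/

/-- The pessimistic value
`Ĵ(π) = min {E_{(x,s) ∼ ρ} z_rtv(x, s, π)ᵀ θ : ‖θ - θ̂‖_W ≤ C}`. -/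
def pessValue [MeasurableSpace S] (r : ℕ) (U : Matrix (Fin dx) (Fin dx) ℝ)
    (V : Matrix (Fin dφ) (Fin dφ) ℝ) (ρ : Measure (EuclideanSpace ℝ (Fin dx) × S))
    (W : Matrix (RtvIdx dx dφ r) (RtvIdx dx dφ r) ℝ) (θhat : RtvIdx dx dφ r → ℝ) (C : ℝ)
    (π : Policy dx S A) : ℝ :=
  sInf ((fun θ => ∫ p, rtv r U V (outer p.1 (φ p.2 (π p))) ⬝ᵥ θ ∂ρ) ''
    {θ | wNorm W (θ - θhat) ≤ C})

end Model

end

end PRS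

set_option linter.unusedSectionVars false

/-! Two scales govern the proof: `τ = √((1 + L) / N)` and `s = √(((dx + dφ) r + L) / N)`, where `L =
log (1/δ)`. Gradient descent only has to produce an estimate at distance `O(τ)` from the true
parameter, with a constant that may depend on the whole problem: what this error contributes to the
final bound is of order `τ²`, hence below any multiple of `s` once `N` is large. The sharp factor
`s` comes from maximum likelihood in the reduced space alone.

Local convergence of the descent (`altStep_converges`) rests on an inequality of Polyak–Łojasiewicz
type: near the truth, squared error plus squared imbalance of the factors is at most a multiple of
the squared partial gradients plus the squared gradient of the loss at the truth (`sq_error_le`).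
Combined with the decrease per step (`altStep_descent`), the energy contracts geometrically down to
that statistical noise, which is `O(τ²)`. The constants stay uniform because positive definiteness
bounds the dimensions and the smallest singular value bounds the rank.

If the estimate is within `ε` of the truth, the singular subspaces move by `O(ε)`
(`norm_perp_sub_perp_le`), but the block of the true parameter that truncation discards is `O(ε²)`,
since it is missed on both sides (`norm_perp_mul_perp_le`). So the reduced model is well specified
up to `O(τ²)`. By convexity, the error of the reduced estimator is at most the score in the
estimated tangent directions divided by the curvature (`exists_isMinOn_nllRtv`). The true tangent
directions form a fixed space of dimension at most `(dx + dφ) r`, on which the method of mixtures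
bounds the score by a multiple of `s` (`self_normalized`, `score_concentration`). Passing to the
estimated directions costs gradient times angle, again `O(τ²)` (`GoodData.abs_ip_nllGrad_le`).
Independence of the two splits plays no role, which is why `W` may come from either.

Finally `W` is comparable to the population second moment, so a ball of radius `C = κ s` contains
the reduced truth, and pessimism loses at most `2 C C*` (`pessimism_gap`). The truncation bias in
the two values is absorbed by one more `C C*`, because `C*` is bounded below; this is where the
non-vanishing mean feature of the optimal policy enters. -/

namespace PRS

/-! ### The Frobenius inner product. -/

section FrobeniusInner

variable {l m n : Type*} [Fintype l] [Fintype m] [Fintype n]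

/-- The Frobenius inner product `tr(Aᵀ B)`. -/
def ip (A B : Matrix m n ℝ) : ℝ := (Aᵀ * B).trace

lemma ip_eq_sum (A B : Matrix m n ℝ) : ip A B = ∑ i, ∑ j, A i j * B i j := by
  simp only [ip, trace, diag, mul_apply, transpose_apply]
  exact Finset.sum_comm

lemma ip_comm (A B : Matrix m n ℝ) : ip A B = ip B A := by
  simp only [ip_eq_sum, mul_comm]

lemma ip_add_left (A B C : Matrix m n ℝ) : ip (A + B) C = ip A C + ip B C := by
  simp [ip, Matrix.add_mul]

lemma ip_add_right (A B C : Matrix m n ℝ) : ip A (B + C) = ip A B + ip A C := by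
  simp [ip, Matrix.mul_add]

lemma ip_neg_right (A B : Matrix m n ℝ) : ip A (-B) = -ip A B := by simp [ip]

lemma ip_sub_left (A B C : Matrix m n ℝ) : ip (A - B) C = ip A C - ip B C := by
  simp [ip, Matrix.sub_mul]

lemma ip_sub_right (A B C : Matrix m n ℝ) : ip A (B - C) = ip A B - ip A C := by
  simp [ip, Matrix.mul_sub]

lemma ip_smul_left (c : ℝ) (A B : Matrix m n ℝ) : ip (c • A) B = c * ip A B := by simp [ip]

lemma ip_smul_right (c : ℝ) (A B : Matrix m n ℝ) : ip A (c • B) = c * ip A B := by simp [ip]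

lemma ip_zero_left (A : Matrix m n ℝ) : ip 0 A = 0 := by simp [ip]

lemma ip_sum_left {τ : Type*} (T : Finset τ) (A : τ → Matrix m n ℝ) (B : Matrix m n ℝ) :
    ip (∑ t ∈ T, A t) B = ∑ t ∈ T, ip (A t) B := by
  classical
  induction T using Finset.induction_on with
  | empty => simp [ip_zero_left]
  | insert a s ha ih => rw [Finset.sum_insert ha, Finset.sum_insert ha, ip_add_left, ih]

lemma ip_transpose (A B : Matrix m n ℝ) : ip Aᵀ Bᵀ = ip A B := by
  simp only [ip_eq_sum, transpose_apply]
  exact Finset.sum_comm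

lemma ip_mul_left (A : Matrix m l ℝ) (B : Matrix l n ℝ) (C : Matrix m n ℝ) :
    ip (A * B) C = ip B (Aᵀ * C) := by
  simp [ip, Matrix.mul_assoc]

lemma ip_mul_right (A : Matrix m l ℝ) (B : Matrix l n ℝ) (C : Matrix m n ℝ) :
    ip (A * B) C = ip A (C * Bᵀ) := by
  simp only [ip, transpose_mul]
  rw [Matrix.mul_assoc, trace_mul_comm, Matrix.mul_assoc]

lemma norm_sq_eq_ip (A : Matrix m n ℝ) : ‖A‖ ^ 2 = ip A A := by
  rw [frobenius_norm_def, ip_eq_sum, ← Real.sqrt_eq_rpow, Real.sq_sqrt (by positivity)]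
  simp [pow_two]

lemma abs_ip_le (A B : Matrix m n ℝ) : |ip A B| ≤ ‖A‖ * ‖B‖ := by
  apply abs_le_of_sq_le_sq _ (by positivity)
  rw [mul_pow, norm_sq_eq_ip, norm_sq_eq_ip]
  have h : ∀ C D : Matrix m n ℝ, ip C D = ∑ p : m × n, C p.1 p.2 * D p.1 p.2 := fun C D => by
    rw [ip_eq_sum, Fintype.sum_prod_type]
  rw [h, h, h]
  simpa [pow_two] using Finset.sum_mul_sq_le_sq_mul_sq Finset.univ
    (fun p : m × n => A p.1 p.2) (fun p => B p.1 p.2)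

lemma ip_le (A B : Matrix m n ℝ) : ip A B ≤ ‖A‖ * ‖B‖ := (le_abs_self _).trans (abs_ip_le A B)

lemma neg_le_ip (A B : Matrix m n ℝ) : -(‖A‖ * ‖B‖) ≤ ip A B := (abs_le.1 (abs_ip_le A B)).1

lemma norm_add_sq_ip (A B : Matrix m n ℝ) :
    ‖A + B‖ ^ 2 = ‖A‖ ^ 2 + 2 * ip A B + ‖B‖ ^ 2 := by
  simp only [norm_sq_eq_ip, ip_add_left, ip_add_right, ip_comm B A]; ring

lemma frobenius_sq_one [DecidableEq m] : ‖(1 : Matrix m m ℝ)‖ ^ 2 = Fintype.card m := by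
  rw [norm_sq_eq_ip, ip]; simp

end FrobeniusInner

/-! ### The logistic loss -/

section Logistic

/-- The value of the answer. -/
def boolVal (y : Bool) : ℝ := if y then 1 else 0

lemma hasDerivAt_logisticLoss (u : ℝ) (y : Bool) :
    HasDerivAt (fun u => logisticLoss u y) (Real.sigmoid u - boolVal y) u := by
  have h1 : HasDerivAt (fun u : ℝ => Real.log (1 + Real.exp (-u)))
      ((0 + Real.exp (-u) * (-1)) / (1 + Real.exp (-u))) u :=
    HasDerivAt.log (((hasDerivAt_const u (1 : ℝ)).add ((hasDerivAt_neg u).exp)))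
      (by positivity)
  have h2 : (0 + Real.exp (-u) * (-1)) / (1 + Real.exp (-u)) = Real.sigmoid u - 1 := by
    rw [Real.sigmoid_def]; field_simp; ring
  rw [h2] at h1
  unfold logisticLoss boolVal
  cases y
  · exact (h1.add (hasDerivAt_id u)).congr_deriv (by simp)
  · simpa using h1

lemma sigmoid_mul_one_sub_le (u : ℝ) : Real.sigmoid u * (1 - Real.sigmoid u) ≤ 1 / 4 := by
  nlinarith [sq_nonneg (Real.sigmoid u - 1 / 2)]

/-- The product equals `1 / (2 + exp u + exp (-u))`, whose denominator is at most `4 exp b`. -/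
lemma le_sigmoid_mul_one_sub {u b : ℝ} (h : |u| ≤ b) :
    Real.exp (-b) / 4 ≤ Real.sigmoid u * (1 - Real.sigmoid u) := by
  rw [← Real.sigmoid_neg, Real.sigmoid_def, Real.sigmoid_def, neg_neg, ← mul_inv]
  have h1 : Real.exp u ≤ Real.exp b := Real.exp_le_exp.2 ((le_abs_self u).trans h)
  have h2 : Real.exp (-u) ≤ Real.exp b := Real.exp_le_exp.2 ((neg_le_abs u).trans h)
  have h3 : Real.exp (-u) * Real.exp u = 1 := by rw [← Real.exp_add]; simp
  have h0 : 1 ≤ Real.exp b := Real.one_le_exp ((abs_nonneg u).trans h)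
  have hp := Real.exp_pos u
  have hn := Real.exp_pos (-u)
  rw [Real.exp_neg, div_eq_mul_inv, ← mul_inv]
  apply inv_anti₀ (by positivity)
  nlinarith

/-- Taylor bounds for a function whose derivative has derivative between `lo` and `hi`. -/
lemma taylor_le_of_deriv2_le {f f' f'' : ℝ → ℝ} (hf : ∀ x, HasDerivAt f (f' x) x)
    (hf' : ∀ x, HasDerivAt f' (f'' x) x) {C u v : ℝ}
    (hC : ∀ x ∈ Set.uIcc u v, f'' x ≤ C) :
    f v ≤ f u + f' u * (v - u) + C / 2 * (v - u) ^ 2 := by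
  -- along the segment from `u` to `v`
  let g : ℝ → ℝ := fun t => f' (u + t * (v - u)) * (v - u) - C * (v - u) ^ 2 * t
  let G : ℝ → ℝ := fun t => f (u + t * (v - u)) - C * (v - u) ^ 2 * (t ^ 2 / 2)
  have hline : ∀ t : ℝ, HasDerivAt (fun t : ℝ => u + t * (v - u)) (v - u) t := fun t => by
    simpa using ((hasDerivAt_id t).mul_const (v - u)).const_add u
  have hg : ∀ t, HasDerivAt g (f'' (u + t * (v - u)) * (v - u) * (v - u) - C * (v - u) ^ 2) t := by
    intro t
    exact ((((hf' (u + t * (v - u))).comp t (hline t)).mul_const (v - u)).sub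
      ((hasDerivAt_id t).const_mul (C * (v - u) ^ 2))).congr_deriv (by simp)
  have hG : ∀ t, HasDerivAt G (g t) t := by
    intro t
    have h2 : HasDerivAt (fun t : ℝ => t ^ 2 / 2) t t := by
      simpa using (hasDerivAt_pow 2 t).div_const 2
    exact ((hf (u + t * (v - u))).comp t (hline t)).sub (h2.const_mul (C * (v - u) ^ 2))
  have hmem : ∀ t ∈ Set.Icc (0 : ℝ) 1, u + t * (v - u) ∈ Set.uIcc u v := by
    rintro t ⟨h0, h1⟩
    rw [Set.mem_uIcc]
    rcases le_total u v with h | h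
    · left; constructor <;> nlinarith
    · right; constructor <;> nlinarith
  -- `g` is the derivative of `G`, the function along the segment minus its quadratic majorant.
  -- Monotonicity is used twice: for `g`, then for `G` minus its tangent at `0`.
  have hanti : AntitoneOn g (Set.Icc 0 1) := by
    apply antitoneOn_of_deriv_nonpos (convex_Icc 0 1)
      (fun t _ => (hg t).continuousAt.continuousWithinAt)
      (fun t _ => (hg t).differentiableAt.differentiableWithinAt)
    intro t ht
    rw [interior_Icc] at ht
    rw [(hg t).deriv]
    nlinarith [hC _ (hmem t ⟨ht.1.le, ht.2.le⟩), sq_nonneg (v - u)]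
  have hanti2 : AntitoneOn (fun t => G t - g 0 * t) (Set.Icc 0 1) := by
    have hd : ∀ t, HasDerivAt (fun t => G t - g 0 * t) (g t - g 0) t := fun t =>
      ((hG t).sub ((hasDerivAt_id t).const_mul (g 0))).congr_deriv (by simp)
    apply antitoneOn_of_deriv_nonpos (convex_Icc 0 1)
      (fun t _ => (hd t).continuousAt.continuousWithinAt)
      (fun t _ => (hd t).differentiableAt.differentiableWithinAt)
    intro t ht
    rw [interior_Icc] at ht
    rw [(hd t).deriv]
    linarith [hanti (Set.left_mem_Icc.2 zero_le_one) ⟨ht.1.le, ht.2.le⟩ ht.1.le]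
  have := hanti2 (Set.left_mem_Icc.2 zero_le_one) (Set.right_mem_Icc.2 zero_le_one) zero_le_one
  simp only [G, g] at this
  norm_num at this
  linarith

lemma hasDerivAt_sigmoid_sub (c u : ℝ) :
    HasDerivAt (fun u => Real.sigmoid u - c) (Real.sigmoid u * (1 - Real.sigmoid u)) u :=
  (Real.hasDerivAt_sigmoid u).sub_const c

lemma logisticLoss_le (u v : ℝ) (y : Bool) : logisticLoss v y ≤
    logisticLoss u y + (Real.sigmoid u - boolVal y) * (v - u) + 1 / 8 * (v - u) ^ 2 := by
  have := taylor_le_of_deriv2_le (fun x => hasDerivAt_logisticLoss x y)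
    (hasDerivAt_sigmoid_sub (boolVal y)) (u := u) (v := v)
    (fun x _ => sigmoid_mul_one_sub_le x)
  linarith

/-- The upper Taylor bound for the negated loss. A positive `c` gives strong convexity on bounded
ranges, `c = 0` global convexity. -/
lemma le_logisticLoss_of_curvature {u v c : ℝ} (y : Bool)
    (hc : ∀ x ∈ Set.uIcc u v, c ≤ Real.sigmoid x * (1 - Real.sigmoid x)) :
    logisticLoss u y + (Real.sigmoid u - boolVal y) * (v - u) + c / 2 * (v - u) ^ 2 ≤
      logisticLoss v y := by
  have := taylor_le_of_deriv2_le (fun x => (hasDerivAt_logisticLoss x y).neg)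
    (fun x => (hasDerivAt_sigmoid_sub (boolVal y) x).neg) (u := u) (v := v) (C := -c)
    (fun x hx => neg_le_neg (hc x hx))
  simp only [Pi.neg_apply] at this
  linarith

lemma le_logisticLoss {u v b : ℝ} (y : Bool) (hu : |u| ≤ b) (hv : |v| ≤ b) :
    logisticLoss u y + (Real.sigmoid u - boolVal y) * (v - u) +
      Real.exp (-b) / 8 * (v - u) ^ 2 ≤ logisticLoss v y := by
  have := le_logisticLoss_of_curvature (c := Real.exp (-b) / 4) (u := u) (v := v) y
    (fun x hx => le_sigmoid_mul_one_sub <| by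
      rw [abs_le] at *
      rcases Set.mem_uIcc.1 hx with h | h <;> constructor <;> linarith [h.1, h.2])
  linarith

lemma logisticLoss_convex (u v : ℝ) (y : Bool) :
    logisticLoss u y + (Real.sigmoid u - boolVal y) * (v - u) ≤ logisticLoss v y := by
  have := le_logisticLoss_of_curvature (c := 0) (u := u) (v := v) y
    (fun x _ => mul_nonneg (Real.sigmoid_nonneg x) (by linarith [Real.sigmoid_le_one x]))
  linarith

lemma abs_sigmoid_sub_le (u v : ℝ) : |Real.sigmoid u - Real.sigmoid v| ≤ 1 / 4 * |u - v| := by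
  have := Convex.norm_image_sub_le_of_norm_hasDerivWithin_le (s := Set.univ) (C := 1 / 4)
    (f := Real.sigmoid) (f' := fun x => Real.sigmoid x * (1 - Real.sigmoid x)) (x := v) (y := u)
    (fun x _ => (Real.hasDerivAt_sigmoid x).hasDerivWithinAt)
    (fun x _ => by
      rw [Real.norm_of_nonneg (mul_nonneg (Real.sigmoid_nonneg x)
        (by linarith [Real.sigmoid_le_one x]))]
      exact sigmoid_mul_one_sub_le x) convex_univ trivial trivial
  simpa using this

end Logistic

/-! ### Factored matrices: descent, balance and the error bound. -/

section Factored

variable {l m n ι : Type*} [Fintype l] [Fintype m] [Fintype n] [Fintype ι]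

lemma norm_mul_le_of_le {A : Matrix l m ℝ} {B : Matrix m n ℝ} {a b : ℝ} (hA : ‖A‖ ≤ a)
    (hB : ‖B‖ ≤ b) : ‖A * B‖ ≤ a * b :=
  (frobenius_norm_mul A B).trans
    (mul_le_mul hA hB (norm_nonneg _) ((norm_nonneg _).trans hA))

lemma norm_transpose_le {A : Matrix l m ℝ} {a : ℝ} (hA : ‖A‖ ≤ a) : ‖Aᵀ‖ ≤ a := by
  rwa [frobenius_norm_transpose]

/-- Smoothness of `f`, and its strong convexity around `Θs`; `G` is the gradient of `f`. -/
structure Landscape (f : Matrix m n ℝ → ℝ) (G : Matrix m n ℝ → Matrix m n ℝ)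
    (Θs : Matrix m n ℝ) (L μ : ℝ) : Prop where
  smooth : ∀ Θ H, f (Θ + H) ≤ f Θ + ip (G Θ) H + L / 2 * ‖H‖ ^ 2
  -- Strong convexity is needed only along segments with an end at `Θs`. The sum of `lower` and
  -- `lower'` is strong monotonicity of the gradient with respect to `Θs`.
  lower : ∀ Θ, ‖Θ - Θs‖ ≤ 1 → f Θs + ip (G Θs) (Θ - Θs) + μ / 2 * ‖Θ - Θs‖ ^ 2 ≤ f Θ
  lower' : ∀ Θ, ‖Θ - Θs‖ ≤ 1 → f Θ + ip (G Θ) (Θs - Θ) + μ / 2 * ‖Θ - Θs‖ ^ 2 ≤ f Θs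
  lipschitz : ∀ Θ Θ', ‖G Θ - G Θ'‖ ≤ L * ‖Θ - Θ'‖

/-- Transposition exchanges the two factors, so facts about the step in `U` yield those about the
step in `V`. -/
lemma Landscape.transpose {f : Matrix m n ℝ → ℝ} {G : Matrix m n ℝ → Matrix m n ℝ}
    {Θs : Matrix m n ℝ} {L μ : ℝ} (h : Landscape f G Θs L μ) :
    Landscape (fun Θ => f Θᵀ) (fun Θ => (G Θᵀ)ᵀ) Θsᵀ L μ where
  smooth Θ H := by
    have := h.smooth Θᵀ Hᵀ
    rwa [← transpose_add, frobenius_norm_transpose, ← ip_transpose, transpose_transpose] at this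
  lower Θ hΘ := by
    rw [← frobenius_norm_transpose, transpose_sub, transpose_transpose] at hΘ ⊢
    have := h.lower Θᵀ hΘ
    rwa [← ip_transpose, transpose_sub, transpose_transpose] at this
  lower' Θ hΘ := by
    rw [← frobenius_norm_transpose, transpose_sub, transpose_transpose] at hΘ ⊢
    have := h.lower' Θᵀ hΘ
    rwa [← ip_transpose, transpose_sub, transpose_transpose] at this
  lipschitz Θ Θ' := by
    rw [← transpose_sub, frobenius_norm_transpose, ← frobenius_norm_transpose (Θ - Θ'),
      transpose_sub]
    exact h.lipschitz _ _

/-- The imbalance `Uᵀ U - Vᵀ V` of two factors. -/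
def bal (U : Matrix m ι ℝ) (V : Matrix n ι ℝ) : Matrix ι ι ℝ := Uᵀ * U - Vᵀ * V

/-- The gradient in `U` of `f(U Vᵀ) + ‖Uᵀ U - Vᵀ V‖² / 8`, where `G` is the gradient of `f`. -/
noncomputable def facGradU (G : Matrix m n ℝ → Matrix m n ℝ) (U : Matrix m ι ℝ)
    (V : Matrix n ι ℝ) : Matrix m ι ℝ :=
  G (U * Vᵀ) * V + (1 / 2 : ℝ) • (U * bal U V)

/-- The gradient in `V` of `f(U Vᵀ) + ‖Uᵀ U - Vᵀ V‖² / 8`, where `G` is the gradient of `f`. -/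
noncomputable def facGradV (G : Matrix m n ℝ → Matrix m n ℝ) (U : Matrix m ι ℝ)
    (V : Matrix n ι ℝ) : Matrix n ι ℝ :=
  (G (U * Vᵀ))ᵀ * U - (1 / 2 : ℝ) • (V * bal U V)

lemma bal_transpose (U : Matrix m ι ℝ) (V : Matrix n ι ℝ) : (bal U V)ᵀ = bal U V := by
  simp [bal]

lemma neg_bal (U : Matrix m ι ℝ) (V : Matrix n ι ℝ) : -bal U V = bal V U := by
  simp [bal]

lemma norm_bal_swap (U : Matrix m ι ℝ) (V : Matrix n ι ℝ) : ‖bal V U‖ = ‖bal U V‖ := by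
  rw [← neg_bal, norm_neg]

lemma facGradU_swap (G : Matrix m n ℝ → Matrix m n ℝ) (U : Matrix m ι ℝ) (V : Matrix n ι ℝ) :
    facGradU (fun Θ => (G Θᵀ)ᵀ) V U = facGradV G U V := by
  simp [facGradU, facGradV, ← neg_bal U V, sub_eq_add_neg]

/-- The regularized factored loss. -/
noncomputable def facObj (f : Matrix m n ℝ → ℝ) (U : Matrix m ι ℝ) (V : Matrix n ι ℝ) : ℝ :=
  f (U * Vᵀ) + 1 / 8 * ‖bal U V‖ ^ 2

lemma facObj_swap (f : Matrix m n ℝ → ℝ) (U : Matrix m ι ℝ) (V : Matrix n ι ℝ) :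
    facObj (fun Θ => f Θᵀ) V U = facObj f U V := by
  simp [facObj, norm_bal_swap U V]

lemma bal_add (U D : Matrix m ι ℝ) (V : Matrix n ι ℝ) :
    bal (U + D) V = bal U V + (Dᵀ * U + Uᵀ * D + Dᵀ * D) := by
  simp only [bal, transpose_add, Matrix.add_mul, Matrix.mul_add]; abel

lemma norm_bal_incr_le {U D : Matrix m ι ℝ} {b : ℝ} (hU : ‖U‖ ≤ b) (hD : ‖D‖ ≤ 1) :
    ‖Dᵀ * U + Uᵀ * D + Dᵀ * D‖ ≤ (2 * b + 1) * ‖D‖ := by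
  have h1 := norm_mul_le_of_le (norm_transpose_le (le_refl ‖D‖)) hU
  have h2 := norm_mul_le_of_le (norm_transpose_le hU) (le_refl ‖D‖)
  have h3 := norm_mul_le_of_le (norm_transpose_le hD) (le_refl ‖D‖)
  have := norm_add₃_le (a := Dᵀ * U) (b := Uᵀ * D) (c := Dᵀ * D)
  linarith

/-- Descent in the first factor. -/
lemma facObj_add_le {f : Matrix m n ℝ → ℝ} {G : Matrix m n ℝ → Matrix m n ℝ}
    {L b β : ℝ} (hL : 0 ≤ L)
    (hs : ∀ Θ H, f (Θ + H) ≤ f Θ + ip (G Θ) H + L / 2 * ‖H‖ ^ 2)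
    {U D : Matrix m ι ℝ} {V : Matrix n ι ℝ}
    (hU : ‖U‖ ≤ b) (hV : ‖V‖ ≤ b) (hB : ‖bal U V‖ ≤ β) (hD : ‖D‖ ≤ 1) :
    facObj f (U + D) V ≤ facObj f U V + ip (facGradU G U V) D +
      (L / 2 * b ^ 2 + 1 / 8 * (2 * β + (2 * b + 1) ^ 2)) * ‖D‖ ^ 2 := by
  have hb : 0 ≤ b := (norm_nonneg _).trans hU
  have h1 := hs (U * Vᵀ) (D * Vᵀ)
  have h2 : ‖D * Vᵀ‖ ≤ ‖D‖ * b := norm_mul_le_of_le le_rfl (norm_transpose_le hV)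
  have h3 : ip (G (U * Vᵀ)) (D * Vᵀ) = ip (G (U * Vᵀ) * V) D := by
    rw [ip_mul_right]
  have h4 : ‖D * Vᵀ‖ ^ 2 ≤ (‖D‖ * b) ^ 2 := pow_le_pow_left₀ (norm_nonneg _) h2 2
  -- `E` is the exact change of the imbalance. Its linear part, paired with `bal U V`, is the
  -- gradient of the regularizer; everything else goes into the coefficient of `‖D‖ ^ 2`.
  set E := Dᵀ * U + Uᵀ * D + Dᵀ * D with hE
  have hEn : ‖E‖ ^ 2 ≤ ((2 * b + 1) * ‖D‖) ^ 2 :=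
    pow_le_pow_left₀ (norm_nonneg _) (norm_bal_incr_le hU hD) 2
  have h5 : ip (bal U V) (Uᵀ * D) = ip (U * bal U V) D := by
    rw [ip_comm, ip_mul_left, transpose_transpose, ip_comm]
  have h6 : ip (bal U V) (Dᵀ * U) = ip (U * bal U V) D := by
    rw [← h5, ← ip_transpose, bal_transpose, transpose_mul, transpose_transpose]
  have h7 : ip (bal U V) (Dᵀ * D) ≤ β * ‖D‖ ^ 2 := by
    refine (ip_le _ _).trans ?_
    have := norm_mul_le_of_le (norm_transpose_le (le_refl ‖D‖)) (le_refl ‖D‖)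
    calc _ ≤ β * (‖D‖ * ‖D‖) :=
          mul_le_mul hB this (norm_nonneg _) ((norm_nonneg _).trans hB)
      _ = _ := by ring
  have h8 : ip (bal U V) E = 2 * ip (U * bal U V) D + ip (bal U V) (Dᵀ * D) := by
    rw [hE, ip_add_right, ip_add_right, h5, h6]; ring
  have h9 := norm_add_sq_ip (bal U V) E
  have h10 : L / 2 * ‖D * Vᵀ‖ ^ 2 ≤ L / 2 * (‖D‖ * b) ^ 2 :=
    mul_le_mul_of_nonneg_left h4 (by positivity)
  simp only [facObj, facGradU, bal_add, ip_add_left, ip_smul_left, Matrix.add_mul, ← hE]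
  rw [h9, h8]
  rw [h3] at h1
  nlinarith

/-- One gradient step in the first factor. -/
lemma facObj_step_le {f : Matrix m n ℝ → ℝ} {G : Matrix m n ℝ → Matrix m n ℝ}
    {L b β η : ℝ} (hL : 0 ≤ L)
    (hs : ∀ Θ H, f (Θ + H) ≤ f Θ + ip (G Θ) H + L / 2 * ‖H‖ ^ 2)
    {U : Matrix m ι ℝ} {V : Matrix n ι ℝ}
    (hU : ‖U‖ ≤ b) (hV : ‖V‖ ≤ b) (hB : ‖bal U V‖ ≤ β) (hη : 0 ≤ η)
    (hD : η * ‖facGradU G U V‖ ≤ 1)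
    (hK : η * (L / 2 * b ^ 2 + 1 / 8 * (2 * β + (2 * b + 1) ^ 2)) ≤ 1 / 2) :
    facObj f (U - η • facGradU G U V) V ≤
      facObj f U V - η / 2 * ‖facGradU G U V‖ ^ 2 := by
  have hn : ‖-(η • facGradU G U V)‖ = η * ‖facGradU G U V‖ := by
    rw [norm_neg, norm_smul, Real.norm_of_nonneg hη]
  have := facObj_add_le hL hs hU hV hB (D := -(η • facGradU G U V)) (by rwa [hn])
  rw [hn, ip_neg_right, ip_smul_right, ← norm_sq_eq_ip, ← sub_eq_add_neg] at this
  refine this.trans ?_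
  have h := mul_le_mul_of_nonneg_right hK
    (mul_nonneg hη (sq_nonneg ‖facGradU G U V‖))
  nlinarith

lemma norm_facGradU_le {G : Matrix m n ℝ → Matrix m n ℝ} {U : Matrix m ι ℝ} {V : Matrix n ι ℝ}
    {b g β : ℝ} (hU : ‖U‖ ≤ b) (hV : ‖V‖ ≤ b) (hG : ‖G (U * Vᵀ)‖ ≤ g) (hB : ‖bal U V‖ ≤ β) :
    ‖facGradU G U V‖ ≤ g * b + 1 / 2 * (b * β) := by
  refine (norm_add_le _ _).trans (add_le_add (norm_mul_le_of_le hG hV) ?_)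
  rw [norm_smul, Real.norm_of_nonneg (by norm_num)]
  exact mul_le_mul_of_nonneg_left (norm_mul_le_of_le hU hB) (by norm_num)

lemma norm_facGradV_sub_le {G : Matrix m n ℝ → Matrix m n ℝ} {L : ℝ}
    (hLip : ∀ Θ Θ', ‖G Θ - G Θ'‖ ≤ L * ‖Θ - Θ'‖) (hL : 0 ≤ L)
    {U D : Matrix m ι ℝ} {V : Matrix n ι ℝ} {b g : ℝ} (hU : ‖U‖ ≤ b) (hV : ‖V‖ ≤ b)
    (hG : ‖G (U * Vᵀ)‖ ≤ g) (hD : ‖D‖ ≤ 1) :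
    ‖facGradV G (U + D) V - facGradV G U V‖ ≤
      (L * b * (b + 1) + g + 1 / 2 * (b * (2 * b + 1))) * ‖D‖ := by
  have hb : 0 ≤ b := (norm_nonneg _).trans hU
  have hdec : facGradV G (U + D) V - facGradV G U V =
      (G ((U + D) * Vᵀ) - G (U * Vᵀ))ᵀ * (U + D) + (G (U * Vᵀ))ᵀ * D -
        (1 / 2 : ℝ) • (V * (Dᵀ * U + Uᵀ * D + Dᵀ * D)) := by
    simp only [facGradV, bal_add, transpose_sub, Matrix.sub_mul, Matrix.mul_add, smul_add]
    abel
  have h1 : ‖G ((U + D) * Vᵀ) - G (U * Vᵀ)‖ ≤ L * (‖D‖ * b) := by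
    refine (hLip _ _).trans (mul_le_mul_of_nonneg_left ?_ hL)
    rw [Matrix.add_mul, add_sub_cancel_left]
    exact norm_mul_le_of_le le_rfl (norm_transpose_le hV)
  have h2 : ‖U + D‖ ≤ b + 1 := (norm_add_le _ _).trans (add_le_add hU hD)
  have h3 := norm_mul_le_of_le (norm_transpose_le h1) h2
  have h4 := norm_mul_le_of_le (norm_transpose_le hG) (le_refl ‖D‖)
  have h5 := norm_mul_le_of_le hV (norm_bal_incr_le hU hD)
  rw [hdec]
  refine (norm_sub_le _ _).trans ?_
  have h6 : ‖(1 / 2 : ℝ) • (V * (Dᵀ * U + Uᵀ * D + Dᵀ * D))‖ =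
      1 / 2 * ‖V * (Dᵀ * U + Uᵀ * D + Dᵀ * D)‖ := by
    rw [norm_smul, Real.norm_of_nonneg (by norm_num)]
  rw [h6]
  have h7 := norm_add_le ((G ((U + D) * Vᵀ) - G (U * Vᵀ))ᵀ * (U + D)) ((G (U * Vᵀ))ᵀ * D)
  linarith

/-- Balanced factors of a bounded matrix are bounded. -/
lemma norm_factor_sq_le [DecidableEq ι] {U : Matrix m ι ℝ} {V : Matrix n ι ℝ} {β rb : ℝ}
    (hr : (Fintype.card ι : ℝ) ≤ rb ^ 2) (hrb : 0 ≤ rb) (hβ : ‖U * Vᵀ‖ ≤ β)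
    (hB : ‖bal U V‖ ≤ 1) : ‖U‖ ^ 2 ≤ rb * (β + 1) := by
  have h0 : 0 ≤ β := (norm_nonneg _).trans hβ
  -- Since `Vᵀ V = Uᵀ U - bal U V`, a bounded product and a small imbalance bound the Gram matrix
  -- `Uᵀ U`. Its trace is `‖U‖ ^ 2`, and Cauchy–Schwarz against the identity costs the square root
  -- of the number of columns.
  have h1 : ‖U * Vᵀ‖ ^ 2 = ‖Uᵀ * U‖ ^ 2 - ip (Uᵀ * U) (bal U V) := by
    rw [norm_sq_eq_ip, norm_sq_eq_ip, bal, ip_sub_right, sub_sub_cancel]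
    rw [ip_mul_left, ip_comm, ← Matrix.mul_assoc, ip_mul_right, transpose_transpose]
  have h2 := ip_le (Uᵀ * U) (bal U V)
  have h3 : ‖Uᵀ * U‖ ≤ β + 1 := by
    by_contra! hc
    have h4 : ‖U * Vᵀ‖ ^ 2 ≤ β ^ 2 := pow_le_pow_left₀ (norm_nonneg _) hβ 2
    nlinarith [mul_le_mul_of_nonneg_left hB (norm_nonneg (Uᵀ * U))]
  have h4 : ‖U‖ ^ 2 = ip (1 : Matrix ι ι ℝ) (Uᵀ * U) := by
    rw [norm_sq_eq_ip, ip, ip]; simp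
  have h5 : ‖(1 : Matrix ι ι ℝ)‖ ≤ rb := by
    apply le_of_sq_le_sq _ hrb
    rwa [frobenius_sq_one]
  rw [h4]
  exact (ip_le _ _).trans (mul_le_mul h5 h3 (norm_nonneg _) hrb)

/-- In `Uᵀ Φ - Ψᵀ V` the terms with the gradient of `f` cancel, and half of `Uᵀ U B + B Vᵀ V`
remains, where `B` is the imbalance. Paired with `B` this is half of `‖U B‖² + ‖V B‖²`, and the left
inverse `Vᵀ X` of `U` turns `‖U B‖` into `‖B‖`. -/
lemma norm_bal_le [DecidableEq ι] {G : Matrix m n ℝ → Matrix m n ℝ} {U : Matrix m ι ℝ}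
    {V : Matrix n ι ℝ} {X : Matrix n m ℝ} {b x : ℝ} (hU : ‖U‖ ≤ b) (hV : ‖V‖ ≤ b)
    (hX : ‖X‖ ≤ x) (hinv : Vᵀ * X * U = 1) :
    ‖bal U V‖ ≤ 2 * (b * x) ^ 2 * b * (‖facGradU G U V‖ + ‖facGradV G U V‖) := by
  set Φ := facGradU G U V
  set Ψ := facGradV G U V
  have hb : 0 ≤ b := (norm_nonneg _).trans hU
  have hx : 0 ≤ x := (norm_nonneg _).trans hX
  have h1 : Uᵀ * Φ - Ψᵀ * V = (1 / 2 : ℝ) • (Uᵀ * U * bal U V + bal U V * (Vᵀ * V)) := by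
    simp only [Φ, Ψ, facGradU, facGradV, transpose_sub, transpose_mul, transpose_smul,
      transpose_transpose, bal_transpose, Matrix.mul_add, Matrix.sub_mul, smul_add,
      Matrix.mul_smul, Matrix.smul_mul, Matrix.mul_assoc]
    abel
  have h2 : ip (bal U V) (Uᵀ * U * bal U V) = ‖U * bal U V‖ ^ 2 := by
    rw [norm_sq_eq_ip, ip_mul_left, Matrix.mul_assoc]
  have h3 : ip (bal U V) (bal U V * (Vᵀ * V)) = ‖V * bal U V‖ ^ 2 := by
    rw [← ip_transpose, transpose_mul, transpose_mul, transpose_transpose, bal_transpose,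
      norm_sq_eq_ip, ip_mul_left, Matrix.mul_assoc]
  have h4 : ‖bal U V‖ ≤ b * x * ‖U * bal U V‖ := by
    have : bal U V = Vᵀ * X * (U * bal U V) := by
      rw [← Matrix.mul_assoc, hinv, Matrix.one_mul]
    nth_rewrite 1 [this]
    exact norm_mul_le_of_le (norm_mul_le_of_le (norm_transpose_le hV) hX) le_rfl
  have h5 : ip (bal U V) (Uᵀ * Φ - Ψᵀ * V) ≤ ‖bal U V‖ * (b * (‖Φ‖ + ‖Ψ‖)) := by
    refine (ip_le _ _).trans (mul_le_mul_of_nonneg_left ?_ (norm_nonneg _))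
    refine (norm_sub_le _ _).trans ?_
    have ha := norm_mul_le_of_le (norm_transpose_le hU) (le_refl ‖Φ‖)
    have hb := norm_mul_le_of_le (norm_transpose_le (le_refl ‖Ψ‖)) hV
    linarith
  rw [h1, ip_smul_right, ip_add_right, h2, h3] at h5
  have h6 : ‖bal U V‖ ^ 2 ≤ (b * x) ^ 2 * ‖U * bal U V‖ ^ 2 := by
    rw [← mul_pow]; exact pow_le_pow_left₀ (norm_nonneg _) h4 2
  have h7 : ‖bal U V‖ * ‖bal U V‖ ≤
      ‖bal U V‖ * (2 * (b * x) ^ 2 * b * (‖Φ‖ + ‖Ψ‖)) := by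
    have h8 : ‖U * bal U V‖ ^ 2 ≤ 2 * (‖bal U V‖ * (b * (‖Φ‖ + ‖Ψ‖))) := by
      nlinarith [sq_nonneg ‖V * bal U V‖]
    have h9 := mul_le_mul_of_nonneg_left h8 (sq_nonneg (b * x))
    nlinarith
  rcases (norm_nonneg (bal U V)).eq_or_lt with h | h
  · rw [← h]; positivity
  · exact le_of_mul_le_mul_left h7 h

/-- With `Θ = U Vᵀ`, `X` is a generalized inverse: `Θ X Θ = Θ`. The first three terms have the form
`U Aᵀ + B Vᵀ`, so they are tangent to the factorization at `Θ`. What is left is `(1 - Θ X) Δ (1 - X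
Θ) = -(1 - Θ X) Θs (1 - X Θ)`, and inserting `Θs = Θs Xs Θs` shows that it is quadratic in the error
`Δ`. -/
lemma delta_decomp [DecidableEq ι] [DecidableEq m] [DecidableEq n] {Θs : Matrix m n ℝ}
    {U : Matrix m ι ℝ}
    {V : Matrix n ι ℝ} {X Xs : Matrix n m ℝ} (hinv : Vᵀ * X * U = 1)
    (hXs : Θs * Xs * Θs = Θs) :
    U * Vᵀ - Θs = U * (Vᵀ * X * (U * Vᵀ - Θs)) + (U * Vᵀ - Θs) * (X * U) * Vᵀ -
      U * (Vᵀ * X * (U * Vᵀ - Θs) * (X * U)) * Vᵀ -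
      ((U * Vᵀ - Θs) - U * (Vᵀ * X * (U * Vᵀ - Θs))) * Xs *
        ((U * Vᵀ - Θs) - (U * Vᵀ - Θs) * (X * U) * Vᵀ) := by
  set Θ := U * Vᵀ with hΘ
  set Δ := Θ - Θs with hΔ
  have hU : U * Vᵀ * X * U = U := by
    rw [Matrix.mul_assoc U, Matrix.mul_assoc U, hinv, Matrix.mul_one]
  have hV : Vᵀ * X * U * Vᵀ = Vᵀ := by rw [hinv, Matrix.one_mul]
  have e1 : U * (Vᵀ * X * Δ) = (Θ * X) * Δ := by simp only [hΘ, Matrix.mul_assoc]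
  have e2 : Δ * (X * U) * Vᵀ = Δ * (X * Θ) := by simp only [hΘ, Matrix.mul_assoc]
  have e3 : U * (Vᵀ * X * Δ * (X * U)) * Vᵀ = (Θ * X) * Δ * (X * Θ) := by
    simp only [hΘ, Matrix.mul_assoc]
  have e4 : Θ * X * Θ = Θ := by
    rw [hΘ, ← Matrix.mul_assoc, hU]
  rw [e1, e2, e3]
  have f1 : Δ - Θ * X * Δ = -((1 - Θ * X) * Θs) := by
    rw [hΔ, Matrix.mul_sub, e4, Matrix.sub_mul, Matrix.one_mul]; abel
  have f2 : Δ - Δ * (X * Θ) = -(Θs * (1 - X * Θ)) := by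
    have : Θ * (X * Θ) = Θ := by rw [← Matrix.mul_assoc, e4]
    rw [hΔ, Matrix.sub_mul, this, Matrix.mul_sub, Matrix.mul_one]; abel
  have f3 : (Δ - Θ * X * Δ) * Xs * (Δ - Δ * (X * Θ)) =
      (1 - Θ * X) * Θs * (1 - X * Θ) := by
    rw [f1, f2, Matrix.neg_mul, Matrix.neg_mul, Matrix.mul_neg, neg_neg]
    conv_rhs => rw [← hXs]
    simp only [Matrix.mul_assoc]
  have f4 : (1 - Θ * X) * Θ = 0 := by rw [Matrix.sub_mul, e4, Matrix.one_mul, sub_self]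
  have f5 : (1 - Θ * X) * Θs * (1 - X * Θ) = -((1 - Θ * X) * Δ * (1 - X * Θ)) := by
    have : (1 - Θ * X) * Θs = -((1 - Θ * X) * Δ) := by
      rw [hΔ, Matrix.mul_sub, f4]; simp
    rw [this, Matrix.neg_mul]
  rw [f3, f5]
  simp only [Matrix.sub_mul, Matrix.mul_sub, Matrix.one_mul, Matrix.mul_one]
  abel

/-- Near `Θs` the error is controlled by the partial gradients. -/
lemma norm_delta_le [DecidableEq ι] [DecidableEq m] [DecidableEq n] {f : Matrix m n ℝ → ℝ}
    {G : Matrix m n ℝ → Matrix m n ℝ} {Θs : Matrix m n ℝ} {L μ : ℝ}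
    (hf : Landscape f G Θs L μ) (hL : 0 ≤ L) {U : Matrix m ι ℝ} {V : Matrix n ι ℝ}
    {X Xs : Matrix n m ℝ} {b x ε : ℝ}
    (hinv : Vᵀ * X * U = 1) (hXs : Θs * Xs * Θs = Θs)
    (hU : ‖U‖ ≤ b) (hV : ‖V‖ ≤ b) (hX : ‖X‖ ≤ x) (hXsn : ‖Xs‖ ≤ x)
    (hΔ : ‖U * Vᵀ - Θs‖ ≤ ε) (hε : ε ≤ 1) (hε1 : L * ((1 + b ^ 2 * x) ^ 2 * x) * ε ≤ μ / 2)
    (hε2 : (1 + b ^ 2 * x) ^ 2 * x * ε ≤ 1) :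
    μ / 2 * ‖U * Vᵀ - Θs‖ ≤ 2 * ‖G Θs‖ +
      (b * x + b ^ 3 * x ^ 2) * (‖(G (U * Vᵀ))ᵀ * U‖ + ‖G (U * Vᵀ) * V‖) := by
  have hb : 0 ≤ b := (norm_nonneg _).trans hU
  have hx : 0 ≤ x := (norm_nonneg _).trans hX
  have hdec := delta_decomp (U := U) (V := V) hinv hXs
  set Δ := U * Vᵀ - Θs with hΔdef
  set g := G (U * Vᵀ) with hg
  have hVX : ‖Vᵀ * X‖ ≤ b * x := norm_mul_le_of_le (norm_transpose_le hV) hX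
  have hXU : ‖X * U‖ ≤ x * b := norm_mul_le_of_le hX hU
  have hVXΔ := norm_mul_le_of_le hVX (le_refl ‖Δ‖)
  have hΔXU := norm_mul_le_of_le (le_refl ‖Δ‖) hXU
  -- On the three tangent terms the gradient acts only through `gᵀ U` and `g V`; the quadratic term
  -- is bounded crudely in `t4`.
  have t1 : ip g (U * (Vᵀ * X * Δ)) ≤ ‖gᵀ * U‖ * (b * x * ‖Δ‖) := by
    rw [ip_comm, ip_mul_left, ip_comm]
    refine (ip_le _ _).trans ?_
    have : ‖Uᵀ * g‖ = ‖gᵀ * U‖ := by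
      rw [← frobenius_norm_transpose, transpose_mul, transpose_transpose]
    rw [this]
    exact mul_le_mul_of_nonneg_left hVXΔ (norm_nonneg _)
  have t2 : ip g (Δ * (X * U) * Vᵀ) ≤ ‖g * V‖ * (‖Δ‖ * (x * b)) := by
    rw [ip_comm, ip_mul_right, transpose_transpose, ip_comm]
    exact (ip_le _ _).trans (mul_le_mul_of_nonneg_left hΔXU (norm_nonneg _))
  have t3 : -ip g (U * (Vᵀ * X * Δ * (X * U)) * Vᵀ) ≤
      ‖g * V‖ * (b * (b * x * ‖Δ‖ * (x * b))) := by
    rw [ip_comm, ip_mul_right, transpose_transpose, ip_comm]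
    have := neg_le_ip (g * V) (U * (Vᵀ * X * Δ * (X * U)))
    have h2 := mul_le_mul_of_nonneg_left
      (norm_mul_le_of_le hU (norm_mul_le_of_le hVXΔ hXU)) (norm_nonneg (g * V))
    linarith
  have s1 : ‖Δ - U * (Vᵀ * X * Δ)‖ ≤ (1 + b ^ 2 * x) * ‖Δ‖ := by
    refine (norm_sub_le _ _).trans ?_
    have := norm_mul_le_of_le hU hVXΔ
    nlinarith
  have s2 : ‖Δ - Δ * (X * U) * Vᵀ‖ ≤ (1 + b ^ 2 * x) * ‖Δ‖ := by
    refine (norm_sub_le _ _).trans ?_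
    have := norm_mul_le_of_le hΔXU (norm_transpose_le hV)
    nlinarith
  have hgn : ‖g‖ ≤ L * ‖Δ‖ + ‖G Θs‖ := by
    have := hf.lipschitz (U * Vᵀ) Θs
    have h2 := norm_add_le (G (U * Vᵀ) - G Θs) (G Θs)
    rw [sub_add_cancel] at h2
    linarith
  have t4 : -ip g ((Δ - U * (Vᵀ * X * Δ)) * Xs * (Δ - Δ * (X * U) * Vᵀ)) ≤
      (L * ‖Δ‖ + ‖G Θs‖) * ((1 + b ^ 2 * x) ^ 2 * x * ‖Δ‖ * ‖Δ‖) := by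
    have h1 := neg_le_ip g ((Δ - U * (Vᵀ * X * Δ)) * Xs * (Δ - Δ * (X * U) * Vᵀ))
    have h2 := norm_mul_le_of_le (norm_mul_le_of_le s1 hXsn) s2
    have h3 := mul_le_mul hgn h2 (norm_nonneg _) (by positivity)
    refine (neg_le_neg h1).trans ?_
    rw [neg_neg]
    refine h3.trans (le_of_eq (by ring))
  have hmain : ip g Δ ≤ ‖gᵀ * U‖ * (b * x * ‖Δ‖) + ‖g * V‖ * (‖Δ‖ * (x * b)) +
      ‖g * V‖ * (b * (b * x * ‖Δ‖ * (x * b))) +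
      (L * ‖Δ‖ + ‖G Θs‖) * ((1 + b ^ 2 * x) ^ 2 * x * ‖Δ‖ * ‖Δ‖) := by
    have : ip g Δ = ip g (U * (Vᵀ * X * Δ)) + ip g (Δ * (X * U) * Vᵀ) -
        ip g (U * (Vᵀ * X * Δ * (X * U)) * Vᵀ) -
        ip g ((Δ - U * (Vᵀ * X * Δ)) * Xs * (Δ - Δ * (X * U) * Vᵀ)) := by
      conv_lhs => rw [hdec]
      rw [ip_sub_right, ip_sub_right, ip_add_right]
    linarith
  have hlow : μ * ‖Δ‖ ^ 2 - ‖G Θs‖ * ‖Δ‖ ≤ ip g Δ := by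
    have h1 := hf.lower (U * Vᵀ) (hΔ.trans hε)
    have h2 := hf.lower' (U * Vᵀ) (hΔ.trans hε)
    rw [← neg_sub (U * Vᵀ), ip_neg_right] at h2
    rw [← hΔdef] at h1 h2
    have h3 := neg_le_ip (G Θs) Δ
    linarith
  rcases (norm_nonneg Δ).eq_or_lt with h0 | h0
  · rw [← h0, mul_zero]; positivity
  apply le_of_mul_le_mul_right _ h0
  set a := ‖Δ‖
  set y := (1 + b ^ 2 * x) ^ 2 * x with hy
  have hy0 : 0 ≤ y := by positivity
  -- The quadratic term is paid for by half of the strong convexity (`hε1`) and by a second copy of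
  -- the noise `‖G Θs‖` (`hε2`).
  have q1 : L * a * (y * a * a) ≤ μ / 2 * a ^ 2 := by
    have : L * y * a ≤ μ / 2 := le_trans (mul_le_mul_of_nonneg_left hΔ (by positivity)) hε1
    linear_combination mul_le_mul_of_nonneg_right this (sq_nonneg a)
  have q2 : ‖G Θs‖ * (y * a * a) ≤ ‖G Θs‖ * a := by
    apply mul_le_mul_of_nonneg_left _ (norm_nonneg _)
    have : y * a ≤ 1 := le_trans (mul_le_mul_of_nonneg_left hΔ hy0) hε2
    linear_combination mul_le_mul_of_nonneg_right this h0.le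
  have q3 : 0 ≤ ‖gᵀ * U‖ * (b ^ 3 * x ^ 2) * a := by positivity
  linear_combination hlow + hmain + q1 + q2 + q3

/-- A thin singular value decomposition with singular values at least `σ`. -/
structure ThinSVD [DecidableEq ι] (Θs : Matrix m n ℝ) (P : Matrix m ι ℝ) (s : ι → ℝ)
    (Q : Matrix n ι ℝ) (σ : ℝ) : Prop where
  left : Pᵀ * P = 1
  right : Qᵀ * Q = 1
  eq : Θs = P * diagonal s * Qᵀ
  le : ∀ i, σ ≤ s i

section ThinSVD

variable [DecidableEq ι] {Θs : Matrix m n ℝ} {P : Matrix m ι ℝ} {s : ι → ℝ}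
  {Q : Matrix n ι ℝ} {σ rb : ℝ}

lemma norm_of_orthonormal_cols_le (hP : Pᵀ * P = 1) (hr : (Fintype.card ι : ℝ) ≤ rb ^ 2)
    (hrb : 0 ≤ rb) : ‖P‖ ≤ rb := by
  apply le_of_sq_le_sq _ hrb
  rw [norm_sq_eq_ip, ip, hP]
  simpa using hr

lemma norm_diagonal_inv_le (hs : ∀ i, σ ≤ s i) (hσ : 0 < σ)
    (hr : (Fintype.card ι : ℝ) ≤ rb ^ 2) (hrb : 0 ≤ rb) :
    ‖diagonal (fun i => (s i)⁻¹)‖ ≤ rb / σ := by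
  apply le_of_sq_le_sq _ (by positivity)
  rw [norm_sq_eq_ip, ip]
  simp only [diagonal_transpose, diagonal_mul_diagonal, trace_diagonal]
  calc ∑ i, (s i)⁻¹ * (s i)⁻¹ ≤ ∑ _i : ι, σ⁻¹ * σ⁻¹ := by
        apply Finset.sum_le_sum
        intro i _
        have : (s i)⁻¹ ≤ σ⁻¹ := inv_anti₀ hσ (hs i)
        have h0 : 0 < s i := hσ.trans_le (hs i)
        exact mul_le_mul this this (by positivity) (by positivity)
    _ = Fintype.card ι * (σ⁻¹ * σ⁻¹) := by simp
    _ ≤ rb ^ 2 * (σ⁻¹ * σ⁻¹) := mul_le_mul_of_nonneg_right hr (by positivity)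
    _ = _ := by field_simp

/-- The pseudo-inverse of `Θs`. -/
lemma ThinSVD.exists_pinv (h : ThinSVD Θs P s Q σ) (hσ : 0 < σ)
    (hr : (Fintype.card ι : ℝ) ≤ rb ^ 2) (hrb : 0 ≤ rb) :
    ∃ Xs : Matrix n m ℝ, Θs * Xs = P * Pᵀ ∧ Xs * Θs = Q * Qᵀ ∧ Θs * Xs * Θs = Θs ∧
      ‖Xs‖ ≤ rb * (rb / σ) * rb := by
  have hd : diagonal s * diagonal (fun i => (s i)⁻¹) = 1 := by
    rw [diagonal_mul_diagonal, ← diagonal_one]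
    congr 1; ext i
    exact mul_inv_cancel₀ (hσ.trans_le (h.le i)).ne'
  have hd' : diagonal (fun i => (s i)⁻¹) * diagonal s = 1 := mul_eq_one_comm.1 hd
  have e1 : Θs * (Q * diagonal (fun i => (s i)⁻¹) * Pᵀ) = P * Pᵀ := by
    calc _ = P * (diagonal s * (Qᵀ * Q) * diagonal (fun i => (s i)⁻¹)) * Pᵀ := by
          rw [h.eq]; simp only [Matrix.mul_assoc]
      _ = _ := by rw [h.right, Matrix.mul_one, hd, Matrix.mul_one]
  refine ⟨Q * diagonal (fun i => (s i)⁻¹) * Pᵀ, e1, ?_, ?_, ?_⟩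
  · calc _ = Q * (diagonal (fun i => (s i)⁻¹) * (Pᵀ * P) * diagonal s) * Qᵀ := by
          rw [h.eq]; simp only [Matrix.mul_assoc]
      _ = _ := by rw [h.left, Matrix.mul_one, hd', Matrix.mul_one]
  · rw [e1]
    calc P * Pᵀ * Θs = P * (Pᵀ * P) * diagonal s * Qᵀ := by
          rw [h.eq]; simp only [Matrix.mul_assoc]
      _ = Θs := by rw [h.left, Matrix.mul_one, h.eq]
  · exact norm_mul_le_of_le (norm_mul_le_of_le (norm_of_orthonormal_cols_le h.right hr hrb)
      (norm_diagonal_inv_le h.le hσ hr hrb))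
      (norm_transpose_le (norm_of_orthonormal_cols_le h.left hr hrb))

/-- Near `Θs` the compression `Pᵀ Θ Q` is a small relative perturbation of `diagonal s`, invertible
by a Neumann series, and `X = Q (Pᵀ Θ Q)⁻¹ Pᵀ`. It depends on `Θ` only, not on how `Θ` is factored.
-/
lemma ThinSVD.exists_inv (h : ThinSVD Θs P s Q σ) (hσ : 0 < σ)
    (hr : (Fintype.card ι : ℝ) ≤ rb ^ 2) (hrb : 0 ≤ rb) {ε : ℝ}
    (hε : rb / σ * (rb * ε * rb) ≤ 1 / 2) {Θ : Matrix m n ℝ} (hΘ : ‖Θ - Θs‖ ≤ ε) :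
    ∃ X : Matrix n m ℝ, ‖X‖ ≤ rb * (2 * (rb / σ)) * rb ∧
      ∀ (U : Matrix m ι ℝ) (V : Matrix n ι ℝ), U * Vᵀ = Θ → Vᵀ * X * U = 1 := by
  set Dinv := diagonal (fun i => (s i)⁻¹) with hDinv
  have hd : diagonal s * Dinv = 1 := by
    rw [diagonal_mul_diagonal, ← diagonal_one]
    congr 1; ext i
    exact mul_inv_cancel₀ (hσ.trans_le (h.le i)).ne'
  have hd' : Dinv * diagonal s = 1 := mul_eq_one_comm.1 hd
  have hP := norm_of_orthonormal_cols_le h.left hr hrb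
  have hQ := norm_of_orthonormal_cols_le h.right hr hrb
  have hDn := norm_diagonal_inv_le h.le hσ hr hrb
  set E := Pᵀ * (Θ - Θs) * Q with hE
  have hEn : ‖E‖ ≤ rb * ε * rb :=
    norm_mul_le_of_le (norm_mul_le_of_le (norm_transpose_le hP) hΘ) hQ
  have hDE : ‖Dinv * E‖ ≤ 1 / 2 := (norm_mul_le_of_le hDn hEn).trans hε
  have hS : Pᵀ * Θ * Q = diagonal s * (1 + Dinv * E) := by
    rw [Matrix.mul_add, Matrix.mul_one, ← Matrix.mul_assoc, hd, Matrix.one_mul, hE,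
      Matrix.mul_sub, Matrix.sub_mul]
    have : Pᵀ * Θs * Q = diagonal s := by
      calc Pᵀ * Θs * Q = (Pᵀ * P) * diagonal s * (Qᵀ * Q) := by
            rw [h.eq]; simp only [Matrix.mul_assoc]
        _ = _ := by rw [h.left, h.right, Matrix.one_mul, Matrix.mul_one]
    rw [this]; abel
  have hunit : IsUnit (1 + Dinv * E) := by
    have : IsUnit (1 - -(Dinv * E)) :=
      isUnit_one_sub_of_norm_lt_one (by rw [norm_neg]; linarith)
    rwa [sub_neg_eq_add] at this
  obtain ⟨R, hR⟩ := hunit.exists_right_inv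
  have hRn : ‖R * Dinv‖ ≤ 2 * (rb / σ) := by
    have h1 : R * Dinv = Dinv - Dinv * E * (R * Dinv) := by
      have : Dinv = (1 + Dinv * E) * R * Dinv := by rw [hR, Matrix.one_mul]
      have h2 : (1 + Dinv * E) * R * Dinv = R * Dinv + Dinv * E * (R * Dinv) := by
        rw [Matrix.add_mul, Matrix.one_mul, Matrix.add_mul, Matrix.mul_assoc (Dinv * E)]
      rw [h2] at this
      nth_rewrite 2 [this]
      abel
    have h2 : ‖R * Dinv‖ ≤ rb / σ + 1 / 2 * ‖R * Dinv‖ := by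
      nth_rewrite 1 [h1]
      exact (norm_sub_le _ _).trans (add_le_add hDn (norm_mul_le_of_le hDE le_rfl))
    linarith
  have hST : Pᵀ * Θ * Q * (R * Dinv) = 1 := by
    rw [hS, Matrix.mul_assoc, ← Matrix.mul_assoc _ R, hR, Matrix.one_mul, hd]
  refine ⟨Q * (R * Dinv) * Pᵀ, norm_mul_le_of_le (norm_mul_le_of_le hQ hRn)
    (norm_transpose_le hP), ?_⟩
  rintro U V rfl
  -- Both factors are square, so a right inverse is also a left inverse, and the order can be
  -- exchanged.
  have h1 : (Pᵀ * U) * (Vᵀ * Q * (R * Dinv)) = 1 := by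
    rw [← hST]; simp only [Matrix.mul_assoc]
  have h2 := mul_eq_one_comm.1 h1
  rw [← h2]; simp only [Matrix.mul_assoc]

end ThinSVD

end Factored

/-! ### Local linear convergence of alternating gradient descent. -/

section Convergence

variable {m n ι : Type*} [Fintype m] [Fintype n] [Fintype ι]

/-- One step of alternating gradient descent on `f(U Vᵀ) + ‖Uᵀ U - Vᵀ V‖² / 8`. -/
noncomputable def altStep (G : Matrix m n ℝ → Matrix m n ℝ) (η : ℝ)
    (UV : Matrix m ι ℝ × Matrix n ι ℝ) : Matrix m ι ℝ × Matrix n ι ℝ :=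
  (UV.1 - η • facGradU G UV.1 UV.2,
    UV.2 - η • facGradV G (UV.1 - η • facGradU G UV.1 UV.2) UV.2)

variable {f : Matrix m n ℝ → ℝ} {G : Matrix m n ℝ → Matrix m n ℝ} {Θs : Matrix m n ℝ} {L μ : ℝ}

lemma Landscape.norm_grad_le (hf : Landscape f G Θs L μ) (hL : 0 ≤ L) (hγ : ‖G Θs‖ ≤ 1)
    {Θ : Matrix m n ℝ} (hΘ : ‖Θ - Θs‖ ≤ 1) : ‖G Θ‖ ≤ L + 1 := by
  have h1 := hf.lipschitz Θ Θs
  have h2 := norm_add_le (G Θ - G Θs) (G Θs)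
  rw [sub_add_cancel] at h2
  have h3 := mul_le_mul_of_nonneg_left hΘ hL
  linarith

/-- Sufficient decrease along one step of alternating gradient descent. -/
lemma altStep_descent (hf : Landscape f G Θs L μ) (hL : 0 ≤ L) (hγ : ‖G Θs‖ ≤ 1)
    {U : Matrix m ι ℝ} {V : Matrix n ι ℝ} {b η : ℝ} (hU : ‖U‖ ≤ b) (hV : ‖V‖ ≤ b)
    (hB : ‖bal U V‖ ≤ 1) (hΔ : ‖U * Vᵀ - Θs‖ ≤ 1 / 2) (hη : 0 ≤ η)
    (h1 : η * ((L + 1) * b + 1 / 2 * (b * 1)) ≤ 1)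
    (h1b : η * ((L + 1) * b + 1 / 2 * (b * 1)) * b ≤ 1 / 4)
    (h2 : η * ((L + 1) * (b + 1) + 1 / 2 * ((b + 1) * (2 * b + 2))) ≤ 1)
    (h2b : η * ((L + 1) * (b + 1) + 1 / 2 * ((b + 1) * (2 * b + 2))) * (b + 1) ≤ 1 / 4)
    (h3 : η * (L * b * (b + 1) + (L + 1) + 1 / 2 * (b * (2 * b + 1))) ≤ 1)
    (hK : η * (L / 2 * (b + 1) ^ 2 +
      1 / 8 * (2 * (2 * b + 2) + (2 * (b + 1) + 1) ^ 2)) ≤ 1 / 2) :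
    ‖(altStep G η (U, V)).1 * (altStep G η (U, V)).2ᵀ - Θs‖ ≤ 1 ∧
    facObj f (altStep G η (U, V)).1 (altStep G η (U, V)).2 ≤ facObj f U V -
      η / 6 * (‖facGradU G U V‖ ^ 2 + ‖facGradV G U V‖ ^ 2) := by
  have hb : 0 ≤ b := (norm_nonneg _).trans hU
  have hG : ‖G (U * Vᵀ)‖ ≤ L + 1 := hf.norm_grad_le hL hγ (hΔ.trans (by norm_num))
  set Φ := facGradU G U V with hΦ
  have hΦn : ‖Φ‖ ≤ (L + 1) * b + 1 / 2 * (b * 1) := norm_facGradU_le hU hV hG hB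
  have hηΦ : η * ‖Φ‖ ≤ η * ((L + 1) * b + 1 / 2 * (b * 1)) := mul_le_mul_of_nonneg_left hΦn hη
  set D := -(η • Φ) with hD
  have hDn : ‖D‖ = η * ‖Φ‖ := by rw [hD, norm_neg, norm_smul, Real.norm_of_nonneg hη]
  have hD1 : ‖D‖ ≤ 1 := by rw [hDn]; exact hηΦ.trans h1
  set U' := U - η • Φ with hU'
  have hUD : U' = U + D := sub_eq_add_neg _ _
  have hU'n : ‖U'‖ ≤ b + 1 := by
    rw [hUD]; exact (norm_add_le _ _).trans (add_le_add hU hD1)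
  have hB' : ‖bal U' V‖ ≤ 2 * b + 2 := by
    rw [hUD, bal_add]
    refine (norm_add_le _ _).trans ?_
    have := norm_bal_incr_le hU hD1
    have := mul_le_mul_of_nonneg_left hD1 (show 0 ≤ 2 * b + 1 by positivity)
    linarith
  have hΔ' : ‖U' * Vᵀ - U * Vᵀ‖ ≤ 1 / 4 := by
    rw [hUD, Matrix.add_mul, add_sub_cancel_left]
    refine (norm_mul_le_of_le (hDn.le.trans hηΦ) (norm_transpose_le hV)).trans h1b
  have hΔs : ‖U' * Vᵀ - Θs‖ ≤ 3 / 4 := by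
    have := norm_add_le (U' * Vᵀ - U * Vᵀ) (U * Vᵀ - Θs)
    rw [sub_add_sub_cancel] at this
    linarith
  have hG' : ‖G (U' * Vᵀ)‖ ≤ L + 1 := hf.norm_grad_le hL hγ (hΔs.trans (by norm_num))
  set Ψ := facGradV G U' V with hΨ
  have hΨswap : Ψ = facGradU (fun Θ => (G Θᵀ)ᵀ) V U' := (facGradU_swap G U' V).symm
  have hVn : ‖V‖ ≤ b + 1 := hV.trans (by linarith)
  have hΨn : ‖Ψ‖ ≤ (L + 1) * (b + 1) + 1 / 2 * ((b + 1) * (2 * b + 2)) := by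
    rw [hΨswap]
    apply norm_facGradU_le hVn hU'n
    · rw [transpose_mul, transpose_transpose, frobenius_norm_transpose]; exact hG'
    · rw [norm_bal_swap]; exact hB'
  have hηΨ : η * ‖Ψ‖ ≤ η * ((L + 1) * (b + 1) + 1 / 2 * ((b + 1) * (2 * b + 2))) :=
    mul_le_mul_of_nonneg_left hΨn hη
  have hstep : altStep G η (U, V) = (U', V - η • Ψ) := rfl
  rw [hstep]
  constructor
  · have e : U' * (V - η • Ψ)ᵀ - Θs = U' * Vᵀ - Θs - U' * (η • Ψ)ᵀ := by
      rw [transpose_sub, Matrix.mul_sub]; abel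
    have h4 : ‖U' * (η • Ψ)ᵀ‖ ≤ (b + 1) * (η * ‖Ψ‖) :=
      norm_mul_le_of_le hU'n (norm_transpose_le
        (by rw [norm_smul, Real.norm_of_nonneg hη]))
    have h5 : (b + 1) * (η * ‖Ψ‖) ≤ 1 / 4 :=
      (mul_le_mul_of_nonneg_left hηΨ (by linarith)).trans (by rw [mul_comm]; exact h2b)
    dsimp only
    rw [e]
    have := norm_sub_le (U' * Vᵀ - Θs) (U' * (η • Ψ)ᵀ)
    linarith
  · have d1 : facObj f U' V ≤ facObj f U V - η / 2 * ‖Φ‖ ^ 2 := by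
      refine facObj_step_le hL hf.smooth hU hV hB hη (hηΦ.trans h1) (le_trans ?_ hK)
      apply mul_le_mul_of_nonneg_left _ hη
      linear_combination mul_nonneg hL hb + 1 / 2 * hL + 3 / 2 * hb
    have d2 : facObj f U' (V - η • Ψ) ≤ facObj f U' V - η / 2 * ‖Ψ‖ ^ 2 := by
      have := facObj_step_le (f := fun Θ => f Θᵀ) (β := 2 * b + 2) hL hf.transpose.smooth hVn hU'n
        (by rw [norm_bal_swap]; exact hB') hη (by rw [← hΨswap]; exact hηΨ.trans h2) hK
      rw [← hΨswap, facObj_swap, facObj_swap] at this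
      exact this
    -- The second half-step uses the gradient at `(U', V)`, which differs from the one at `(U, V)`
    -- by at most `‖Φ‖`. This is why the gain `η / 2` of each half-step becomes `η / 6` in terms of
    -- the gradients at `(U, V)`.
    have d3 : ‖facGradV G U V‖ ≤ ‖Ψ‖ + ‖Φ‖ := by
      have h4 := norm_facGradV_sub_le hf.lipschitz hL hU hV hG hD1
      rw [← hUD, ← hΨ, hDn] at h4
      have h5 := norm_sub_le Ψ (Ψ - facGradV G U V)
      rw [sub_sub_cancel] at h5
      have h6 := mul_le_mul_of_nonneg_right h3 (norm_nonneg Φ)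
      linear_combination h4 + h5 + h6
    have d4 : ‖facGradV G U V‖ ^ 2 ≤ 2 * ‖Ψ‖ ^ 2 + 2 * ‖Φ‖ ^ 2 := by
      have := pow_le_pow_left₀ (norm_nonneg _) d3 2
      linear_combination this + sq_nonneg (‖Ψ‖ - ‖Φ‖)
    dsimp only
    linear_combination d1 + d2 + mul_le_mul_of_nonneg_left d4 (show 0 ≤ η / 6 by positivity) +
      1 / 6 * mul_nonneg hη (sq_nonneg ‖Ψ‖)

variable [DecidableEq ι] [DecidableEq m] [DecidableEq n]

/-- Near `Θs`, the error and the imbalance are controlled by the partial gradients. -/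
lemma sq_error_le (hf : Landscape f G Θs L μ) (hL : 0 ≤ L) (hμ : 0 < μ) {U : Matrix m ι ℝ}
    {V : Matrix n ι ℝ} {X Xs : Matrix n m ℝ} {b x ε : ℝ}
    (hinv : Vᵀ * X * U = 1) (hXs : Θs * Xs * Θs = Θs)
    (hU : ‖U‖ ≤ b) (hV : ‖V‖ ≤ b) (hX : ‖X‖ ≤ x) (hXsn : ‖Xs‖ ≤ x)
    (hΔ : ‖U * Vᵀ - Θs‖ ≤ ε) (hε : ε ≤ 1) (hε1 : L * ((1 + b ^ 2 * x) ^ 2 * x) * ε ≤ μ / 2)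
    (hε2 : (1 + b ^ 2 * x) ^ 2 * x * ε ≤ 1) {CB CD : ℝ} (hCB : CB = 2 * (b * x) ^ 2 * b)
    (hCD : CD = (b * x + b ^ 3 * x ^ 2) * (1 + b * CB)) :
    ‖U * Vᵀ - Θs‖ ^ 2 + ‖bal U V‖ ^ 2 ≤ (2 * CB ^ 2 + 4 / μ ^ 2 * (8 + 4 * CD ^ 2)) *
      (‖facGradU G U V‖ ^ 2 + ‖facGradV G U V‖ ^ 2 + ‖G Θs‖ ^ 2) := by
  have hb : 0 ≤ b := (norm_nonneg _).trans hU
  have hx : 0 ≤ x := (norm_nonneg _).trans hX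
  have hCB0 : 0 ≤ CB := by rw [hCB]; positivity
  have hCD0 : 0 ≤ CD := by rw [hCD]; positivity
  have h1 := norm_bal_le (G := G) hU hV hX hinv
  rw [← hCB] at h1
  have h2 := norm_delta_le hf hL hinv hXs hU hV hX hXsn hΔ hε hε1 hε2
  set φ := ‖facGradU G U V‖ with hφ
  set ψ := ‖facGradV G U V‖ with hψ
  set γ := ‖G Θs‖
  have hφ0 : 0 ≤ φ := norm_nonneg _
  have hψ0 : 0 ≤ ψ := norm_nonneg _
  have hγ0 : 0 ≤ γ := norm_nonneg _
  have h3 : ‖G (U * Vᵀ) * V‖ ≤ φ + 1 / 2 * (b * ‖bal U V‖) := by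
    have e : G (U * Vᵀ) * V = facGradU G U V - (1 / 2 : ℝ) • (U * bal U V) := by
      simp [facGradU]
    rw [e]
    refine (norm_sub_le _ _).trans (add_le_add le_rfl ?_)
    rw [norm_smul, Real.norm_of_nonneg (by norm_num)]
    exact mul_le_mul_of_nonneg_left (norm_mul_le_of_le hU le_rfl) (by norm_num)
  have h4 : ‖(G (U * Vᵀ))ᵀ * U‖ ≤ ψ + 1 / 2 * (b * ‖bal U V‖) := by
    have e : (G (U * Vᵀ))ᵀ * U = facGradV G U V + (1 / 2 : ℝ) • (V * bal U V) := by
      simp [facGradV]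
    rw [e]
    refine (norm_add_le _ _).trans (add_le_add le_rfl ?_)
    rw [norm_smul, Real.norm_of_nonneg (by norm_num)]
    exact mul_le_mul_of_nonneg_left (norm_mul_le_of_le hV le_rfl) (by norm_num)
  have h5 : μ / 2 * ‖U * Vᵀ - Θs‖ ≤ 2 * γ + CD * (φ + ψ) := by
    refine h2.trans ?_
    rw [hCD, mul_assoc]
    refine add_le_add le_rfl (mul_le_mul_of_nonneg_left ?_ (by positivity))
    have := mul_le_mul_of_nonneg_left h1 hb
    linear_combination h3 + h4 + this
  have h6 : ‖bal U V‖ ^ 2 ≤ 2 * CB ^ 2 * (φ ^ 2 + ψ ^ 2) := by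
    have := pow_le_pow_left₀ (norm_nonneg _) h1 2
    linear_combination this + mul_nonneg (sq_nonneg CB) (sq_nonneg (φ - ψ))
  have h7 : ‖U * Vᵀ - Θs‖ ^ 2 ≤ 4 / μ ^ 2 * (8 * γ ^ 2 + 4 * CD ^ 2 * (φ ^ 2 + ψ ^ 2)) := by
    have h8 := pow_le_pow_left₀ (by positivity) h5 2
    have h9 : (2 * γ + CD * (φ + ψ)) ^ 2 ≤ 8 * γ ^ 2 + 4 * CD ^ 2 * (φ ^ 2 + ψ ^ 2) := by
      linear_combination sq_nonneg (2 * γ - CD * (φ + ψ)) +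
        2 * mul_nonneg (sq_nonneg CD) (sq_nonneg (φ - ψ))
    rw [div_mul_eq_mul_div, le_div_iff₀ (by positivity)]
    linear_combination 4 * h8 + 4 * h9
  have h10 : 4 / μ ^ 2 * (8 * γ ^ 2 + 4 * CD ^ 2 * (φ ^ 2 + ψ ^ 2)) ≤
      4 / μ ^ 2 * ((8 + 4 * CD ^ 2) * (φ ^ 2 + ψ ^ 2 + γ ^ 2)) := by
    apply mul_le_mul_of_nonneg_left _ (by positivity)
    linear_combination 4 * mul_nonneg (sq_nonneg CD) (sq_nonneg γ) + 8 * sq_nonneg φ +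
      8 * sq_nonneg ψ
  have h11 : 2 * CB ^ 2 * (φ ^ 2 + ψ ^ 2) ≤ 2 * CB ^ 2 * (φ ^ 2 + ψ ^ 2 + γ ^ 2) := by
    apply mul_le_mul_of_nonneg_left _ (by positivity)
    linarith [sq_nonneg γ]
  linear_combination h6 + h7 + h10 + h11

lemma facObj_sub_le (hf : Landscape f G Θs L μ) (U : Matrix m ι ℝ)
    (V : Matrix n ι ℝ) : facObj f U V - f Θs ≤
      ‖G Θs‖ * ‖U * Vᵀ - Θs‖ + L / 2 * ‖U * Vᵀ - Θs‖ ^ 2 + 1 / 8 * ‖bal U V‖ ^ 2 := by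
  have h1 := hf.smooth Θs (U * Vᵀ - Θs)
  rw [add_sub_cancel] at h1
  have h2 := ip_le (G Θs) (U * Vᵀ - Θs)
  unfold facObj
  linarith

/-- With `facObj_sub_le`, the excess energy is comparable to squared error plus squared imbalance,
up to the squared noise. Inside the unit ball a low energy level therefore keeps an iterate close to
`Θs` and nearly balanced. -/
lemma le_facObj_sub (hf : Landscape f G Θs L μ) (hμ : 0 < μ) {U : Matrix m ι ℝ}
    {V : Matrix n ι ℝ} (h : ‖U * Vᵀ - Θs‖ ≤ 1) :
    μ / 4 * ‖U * Vᵀ - Θs‖ ^ 2 + 1 / 8 * ‖bal U V‖ ^ 2 - ‖G Θs‖ ^ 2 / μ ≤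
      facObj f U V - f Θs := by
  have h1 := hf.lower _ h
  have h2 := neg_le_ip (G Θs) (U * Vᵀ - Θs)
  have h3 : ‖G Θs‖ * ‖U * Vᵀ - Θs‖ ≤ μ / 4 * ‖U * Vᵀ - Θs‖ ^ 2 + ‖G Θs‖ ^ 2 / μ := by
    have e : μ / 4 * ‖U * Vᵀ - Θs‖ ^ 2 + ‖G Θs‖ ^ 2 / μ - ‖G Θs‖ * ‖U * Vᵀ - Θs‖ =
        (μ * ‖U * Vᵀ - Θs‖ / 2 - ‖G Θs‖) ^ 2 / μ := by
      field_simp; ring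
    have : 0 ≤ (μ * ‖U * Vᵀ - Θs‖ / 2 - ‖G Θs‖) ^ 2 / μ := by positivity
    linarith
  unfold facObj
  linarith

/-- Serves to meet finitely many smallness conditions on one parameter at once. -/
lemma eventually_mul_le (A : ℝ) {t : ℝ} (ht : 0 < t) :
    ∀ᶠ ε in nhdsWithin (0 : ℝ) (Set.Ioi 0), A * ε ≤ t := by
  have h : Filter.Tendsto (fun ε => A * ε) (nhdsWithin (0 : ℝ) (Set.Ioi 0)) (nhds (A * 0)) :=
    (Filter.tendsto_id.mono_left nhdsWithin_le_nhds).const_mul A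
  rw [mul_zero] at h
  exact h.eventually_le_const ht

/-- Local linear convergence of alternating gradient descent, up to the gradient at `Θs`. -/
theorem altStep_converges {L μ σ β rb : ℝ} (hL : 0 ≤ L) (hμ : 0 < μ) (hσ : 0 < σ) (hβ : 0 ≤ β)
    (hrb : 0 < rb) :
    ∃ c₁ > 0, ∃ c₂ > 0, ∃ c₃ > 0, ∃ C > 0, ∃ ρ > 0, ρ * c₁ ≤ 1 / 2 ∧
    ∀ {m n ι : Type} [Fintype m] [Fintype n] [Fintype ι] [DecidableEq m] [DecidableEq n]
      [DecidableEq ι] {f : Matrix m n ℝ → ℝ} {G : Matrix m n ℝ → Matrix m n ℝ}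
      {Θs : Matrix m n ℝ} {P : Matrix m ι ℝ} {s : ι → ℝ} {Q : Matrix n ι ℝ},
      Landscape f G Θs L μ → ThinSVD Θs P s Q σ → ‖Θs‖ ≤ β →
      (Fintype.card ι : ℝ) ≤ rb ^ 2 → ‖G Θs‖ ≤ c₃ → ∀ η, 0 < η → η ≤ c₁ →
      ∀ UV : Matrix m ι ℝ × Matrix n ι ℝ, bal UV.1 UV.2 = 0 → ‖UV.1 * UV.2ᵀ - Θs‖ ≤ c₂ →
      ∀ k, ‖((altStep G η)^[k] UV).1 * ((altStep G η)^[k] UV).2ᵀ - Θs‖ ^ 2 ≤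
        C * ((1 - ρ * η) ^ k + ‖G Θs‖ ^ 2) := by
  -- A bound for the factors: `norm_factor_sq_le` gives `‖U‖ ^ 2 ≤ rb * (β + 2)`, which is at most
  -- `b ^ 2` because `b ≥ 1`.
  set b := rb * (β + 2) + 1 with hbdef
  have hb1 : 1 ≤ b := by have : 0 ≤ rb * (β + 2) := by positivity
                         linarith
  have hb : 0 < b := by linarith
  set x := rb * (2 * (rb / σ)) * rb with hxdef
  have hx : 0 < x := by positivity
  obtain ⟨CB, hCB⟩ : ∃ CB, CB = 2 * (b * x) ^ 2 * b := ⟨_, rfl⟩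
  obtain ⟨CD, hCD⟩ : ∃ CD, CD = (b * x + b ^ 3 * x ^ 2) * (1 + b * CB) := ⟨_, rfl⟩
  obtain ⟨C1, hC1⟩ : ∃ C1, C1 = 2 * CB ^ 2 + 4 / μ ^ 2 * (8 + 4 * CD ^ 2) := ⟨_, rfl⟩
  have hC1p : 0 < C1 := by rw [hC1]; positivity
  obtain ⟨C3, hC3⟩ : ∃ C3, C3 = (L / 2 + 1) * C1 := ⟨_, rfl⟩
  have hC3p : 0 < C3 := by rw [hC3]; positivity
  -- `C3` bounds the energy above the noise by the squared gradients, and a step gains `η / 6` times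
  -- these.
  obtain ⟨ρ, hρ⟩ : ∃ ρ, ρ = 1 / (6 * C3) := ⟨_, rfl⟩
  have hρp : 0 < ρ := by rw [hρ]; positivity
  -- the radius of the region
  obtain ⟨ε, ⟨⟨⟨hε1, hε2⟩, hε3⟩, hε4⟩, hεp⟩ :=
    ((((eventually_mul_le (L * ((1 + b ^ 2 * x) ^ 2 * x)) (half_pos hμ)).and
      (eventually_mul_le ((1 + b ^ 2 * x) ^ 2 * x) one_pos)).and
      (eventually_mul_le (rb / σ * (rb * rb)) (half_pos one_pos))).and
      (eventually_mul_le 1 (half_pos one_pos))).and self_mem_nhdsWithin |>.exists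
  rw [one_mul] at hε4
  have hεp : 0 < ε := hεp
  -- the energy level
  obtain ⟨τ, ⟨hτ1, hτ2⟩, hτp⟩ :=
    ((eventually_mul_le 2 (show 0 < μ / 4 * ε ^ 2 by positivity)).and
      (eventually_mul_le 16 one_pos)).and self_mem_nhdsWithin |>.exists
  have hτp : 0 < τ := hτp
  -- the learning rate
  obtain ⟨c₁, ⟨⟨⟨⟨⟨⟨h1, h1b⟩, h2⟩, h2b⟩, h3⟩, hK⟩, hρc⟩, hc₁⟩ :=
    (((((((eventually_mul_le ((L + 1) * b + 1 / 2 * (b * 1)) one_pos).and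
      (eventually_mul_le (((L + 1) * b + 1 / 2 * (b * 1)) * b)
        (show (0 : ℝ) < 1 / 4 by norm_num))).and
      (eventually_mul_le ((L + 1) * (b + 1) + 1 / 2 * ((b + 1) * (2 * b + 2))) one_pos)).and
      (eventually_mul_le (((L + 1) * (b + 1) + 1 / 2 * ((b + 1) * (2 * b + 2))) * (b + 1))
        (show (0 : ℝ) < 1 / 4 by norm_num))).and
      (eventually_mul_le (L * b * (b + 1) + (L + 1) + 1 / 2 * (b * (2 * b + 1))) one_pos)).and
      (eventually_mul_le (L / 2 * (b + 1) ^ 2 +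
        1 / 8 * (2 * (2 * b + 2) + (2 * (b + 1) + 1) ^ 2)) (half_pos one_pos))).and
      (eventually_mul_le ρ (half_pos one_pos))).and self_mem_nhdsWithin |>.exists
  have hc₁ : 0 < c₁ := hc₁
  -- the initial error and the noise
  obtain ⟨c₂, ⟨⟨h4, h5⟩, h6⟩, hc₂⟩ :=
    (((eventually_mul_le 1 (show 0 < min 1 (τ / 2) by positivity)).and
      (eventually_mul_le (L / 2) (half_pos hτp))).and
      (eventually_mul_le 1 (show (0 : ℝ) < 1 by norm_num))).and self_mem_nhdsWithin |>.exists
  have hc₂ : 0 < c₂ := hc₂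
  obtain ⟨c₃, ⟨h7, h8⟩, hc₃⟩ :=
    ((eventually_mul_le 1 one_pos).and (eventually_mul_le (1 / μ) hτp)).and
      self_mem_nhdsWithin |>.exists
  have hc₃ : 0 < c₃ := hc₃
  rw [one_mul] at h4 h6 h7
  refine ⟨c₁, hc₁, c₂, hc₂, c₃, hc₃, 4 / μ * (τ + (C3 + 1) + 1 / μ), by positivity, ρ, hρp, hρc,
    ?_⟩
  intro m n ι _ _ _ _ _ _ f G Θs P s Q hf hsvd hΘβ hcard hγ η hη hηc UV hbal0 hinit
  set γ := ‖G Θs‖ with hγdef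
  have hγ0 : 0 ≤ γ := norm_nonneg _
  have hγ1 : γ ≤ 1 := hγ.trans h7
  have hγτ : γ ^ 2 / μ ≤ τ := by
    have : γ ^ 2 ≤ c₃ := by
      rw [sq]; simpa using mul_le_mul hγ hγ1 hγ0 hc₃.le
    calc γ ^ 2 / μ ≤ c₃ / μ := div_le_div_of_nonneg_right this hμ.le
      _ = 1 / μ * c₃ := by ring
      _ ≤ τ := h8
  have hmono : ∀ {A t : ℝ}, 0 ≤ A → A * c₁ ≤ t → η * A ≤ t := fun hA h =>
    (mul_comm η _ ▸ mul_le_mul_of_nonneg_left hηc hA).trans h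
  have hρη : 0 ≤ 1 - ρ * η := by
    have := hmono hρp.le hρc
    linarith [mul_comm ρ η]
  obtain ⟨Xs, -, -, hXs, hXsn⟩ := hsvd.exists_pinv hσ hcard hrb.le
  have hXsn' : ‖Xs‖ ≤ x := hXsn.trans (by
    rw [hxdef]
    have : 0 ≤ rb * (rb / σ) * rb := by positivity
    linear_combination this)
  -- The iterates are trapped: energy at most `τ` and error at most `1` force error at most `ε` and
  -- imbalance at most `1`, where the error bound applies. The conjunct `≤ 1` must be carried along
  -- because strong convexity is known only there. Counted above the level `(C3 + 1) * γ ^ 2`, the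
  -- energy contracts by `1 - ρ * η`.
  have key : ∀ k, ‖((altStep G η)^[k] UV).1 * ((altStep G η)^[k] UV).2ᵀ - Θs‖ ≤ 1 ∧
      facObj f ((altStep G η)^[k] UV).1 ((altStep G η)^[k] UV).2 - f Θs ≤ τ ∧
      facObj f ((altStep G η)^[k] UV).1 ((altStep G η)^[k] UV).2 - f Θs - (C3 + 1) * γ ^ 2 ≤
        (1 - ρ * η) ^ k * τ := by
    intro k
    induction k with
    | zero =>
      simp only [Function.iterate_zero, id_eq, pow_zero, one_mul]
      have hE := facObj_sub_le hf UV.1 UV.2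
      rw [hbal0, norm_zero, ← hγdef] at hE
      have hd : 0 ≤ ‖UV.1 * UV.2ᵀ - Θs‖ := norm_nonneg _
      have e1 : γ * ‖UV.1 * UV.2ᵀ - Θs‖ ≤ τ / 2 := by
        have h9 : c₂ ≤ τ / 2 := h4.trans (min_le_right _ _)
        have := mul_le_mul hγ1 hinit hd zero_le_one
        linarith
      have e2 : L / 2 * ‖UV.1 * UV.2ᵀ - Θs‖ ^ 2 ≤ τ / 2 := by
        have : ‖UV.1 * UV.2ᵀ - Θs‖ ^ 2 ≤ c₂ := by
          rw [sq]; simpa using mul_le_mul hinit (hinit.trans h6) hd hc₂.le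
        exact (mul_le_mul_of_nonneg_left this (by positivity)).trans h5
      have e3 : facObj f UV.1 UV.2 - f Θs ≤ τ := by linarith
      have e4 : 0 ≤ (C3 + 1) * γ ^ 2 := by positivity
      exact ⟨hinit.trans h6, e3, by linarith⟩
    | succ k ih =>
      rw [Function.iterate_succ_apply']
      set UVk := (altStep G η)^[k] UV
      obtain ⟨i1, i2, i3⟩ := ih
      have hlow := le_facObj_sub hf hμ i1
      rw [← hγdef] at hlow
      have hΔε : ‖UVk.1 * UVk.2ᵀ - Θs‖ ≤ ε := by
        apply le_of_sq_le_sq _ hεp.le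
        have : μ / 4 * ‖UVk.1 * UVk.2ᵀ - Θs‖ ^ 2 ≤ μ / 4 * ε ^ 2 := by
          linarith [sq_nonneg ‖bal UVk.1 UVk.2‖]
        exact le_of_mul_le_mul_left this (by positivity)
      have hB1 : ‖bal UVk.1 UVk.2‖ ≤ 1 := by
        apply le_of_sq_le_sq _ zero_le_one
        have : 0 ≤ μ / 4 * ‖UVk.1 * UVk.2ᵀ - Θs‖ ^ 2 := by positivity
        linarith
      have hΘn : ‖UVk.1 * UVk.2ᵀ‖ ≤ β + 1 := by
        have := norm_add_le (UVk.1 * UVk.2ᵀ - Θs) Θs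
        rw [sub_add_cancel] at this
        linarith
      have hbsq : rb * (β + 1 + 1) ≤ b ^ 2 := by
        have h9 : rb * (β + 1 + 1) = b - 1 := by rw [hbdef]; ring
        have := mul_le_mul_of_nonneg_left hb1 hb.le
        rw [h9, sq]; linarith
      have hUb : ‖UVk.1‖ ≤ b :=
        le_of_sq_le_sq ((norm_factor_sq_le hcard hrb.le hΘn hB1).trans hbsq) hb.le
      have hVb : ‖UVk.2‖ ≤ b := by
        refine le_of_sq_le_sq ((norm_factor_sq_le (U := UVk.2) (V := UVk.1) (β := β + 1)
          hcard hrb.le ?_ ?_).trans hbsq) hb.le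
        · rw [← frobenius_norm_transpose, transpose_mul, transpose_transpose]; exact hΘn
        · rw [norm_bal_swap]; exact hB1
      obtain ⟨X, hXn, hX⟩ := hsvd.exists_inv hσ hcard hrb.le
        (show rb / σ * (rb * ε * rb) ≤ 1 / 2 by linear_combination hε3) hΔε
      have hinv := hX UVk.1 UVk.2 rfl
      have herr := sq_error_le hf hL hμ hinv hXs hUb hVb hXn hXsn' hΔε (by linarith) hε1 hε2
        hCB hCD
      obtain ⟨s1, s2⟩ := altStep_descent hf hL hγ1 hUb hVb hB1 (hΔε.trans (by linarith)) hη.le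
        (hmono (by positivity) h1) (by rw [mul_assoc]; exact hmono (by positivity) h1b)
        (hmono (by positivity) h2) (by rw [mul_assoc]; exact hmono (by positivity) h2b)
        (hmono (by positivity) h3) (hmono (by positivity) (by linarith))
      have s2' := s2
      refine ⟨s1, ?_, ?_⟩
      · have : 0 ≤ η / 6 * (‖facGradU G UVk.1 UVk.2‖ ^ 2 + ‖facGradV G UVk.1 UVk.2‖ ^ 2) := by
          positivity
        linarith
      · have hup := facObj_sub_le hf UVk.1 UVk.2
        rw [← hγdef] at hup
        rw [← hC1, ← hγdef] at herr
        set E := facObj f UVk.1 UVk.2 - f Θs with hE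
        set S := ‖facGradU G UVk.1 UVk.2‖ ^ 2 + ‖facGradV G UVk.1 UVk.2‖ ^ 2
        set d := ‖UVk.1 * UVk.2ᵀ - Θs‖
        set B := ‖bal UVk.1 UVk.2‖
        have u1 : E ≤ (L / 2 + 1) * (d ^ 2 + B ^ 2) + γ ^ 2 := by
          linear_combination hup + 1 / 2 * sq_nonneg (γ - d) + 1 / 2 * mul_nonneg hL (sq_nonneg B) +
            7 / 8 * sq_nonneg B + 1 / 2 * sq_nonneg d + 1 / 2 * sq_nonneg γ
        have u2 : E ≤ C3 * S + (C3 + 1) * γ ^ 2 := by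
          have := mul_le_mul_of_nonneg_left herr (show 0 ≤ L / 2 + 1 by positivity)
          rw [hC3]
          linear_combination u1 + this
        have u3 : ρ * (E - (C3 + 1) * γ ^ 2) ≤ S / 6 := by
          have : ρ * (E - (C3 + 1) * γ ^ 2) ≤ ρ * (C3 * S) :=
            mul_le_mul_of_nonneg_left (by linarith) hρp.le
          refine this.trans (le_of_eq ?_)
          rw [hρ]; field_simp
        have u4 := mul_le_mul_of_nonneg_left u3 hη.le
        have u5 := mul_le_mul_of_nonneg_left i3 hρη
        rw [pow_succ]
        linear_combination s2' + u4 + u5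
  intro k
  obtain ⟨k1, k2, k3⟩ := key k
  have hlow := le_facObj_sub hf hμ k1
  rw [← hγdef] at hlow
  set UVk := (altStep G η)^[k] UV
  set p := (1 - ρ * η) ^ k with hp
  have hp0 : 0 ≤ p := pow_nonneg hρη k
  have v1 : μ / 4 * ‖UVk.1 * UVk.2ᵀ - Θs‖ ^ 2 ≤ p * τ + (C3 + 1) * γ ^ 2 + γ ^ 2 / μ := by
    linarith [sq_nonneg ‖bal UVk.1 UVk.2‖]
  have v2 : p * τ + (C3 + 1) * γ ^ 2 + γ ^ 2 / μ ≤
      (τ + (C3 + 1) + 1 / μ) * (p + γ ^ 2) := by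
    have a1 : 0 ≤ τ * γ ^ 2 := by positivity
    have a2 : 0 ≤ (C3 + 1) * p := by positivity
    have a3 : 0 ≤ 1 / μ * p := by positivity
    have a4 : γ ^ 2 / μ = 1 / μ * γ ^ 2 := by ring
    rw [a4]
    linear_combination a1 + a2 + a3
  calc ‖UVk.1 * UVk.2ᵀ - Θs‖ ^ 2
      = 4 / μ * (μ / 4 * ‖UVk.1 * UVk.2ᵀ - Θs‖ ^ 2) := by field_simp
    _ ≤ 4 / μ * ((τ + (C3 + 1) + 1 / μ) * (p + γ ^ 2)) :=
        mul_le_mul_of_nonneg_left (v1.trans v2) (by positivity)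
    _ = _ := by ring

end Convergence

/-! ### Rectangular diagonal matrices. -/

section RectDiag

variable {m n k r : ℕ}

lemma rectDiag_transpose (d : ℕ → ℝ) : (rectDiag m n d)ᵀ = rectDiag n m d := by
  ext i j
  simp only [rectDiag, transpose_apply, of_apply, eq_comm (a := j.val)]
  split_ifs with h <;> simp [*]

lemma rectDiag_self (d : ℕ → ℝ) : rectDiag m m d = diagonal fun i => d i.val := by
  ext i j
  simp only [rectDiag, of_apply, diagonal_apply, Fin.ext_iff]

lemma rectDiag_mul (d e : ℕ → ℝ) : rectDiag m k d * rectDiag k n e =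
    rectDiag m n fun i => if i < k then d i * e i else 0 := by
  ext i j
  simp only [rectDiag, mul_apply, of_apply]
  by_cases hi : i.val < k
  · rw [Finset.sum_eq_single ⟨i.val, hi⟩]
    · simp [hi]
    · intro l _ hl
      have : i.val ≠ l.val := fun h => hl (Fin.ext h.symm)
      simp [this]
    · simp
  · rw [Finset.sum_eq_zero]
    · simp [hi]
    · intro l _
      have : i.val ≠ l.val := fun h => hi (h ▸ l.2)
      simp [this]

lemma rectDiag_congr {d e : ℕ → ℝ} (h : ∀ i, i < m → i < n → d i = e i) :
    rectDiag m n d = rectDiag m n e := by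
  ext i j
  simp only [rectDiag, of_apply]
  split_ifs with hij
  · exact h i i.2 (hij ▸ j.2)
  · rfl

lemma rectDiag_gram (d : ℕ → ℝ) (h : k ≤ m) :
    (rectDiag m k d)ᵀ * rectDiag m k d = diagonal fun i => d i.val ^ 2 := by
  rw [rectDiag_transpose, rectDiag_mul, ← rectDiag_self fun i => d i ^ 2]
  apply rectDiag_congr
  intro i hi _
  rw [if_pos (hi.trans_le h), sq]

end RectDiag

/-! ### Singular values and perturbation of singular subspaces. -/

section SVD

variable {m n r : ℕ}

lemma orthogonal_transpose_mul {U : Matrix (Fin m) (Fin m) ℝ}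
    (h : U ∈ Matrix.orthogonalGroup (Fin m) ℝ) : Uᵀ * U = 1 := by
  exact (Matrix.mem_orthogonalGroup_iff' _ _).1 h

lemma orthogonal_mul_transpose {U : Matrix (Fin m) (Fin m) ℝ}
    (h : U ∈ Matrix.orthogonalGroup (Fin m) ℝ) : U * Uᵀ = 1 := by
  exact (Matrix.mem_orthogonalGroup_iff _ _).1 h

lemma norm_isometry_mul {l m n : Type*} [Fintype l] [Fintype m] [Fintype n] [DecidableEq m]
    {U : Matrix l m ℝ} (h : Uᵀ * U = 1) (A : Matrix m n ℝ) : ‖U * A‖ = ‖A‖ := by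
  have : ‖U * A‖ ^ 2 = ‖A‖ ^ 2 := by
    rw [norm_sq_eq_ip, norm_sq_eq_ip, ip_mul_left, ← Matrix.mul_assoc, h, Matrix.one_mul]
  exact (pow_left_inj₀ (norm_nonneg _) (norm_nonneg _) two_ne_zero).1 this

lemma norm_mul_isometry {l m n : Type*} [Fintype l] [Fintype m] [Fintype n] [DecidableEq m]
    {U : Matrix l m ℝ} (h : Uᵀ * U = 1) (A : Matrix n m ℝ) : ‖A * Uᵀ‖ = ‖A‖ := by
  rw [← frobenius_norm_transpose, transpose_mul, transpose_transpose, norm_isometry_mul h,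
    frobenius_norm_transpose]

lemma exists_ne_zero_mulVec_eq_zero (N : Matrix (Fin m) (Fin (r + 1)) ℝ) (h : N.rank ≤ r) :
    ∃ w ≠ 0, N *ᵥ w = 0 := by
  by_contra! hc
  have hinj : Function.Injective N.mulVecLin := by
    rw [injective_iff_map_eq_zero]
    intro w hw
    by_contra hne
    exact hc w hne hw
  have := LinearMap.finrank_range_of_inj hinj
  rw [Module.finrank_fin_fun] at this
  rw [Matrix.rank, this] at h
  omega

/-- A singular value beyond the rank of `M'` is at most the distance to `M'`. -/
lemma IsSVD.le_norm_sub {M M' : Matrix (Fin m) (Fin n) ℝ} {U : Matrix (Fin m) (Fin m) ℝ}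
    {d : ℕ → ℝ} {V : Matrix (Fin n) (Fin n) ℝ} (h : IsSVD M U d V) (hr : M'.rank ≤ r)
    (hm : r < m) (hn : r < n) : d r ≤ ‖M - M'‖ := by
  -- The first `r + 1` right singular vectors span more dimensions than the rank of `M'`, so `M'`
  -- kills some non-zero `F w`; on this span `M` stretches by at least `d r`.
  set F := V * rectDiag n (r + 1) 1
  have hF : Fᵀ * F = 1 := by
    rw [transpose_mul, Matrix.mul_assoc, ← Matrix.mul_assoc Vᵀ,
      orthogonal_transpose_mul h.right_orthogonal, Matrix.one_mul, rectDiag_gram _ hn]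
    simp
  obtain ⟨w, hw0, hw⟩ := exists_ne_zero_mulVec_eq_zero (M' * F)
    ((Matrix.rank_mul_le_left M' F).trans hr)
  set C := replicateCol Unit w
  have hC0 : 0 < ‖C‖ := by
    rw [norm_pos_iff]
    intro hc
    apply hw0
    ext i
    exact congrFun (congrFun hc i) ()
  have h1 : M' * (F * C) = 0 := by
    rw [← Matrix.mul_assoc]
    ext i j
    exact congrFun hw i
  have h2 : M * (F * C) = U * (rectDiag m (r + 1) d * C) := by
    have : rectDiag m n d * rectDiag n (r + 1) 1 = rectDiag m (r + 1) d := by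
      rw [rectDiag_mul]
      apply rectDiag_congr
      intro i _ hi
      rw [if_pos (by omega)]; simp
    rw [h.eq, ← this]
    simp only [F, Matrix.mul_assoc]
    rw [← Matrix.mul_assoc Vᵀ, orthogonal_transpose_mul h.right_orthogonal, Matrix.one_mul]
  have h3 : ‖(M - M') * (F * C)‖ ≤ ‖M - M'‖ * ‖C‖ := by
    rw [← norm_isometry_mul hF C]; exact frobenius_norm_mul _ _
  rw [Matrix.sub_mul, h1, sub_zero, h2,
    norm_isometry_mul (orthogonal_transpose_mul h.left_orthogonal)] at h3
  have h4 : d r * ‖C‖ ≤ ‖rectDiag m (r + 1) d * C‖ := by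
    apply le_of_sq_le_sq _ (norm_nonneg _)
    rw [mul_pow, norm_sq_eq_ip, norm_sq_eq_ip, ip_mul_left, ← Matrix.mul_assoc,
      rectDiag_gram _ hm, ip_eq_sum, ip_eq_sum, Finset.mul_sum]
    apply Finset.sum_le_sum
    intro i _
    rw [Finset.mul_sum]
    apply Finset.sum_le_sum
    intro j _
    rw [diagonal_mul]
    have : d r ^ 2 ≤ d i.val ^ 2 :=
      pow_le_pow_left₀ (h.nonneg r) (h.antitone (Nat.lt_succ_iff.1 i.2)) 2
    nlinarith [mul_le_mul_of_nonneg_right this (mul_self_nonneg (C i j))]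
  exact le_of_mul_le_mul_right (h4.trans h3) hC0

variable {M : Matrix (Fin m) (Fin n) ℝ} {U : Matrix (Fin m) (Fin m) ℝ}
  {d : ℕ → ℝ} {V : Matrix (Fin n) (Fin n) ℝ}

lemma IsSVD.eq_zero_of_rank_le (h : IsSVD M U d V) (hr : M.rank ≤ r) {i : ℕ} (hi : r ≤ i)
    (hm : i < m) (hn : i < n) : d i = 0 := by
  have h1 := h.le_norm_sub hr (hi.trans_lt hm) (hi.trans_lt hn)
  rw [sub_self, norm_zero] at h1
  exact le_antisymm ((h.antitone hi).trans h1) (h.nonneg i)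

/-- Indices start at zero, so `d (r - 1)` is the `r`-th singular value; if it vanished, `M` would
factor through dimension `r - 1`. -/
lemma IsSVD.pos_of_rank_eq (h : IsSVD M U d V) (hr : M.rank = r) (h1 : 1 ≤ r) :
    0 < d (r - 1) := by
  by_contra! hc
  have hz : ∀ i, ¬ i < r - 1 → d i = 0 := fun i hi =>
    le_antisymm ((h.antitone (not_lt.1 hi)).trans hc) (h.nonneg i)
  have : rectDiag m n d = rectDiag m (r - 1) d * rectDiag (r - 1) n 1 := by
    rw [rectDiag_mul]
    apply rectDiag_congr
    intro i _ _
    split_ifs with hi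
    · simp
    · exact hz i hi
  have h2 : M.rank ≤ r - 1 := by
    rw [h.eq, this]
    refine (Matrix.rank_mul_le_left _ _).trans ((Matrix.rank_mul_le_right _ _).trans
      ((Matrix.rank_mul_le_left _ _).trans ?_))
    simpa using Matrix.rank_le_width (rectDiag m (r - 1) d)
  omega

/-- The first `r` columns of a matrix. -/
noncomputable def firstCols (r : ℕ) (U : Matrix (Fin m) (Fin m) ℝ) : Matrix (Fin m) (Fin r) ℝ :=
  U * rectDiag m r 1

lemma firstCols_orthonormal (hU : U ∈ Matrix.orthogonalGroup (Fin m) ℝ) (hr : r ≤ m) :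
    (firstCols r U)ᵀ * firstCols r U = 1 := by
  rw [firstCols, transpose_mul, Matrix.mul_assoc, ← Matrix.mul_assoc Uᵀ,
      orthogonal_transpose_mul hU, Matrix.one_mul, rectDiag_gram _ hr]
  simp

lemma IsSVD.thin (h : IsSVD M U d V) (hr : M.rank ≤ r) (hm : r ≤ m) (hn : r ≤ n) :
    ThinSVD M (firstCols r U) (fun i : Fin r => d i) (firstCols r V) (d (r - 1)) where
  left := firstCols_orthonormal h.left_orthogonal hm
  right := firstCols_orthonormal h.right_orthogonal hn
  eq := by
    have e : rectDiag m n d = rectDiag m r 1 * rectDiag r r d * rectDiag r n 1 := by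
      rw [rectDiag_mul, rectDiag_mul]
      apply rectDiag_congr
      intro i h1 h2
      split_ifs with hi
      · simp
      · exact h.eq_zero_of_rank_le hr (not_lt.1 hi) h1 h2
    rw [← rectDiag_self, firstCols, firstCols, transpose_mul, rectDiag_transpose]
    conv_lhs => rw [h.eq, e]
    simp only [Matrix.mul_assoc]
  le i := h.antitone (by omega)

/-- The orthogonal projection onto the span of the columns of `U` with index at least `r`. -/
noncomputable def perp (r : ℕ) (U : Matrix (Fin m) (Fin m) ℝ) : Matrix (Fin m) (Fin m) ℝ :=
  U * diagonal (fun i : Fin m => if i.val < r then (0 : ℝ) else 1) * Uᵀ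

lemma perp_transpose : (perp r U)ᵀ = perp r U := by
  simp [perp, Matrix.mul_assoc]

lemma perp_mul_perp (hU : U ∈ Matrix.orthogonalGroup (Fin m) ℝ) :
    perp r U * perp r U = perp r U := by
  simp only [perp, Matrix.mul_assoc]
  rw [← Matrix.mul_assoc Uᵀ, orthogonal_transpose_mul hU, Matrix.one_mul,
    ← Matrix.mul_assoc (diagonal _), diagonal_mul_diagonal]
  congr 3
  ext i
  split_ifs <;> simp

lemma trace_perp (hU : U ∈ Matrix.orthogonalGroup (Fin m) ℝ) :
    (perp r U).trace = ∑ i : Fin m, if i.val < r then (0 : ℝ) else 1 := by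
  rw [perp, trace_mul_comm, ← Matrix.mul_assoc, orthogonal_transpose_mul hU, Matrix.one_mul,
    trace_diagonal]

lemma firstCols_mul_transpose (hU : U ∈ Matrix.orthogonalGroup (Fin m) ℝ) :
    firstCols r U * (firstCols r U)ᵀ = 1 - perp r U := by
  have e : rectDiag m r 1 * rectDiag r m 1 =
      1 - diagonal (fun i : Fin m => if i.val < r then (0 : ℝ) else 1) := by
    rw [rectDiag_mul, rectDiag_self, ← diagonal_one, diagonal_sub]
    congr 1; ext i
    split_ifs <;> simp
  rw [firstCols, transpose_mul, rectDiag_transpose, Matrix.mul_assoc U,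
    ← Matrix.mul_assoc (rectDiag m r 1), e, Matrix.sub_mul, Matrix.mul_sub, Matrix.one_mul,
    orthogonal_mul_transpose hU, perp, Matrix.mul_assoc U]

lemma norm_proj_mul_le {k l : Type*} [Fintype k] [Fintype l] {p : Matrix k k ℝ} (ht : pᵀ = p)
    (hp : p * p = p) (A : Matrix k l ℝ) : ‖p * A‖ ≤ ‖A‖ := by
  rcases (norm_nonneg (p * A)).eq_or_lt with h | h
  · rw [← h]; exact norm_nonneg _
  apply le_of_mul_le_mul_right _ h
  have : ‖p * A‖ * ‖p * A‖ = ip A (p * A) := by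
    rw [← sq, norm_sq_eq_ip, ip_mul_left, ht, ← Matrix.mul_assoc, hp]
  rw [this]
  exact ip_le _ _

lemma norm_mul_proj_le {k l : Type*} [Fintype k] [Fintype l] {p : Matrix k k ℝ} (ht : pᵀ = p)
    (hp : p * p = p) (A : Matrix l k ℝ) : ‖A * p‖ ≤ ‖A‖ := by
  rw [← frobenius_norm_transpose, transpose_mul, ht, ← frobenius_norm_transpose A]
  exact norm_proj_mul_le ht hp _

lemma norm_perp_mul_le {l : Type*} [Fintype l] (hU : U ∈ Matrix.orthogonalGroup (Fin m) ℝ)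
    (A : Matrix (Fin m) l ℝ) : ‖perp r U * A‖ ≤ ‖A‖ :=
  norm_proj_mul_le perp_transpose (perp_mul_perp hU) A

lemma norm_mul_perp_le {l : Type*} [Fintype l] (hU : U ∈ Matrix.orthogonalGroup (Fin m) ℝ)
    (A : Matrix l (Fin m) ℝ) : ‖A * perp r U‖ ≤ ‖A‖ :=
  norm_mul_proj_le perp_transpose (perp_mul_perp hU) A

lemma IsSVD.transpose (h : IsSVD M U d V) : IsSVD Mᵀ V d U where
  left_orthogonal := h.right_orthogonal
  right_orthogonal := h.left_orthogonal
  nonneg := h.nonneg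
  antitone := h.antitone
  eq := by
    conv_lhs => rw [h.eq]
    simp only [transpose_mul, transpose_transpose, rectDiag_transpose, Matrix.mul_assoc]

lemma IsSVD.perp_mul (h : IsSVD M U d V) (hr : M.rank ≤ r) : perp r U * M = 0 := by
  have e : diagonal (fun i : Fin m => if i.val < r then (0 : ℝ) else 1) * rectDiag m n d = 0 := by
    ext i j
    rw [diagonal_mul]
    simp only [rectDiag, of_apply, Matrix.zero_apply]
    split_ifs with h1 h2 h2 <;> simp only [zero_mul, mul_zero, one_mul]
    exact h.eq_zero_of_rank_le hr (not_lt.1 h1) i.2 (h2 ▸ j.2)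
  conv_lhs => rw [h.eq, perp]
  simp only [Matrix.mul_assoc]
  rw [← Matrix.mul_assoc Uᵀ, orthogonal_transpose_mul h.left_orthogonal, Matrix.one_mul,
    ← Matrix.mul_assoc (diagonal _), e]
  simp

lemma IsSVD.mul_perp (h : IsSVD M U d V) (hr : M.rank ≤ r) : M * perp r V = 0 := by
  have := h.transpose.perp_mul (r := r) (by rwa [Matrix.rank_transpose])
  rw [← transpose_inj, transpose_mul, perp_transpose, this, transpose_zero]

/-- Perturbation of the projection onto the complement of the column space. -/
lemma norm_perp_sub_perp_le {Us : Matrix (Fin m) (Fin m) ℝ} {Θs : Matrix (Fin m) (Fin n) ℝ}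
    {Xs : Matrix (Fin n) (Fin m) ℝ} {ε x : ℝ} (h : IsSVD M U d V) (hr : M.rank ≤ r)
    (hUs : Us ∈ Matrix.orthogonalGroup (Fin m) ℝ) (hXs : Θs * Xs = 1 - perp r Us)
    (hx : ‖Xs‖ ≤ x) (hε : ‖M - Θs‖ ≤ ε) : ‖perp r U - perp r Us‖ ≤ 2 * (ε * x) := by
  have hU := h.left_orthogonal
  set p := perp r U with hp
  set q := perp r Us with hq
  -- `p` kills `M` and `1 - q = Θs * Xs`, so only the error `M - Θs` survives.
  have h1 : ‖p * (1 - q)‖ ≤ ε * x := by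
    have : p * (1 - q) = -(p * (M - Θs)) * Xs := by
      rw [Matrix.mul_sub p M, h.perp_mul hr, zero_sub, neg_neg, Matrix.mul_assoc, hXs]
    rw [this]
    refine norm_mul_le_of_le ?_ hx
    rw [norm_neg]
    exact (norm_perp_mul_le hU _).trans hε
  have hpp : p * p = p := perp_mul_perp hU
  have hqq : q * q = q := perp_mul_perp hUs
  have hpt : pᵀ = p := perp_transpose
  have hqt : qᵀ = q := perp_transpose
  -- The two projections have equal trace, since both keep the columns of index at least `r`; hence
  -- the two off-diagonal pieces have equal norm.
  have h2 : ‖(1 - p) * q‖ = ‖p * (1 - q)‖ := by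
    have : ‖(1 - p) * q‖ ^ 2 = ‖p * (1 - q)‖ ^ 2 := by
      have e1 : ‖(1 - p) * q‖ ^ 2 = q.trace - (p * q).trace := by
        rw [norm_sq_eq_ip, ip_mul_left, ip, transpose_sub, transpose_one, hpt, hqt,
          ← trace_sub, trace_mul_comm, ← Matrix.mul_assoc]
        congr 1
        simp only [Matrix.mul_sub, Matrix.sub_mul, Matrix.one_mul, Matrix.mul_one, hpp,
          Matrix.mul_assoc, hqq]
        abel
      have e2 : ‖p * (1 - q)‖ ^ 2 = p.trace - (p * q).trace := by
        rw [norm_sq_eq_ip, ip_mul_right, ip, transpose_sub, transpose_one, hpt, hqt,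
          ← trace_sub]
        congr 1
        simp only [Matrix.mul_sub, Matrix.sub_mul, Matrix.mul_one, hqq, Matrix.mul_assoc]
        simp only [← Matrix.mul_assoc, hpp]
        abel
      rw [e1, e2, trace_perp hU, trace_perp hUs]
    exact (pow_left_inj₀ (norm_nonneg _) (norm_nonneg _) two_ne_zero).1 this
  have h3 : p - q = p * (1 - q) - (1 - p) * q := by
    simp only [Matrix.mul_sub, Matrix.sub_mul, Matrix.one_mul, Matrix.mul_one]; abel
  rw [h3]
  have := norm_sub_le (p * (1 - q)) ((1 - p) * q)
  linarith

end SVD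

/-! ### Reduced vectors as matrices. -/

section Embedding

variable {m n r : ℕ}

/-- The matrix with prescribed entries in the blocks `11`, `12`, `21` and zeros in block `22`. -/
noncomputable def padRtv (θ : RtvIdx m n r → ℝ) : Matrix (Fin m) (Fin n) ℝ :=
  Matrix.of fun i j => if h : i.val < r ∨ j.val < r then θ ⟨(i, j), h⟩ else 0

/-- The adjoint of `rtv`. -/
noncomputable def emb (U : Matrix (Fin m) (Fin m) ℝ) (V : Matrix (Fin n) (Fin n) ℝ)
    (θ : RtvIdx m n r → ℝ) : Matrix (Fin m) (Fin n) ℝ :=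
  U * padRtv θ * Vᵀ

lemma ip_padRtv (M : Matrix (Fin m) (Fin n) ℝ) (θ : RtvIdx m n r → ℝ) :
    ip M (padRtv θ) = ∑ p : RtvIdx m n r, M p.1.1 p.1.2 * θ p := by
  rw [ip_eq_sum, ← Fintype.sum_prod_type' (fun i j => M i j * padRtv θ i j)]
  rw [← Fintype.sum_subtype_add_sum_subtype (fun p : Fin m × Fin n => p.1.val < r ∨ p.2.val < r)
    (fun p => M p.1 p.2 * padRtv θ p.1 p.2)]
  rw [Finset.sum_eq_zero (s := (Finset.univ : Finset
    {p : Fin m × Fin n // ¬(p.1.val < r ∨ p.2.val < r)}))]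
  · rw [add_zero]
    apply Finset.sum_congr rfl
    rintro ⟨⟨i, j⟩, h⟩ _
    simp only [padRtv, of_apply, dif_pos h]
  · rintro ⟨⟨i, j⟩, h⟩ _
    simp only [padRtv, of_apply, dif_neg h, mul_zero]

variable {U : Matrix (Fin m) (Fin m) ℝ} {V : Matrix (Fin n) (Fin n) ℝ}

/-- Through this identity the reduced loss and second moment become those on matrices, and the
estimated subspaces enter only through `emb`. -/
lemma rtv_dotProduct (M : Matrix (Fin m) (Fin n) ℝ) (θ : RtvIdx m n r → ℝ) :
    rtv r U V M ⬝ᵥ θ = ip M (emb U V θ) := by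
  have : ip M (emb U V θ) = ip (Uᵀ * M * V) (padRtv θ) := by
    rw [emb, ip_comm, ip_mul_right, ip_mul_left, transpose_transpose, ip_comm, Matrix.mul_assoc]
  rw [this, ip_padRtv]
  rfl

lemma emb_add (θ θ' : RtvIdx m n r → ℝ) : emb U V (θ + θ') = emb U V θ + emb U V θ' := by
  have : padRtv (θ + θ') = padRtv θ + padRtv θ' := by
    ext i j; simp only [padRtv, of_apply, Matrix.add_apply]; split_ifs <;> simp
  simp [emb, this, Matrix.mul_add, Matrix.add_mul]

lemma emb_smul (c : ℝ) (θ : RtvIdx m n r → ℝ) : emb U V (c • θ) = c • emb U V θ := by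
  have : padRtv (c • θ) = c • padRtv θ := by
    ext i j; simp only [padRtv, of_apply, Matrix.smul_apply]; split_ifs <;> simp
  simp [emb, this]

lemma rtv_emb (hU : U ∈ Matrix.orthogonalGroup (Fin m) ℝ)
    (hV : V ∈ Matrix.orthogonalGroup (Fin n) ℝ) (θ : RtvIdx m n r → ℝ) :
    rtv r U V (emb U V θ) = θ := by
  have : Uᵀ * emb U V θ * V = padRtv θ := by
    simp only [emb, Matrix.mul_assoc]
    rw [orthogonal_transpose_mul hV, Matrix.mul_one, ← Matrix.mul_assoc,
      orthogonal_transpose_mul hU, Matrix.one_mul]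
  ext ⟨⟨i, j⟩, h⟩
  simp only [rtv, this, padRtv, of_apply, dif_pos h]

lemma norm_emb_sq (hU : U ∈ Matrix.orthogonalGroup (Fin m) ℝ)
    (hV : V ∈ Matrix.orthogonalGroup (Fin n) ℝ) (θ : RtvIdx m n r → ℝ) :
    ‖emb U V θ‖ ^ 2 = θ ⬝ᵥ θ := by
  rw [norm_sq_eq_ip, ← rtv_dotProduct, rtv_emb hU hV]

/-- Reduction loses exactly the block `22`. Hence the range of `emb` consists of the matrices `M`
with `perp r U * M * perp r V = 0`, the tangent directions used below. -/
lemma emb_rtv (hU : U ∈ Matrix.orthogonalGroup (Fin m) ℝ)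
    (hV : V ∈ Matrix.orthogonalGroup (Fin n) ℝ) (M : Matrix (Fin m) (Fin n) ℝ) :
    emb U V (rtv r U V M) = M - perp r U * M * perp r V := by
  have e : padRtv (rtv r U V M) = Uᵀ * M * V -
      diagonal (fun i : Fin m => if i.val < r then (0 : ℝ) else 1) * (Uᵀ * M * V) *
        diagonal (fun i : Fin n => if i.val < r then (0 : ℝ) else 1) := by
    ext i j
    rw [Matrix.sub_apply, mul_diagonal, diagonal_mul]
    simp only [padRtv, of_apply, rtv]
    by_cases h1 : i.val < r <;> by_cases h2 : j.val < r <;> simp [h1, h2]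
  have e2 : U * (Uᵀ * M * V) * Vᵀ = M := by
    simp only [Matrix.mul_assoc]
    rw [orthogonal_mul_transpose hV, Matrix.mul_one, ← Matrix.mul_assoc,
      orthogonal_mul_transpose hU, Matrix.one_mul]
  rw [emb, e, Matrix.mul_sub, Matrix.sub_mul, e2]
  simp only [perp, Matrix.mul_assoc]

lemma perp_emb_perp (hU : U ∈ Matrix.orthogonalGroup (Fin m) ℝ)
    (hV : V ∈ Matrix.orthogonalGroup (Fin n) ℝ) (θ : RtvIdx m n r → ℝ) :
    perp r U * emb U V θ * perp r V = 0 := by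
  have := emb_rtv (r := r) hU hV (emb U V θ)
  rw [rtv_emb hU hV] at this
  exact sub_eq_self.1 this.symm

lemma emb_rtv_of_perp (hU : U ∈ Matrix.orthogonalGroup (Fin m) ℝ)
    (hV : V ∈ Matrix.orthogonalGroup (Fin n) ℝ) {M : Matrix (Fin m) (Fin n) ℝ}
    (h : perp r U * M * perp r V = 0) : emb U V (rtv r U V M) = M := by
  rw [emb_rtv hU hV, h, sub_zero]

/-- There are at most `(m + n) r` positions. -/
lemma card_rtvIdx_le : (Fintype.card (RtvIdx m n r) : ℝ) ≤ ((m : ℝ) + n) * r := by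
  have h : Fintype.card (RtvIdx m n r) ≤ (m + n) * r := by
    rw [Fintype.card_subtype]
    have hsub : (Finset.univ.filter fun p : Fin m × Fin n => p.1.val < r ∨ p.2.val < r) ⊆
        (Finset.univ.filter fun i : Fin m => i.val < r) ×ˢ (Finset.univ : Finset (Fin n)) ∪
        (Finset.univ : Finset (Fin m)) ×ˢ (Finset.univ.filter fun j : Fin n => j.val < r) := by
      intro p hp
      simpa using hp
    have hcard : ∀ k : ℕ, (Finset.univ.filter fun i : Fin k => i.val < r).card ≤ r := by
      intro k
      have := Finset.card_le_card_of_injOn (s := Finset.univ.filter fun i : Fin k => i.val < r)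
        (t := Finset.range r) Fin.val (by intro i hi; simpa using hi)
        (Fin.val_injective.injOn)
      simpa using this
    refine (Finset.card_le_card hsub).trans ((Finset.card_union_le _ _).trans ?_)
    rw [Finset.card_product, Finset.card_product, Finset.card_univ, Finset.card_univ,
      Fintype.card_fin, Fintype.card_fin]
    nlinarith [Nat.mul_le_mul_right n (hcard m), Nat.mul_le_mul_left m (hcard n)]
  exact_mod_cast h

end Embedding

/-! ### The initial factors. -/

section Init

variable {dx dφ r : ℕ}

lemma fgdInit_mul {U₀ : Matrix (Fin dx) (Fin dx) ℝ} {d₀ : ℕ → ℝ}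
    {V₀ : Matrix (Fin dφ) (Fin dφ) ℝ} (hd : ∀ i, 0 ≤ d₀ i) :
    (fgdInit r U₀ d₀ V₀).1 * (fgdInit r U₀ d₀ V₀).2ᵀ =
      U₀ * (rectDiag dx dφ fun i => if i < r then d₀ i else 0) * V₀ᵀ := by
  simp only [fgdInit, transpose_mul, rectDiag_transpose, Matrix.mul_assoc]
  rw [← Matrix.mul_assoc (rectDiag dx r _), rectDiag_mul]
  simp only [Real.mul_self_sqrt (hd _)]

lemma bal_fgdInit {U₀ : Matrix (Fin dx) (Fin dx) ℝ} {d₀ : ℕ → ℝ}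
    {V₀ : Matrix (Fin dφ) (Fin dφ) ℝ} (hU : U₀ ∈ Matrix.orthogonalGroup (Fin dx) ℝ)
    (hV : V₀ ∈ Matrix.orthogonalGroup (Fin dφ) ℝ) (h1 : r ≤ dx) (h2 : r ≤ dφ) :
    bal (fgdInit r U₀ d₀ V₀).1 (fgdInit r U₀ d₀ V₀).2 = 0 := by
  simp only [bal, fgdInit, transpose_mul, Matrix.mul_assoc]
  rw [← Matrix.mul_assoc U₀ᵀ, ← Matrix.mul_assoc V₀ᵀ, orthogonal_transpose_mul hU,
    orthogonal_transpose_mul hV, Matrix.one_mul, Matrix.one_mul, rectDiag_gram _ h1,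
    rectDiag_gram _ h2, sub_self]

/-- The product of the initial factors is the rank-`r` truncation of `Θ₀`. Each discarded singular
value is at most `‖Θ₀ - Θs‖` by `IsSVD.le_norm_sub`; they are counted crudely by `dx * dφ`, which
`GoodData.dim_le` bounds by constants. -/
lemma norm_fgdInit_sub_le {Θ₀ Θs : Matrix (Fin dx) (Fin dφ) ℝ}
    {U₀ : Matrix (Fin dx) (Fin dx) ℝ} {d₀ : ℕ → ℝ} {V₀ : Matrix (Fin dφ) (Fin dφ) ℝ}
    (h : IsSVD Θ₀ U₀ d₀ V₀) (hr : Θs.rank ≤ r) {D : ℝ} (hD : 0 ≤ D)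
    (hdim : (dx : ℝ) * dφ ≤ D ^ 2) :
    ‖(fgdInit r U₀ d₀ V₀).1 * (fgdInit r U₀ d₀ V₀).2ᵀ - Θs‖ ≤ (1 + D) * ‖Θ₀ - Θs‖ := by
  rw [fgdInit_mul h.nonneg]
  set e : ℕ → ℝ := fun i => if i < r then 0 else d₀ i
  have h1 : U₀ * (rectDiag dx dφ fun i => if i < r then d₀ i else 0) * V₀ᵀ =
      Θ₀ - U₀ * rectDiag dx dφ e * V₀ᵀ := by
    rw [eq_sub_iff_add_eq, ← Matrix.add_mul, ← Matrix.mul_add]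
    conv_rhs => rw [h.eq]
    congr 2
    ext i j
    simp only [rectDiag, Matrix.add_apply, of_apply, e]
    split_ifs <;> simp
  have h2 : ‖U₀ * rectDiag dx dφ e * V₀ᵀ‖ ≤ D * ‖Θ₀ - Θs‖ := by
    rw [norm_mul_isometry (orthogonal_transpose_mul h.right_orthogonal),
      norm_isometry_mul (orthogonal_transpose_mul h.left_orthogonal)]
    apply le_of_sq_le_sq _ (by positivity)
    rw [norm_sq_eq_ip, ip_eq_sum]
    have hent : ∀ (i : Fin dx) (j : Fin dφ),
        rectDiag dx dφ e i j * rectDiag dx dφ e i j ≤ ‖Θ₀ - Θs‖ ^ 2 := by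
      intro i j
      simp only [rectDiag, of_apply, e]
      split_ifs with hij hir
      · nlinarith [sq_nonneg ‖Θ₀ - Θs‖]
      · have hri : r ≤ i.val := not_lt.1 hir
        have hle : d₀ i ≤ ‖Θ₀ - Θs‖ := (h.antitone hri).trans
          (h.le_norm_sub hr (hri.trans_lt i.2) (hri.trans_lt (hij ▸ j.2)))
        rw [sq]
        exact mul_le_mul hle hle (h.nonneg _) (norm_nonneg _)
      · nlinarith [sq_nonneg ‖Θ₀ - Θs‖]
    calc _ ≤ ∑ _i : Fin dx, ∑ _j : Fin dφ, ‖Θ₀ - Θs‖ ^ 2 :=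
          Finset.sum_le_sum fun i _ => Finset.sum_le_sum fun j _ => hent i j
      _ = (dx : ℝ) * dφ * ‖Θ₀ - Θs‖ ^ 2 := by simp [mul_assoc]
      _ ≤ D ^ 2 * ‖Θ₀ - Θs‖ ^ 2 := mul_le_mul_of_nonneg_right hdim (sq_nonneg _)
      _ = _ := by ring
  have h3 : Θ₀ - U₀ * rectDiag dx dφ e * V₀ᵀ - Θs =
      (Θ₀ - Θs) - U₀ * rectDiag dx dφ e * V₀ᵀ := by abel
  rw [h1, h3]
  refine (norm_sub_le _ _).trans ?_
  linarith

end Init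

/-! ### The empirical loss on matrices. -/

section Empirical

variable {dx dφ : ℕ} {S : Type u} {A : Type v} (φ : S → A → EuclideanSpace ℝ (Fin dφ))

lemma bilin_eq_ip (Θ : Matrix (Fin dx) (Fin dφ) ℝ) (x : EuclideanSpace ℝ (Fin dx))
    (v : EuclideanSpace ℝ (Fin dφ)) : bilin Θ x v = ip (outer x v) Θ := by
  rw [ip_eq_sum]
  simp only [bilin, outer, of_apply]
  exact Finset.sum_congr rfl fun i _ => Finset.sum_congr rfl fun j _ => by ring

lemma norm_outer (x : EuclideanSpace ℝ (Fin dx)) (v : EuclideanSpace ℝ (Fin dφ)) :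
    ‖outer x v‖ = ‖x‖ * ‖v‖ := by
  have : ‖outer x v‖ ^ 2 = (‖x‖ * ‖v‖) ^ 2 := by
    rw [norm_sq_eq_ip, ip_eq_sum, mul_pow, EuclideanSpace.real_norm_sq_eq,
      EuclideanSpace.real_norm_sq_eq, Finset.sum_mul_sum]
    simp only [outer, of_apply]
    exact Finset.sum_congr rfl fun i _ => Finset.sum_congr rfl fun j _ => by ring
  exact (pow_left_inj₀ (norm_nonneg _) (by positivity) two_ne_zero).1 this

/-- The matrix `x (φ(s, a₁) - φ(s, a₀))ᵀ` of an observation. -/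
def zmat (o : Obs dx S A) : Matrix (Fin dx) (Fin dφ) ℝ := outer o.1.1 (featDiff φ o.1)

lemma norm_zmat_le {Bx Bφ : ℝ} (hφ : ∀ s a, ‖φ s a‖ ≤ Bφ) {o : Obs dx S A} (ho : ‖o.1.1‖ ≤ Bx) :
    ‖zmat φ o‖ ≤ Bx * (2 * Bφ) := by
  rw [zmat, norm_outer]
  refine mul_le_mul ho ?_ (norm_nonneg _) ((norm_nonneg _).trans ho)
  refine (norm_sub_le _ _).trans ?_
  linarith [hφ o.1.2.1 o.1.2.2.2, hφ o.1.2.1 o.1.2.2.1]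

variable {N : ℕ} (ω : Fin N → Obs dx S A) (T : Finset (Fin N))

/-- The gradient of the average negative log-likelihood. -/
noncomputable def nllGrad (Θ : Matrix (Fin dx) (Fin dφ) ℝ) : Matrix (Fin dx) (Fin dφ) ℝ :=
  (T.card : ℝ)⁻¹ • ∑ t ∈ T,
    (Real.sigmoid (ip (zmat φ (ω t)) Θ) - boolVal (ω t).2) • zmat φ (ω t)

/-- The empirical second moment as a quadratic form on matrices. -/
noncomputable def quadEmp (Δ : Matrix (Fin dx) (Fin dφ) ℝ) : ℝ :=
  (T.card : ℝ)⁻¹ * ∑ t ∈ T, ip (zmat φ (ω t)) Δ ^ 2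

lemma nll_eq (Θ : Matrix (Fin dx) (Fin dφ) ℝ) : nll φ ω T Θ =
    (T.card : ℝ)⁻¹ * ∑ t ∈ T, logisticLoss (ip (zmat φ (ω t)) Θ) (ω t).2 := by
  simp only [nll, bilin_eq_ip, zmat]

lemma ip_nllGrad (Θ H : Matrix (Fin dx) (Fin dφ) ℝ) : ip (nllGrad φ ω T Θ) H =
    (T.card : ℝ)⁻¹ * ∑ t ∈ T,
      (Real.sigmoid (ip (zmat φ (ω t)) Θ) - boolVal (ω t).2) * ip (zmat φ (ω t)) H := by
  rw [nllGrad, ip_smul_left, ip_sum_left]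
  simp only [ip_smul_left]

variable {φ ω T}

lemma nll_le (Θ Θ' : Matrix (Fin dx) (Fin dφ) ℝ) : nll φ ω T Θ' ≤
    nll φ ω T Θ + ip (nllGrad φ ω T Θ) (Θ' - Θ) + 1 / 8 * quadEmp φ ω T (Θ' - Θ) := by
  rw [nll_eq, nll_eq, ip_nllGrad, quadEmp, mul_left_comm, ← mul_add, ← mul_add,
    Finset.mul_sum T (fun t => ip (zmat φ (ω t)) (Θ' - Θ) ^ 2),
    ← Finset.sum_add_distrib, ← Finset.sum_add_distrib]
  apply mul_le_mul_of_nonneg_left _ (by positivity)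
  apply Finset.sum_le_sum
  intro t _
  rw [ip_sub_right]
  exact logisticLoss_le _ _ _

lemma le_nll_of_bound {R β : ℝ} (hZ : ∀ t ∈ T, ‖zmat φ (ω t)‖ ≤ R)
    {Θ Θ' : Matrix (Fin dx) (Fin dφ) ℝ} (h : ‖Θ‖ ≤ β) (h' : ‖Θ'‖ ≤ β) :
    nll φ ω T Θ + ip (nllGrad φ ω T Θ) (Θ' - Θ) +
      Real.exp (-(R * β)) / 8 * quadEmp φ ω T (Θ' - Θ) ≤ nll φ ω T Θ' := by
  rw [nll_eq, nll_eq, ip_nllGrad, quadEmp, mul_left_comm, ← mul_add, ← mul_add,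
    Finset.mul_sum T (fun t => ip (zmat φ (ω t)) (Θ' - Θ) ^ 2),
    ← Finset.sum_add_distrib, ← Finset.sum_add_distrib]
  apply mul_le_mul_of_nonneg_left _ (by positivity)
  apply Finset.sum_le_sum
  intro t ht
  rw [ip_sub_right]
  have hb : ∀ {Θ : Matrix (Fin dx) (Fin dφ) ℝ}, ‖Θ‖ ≤ β → |ip (zmat φ (ω t)) Θ| ≤ R * β :=
    fun hΘ => (abs_ip_le _ _).trans (mul_le_mul (hZ t ht) hΘ (norm_nonneg _)
      ((norm_nonneg _).trans (hZ t ht)))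
  exact le_logisticLoss _ (hb h) (hb h')

lemma nll_convex (Θ Θ' : Matrix (Fin dx) (Fin dφ) ℝ) :
    nll φ ω T Θ + ip (nllGrad φ ω T Θ) (Θ' - Θ) ≤ nll φ ω T Θ' := by
  rw [nll_eq, nll_eq, ip_nllGrad, ← mul_add, ← Finset.sum_add_distrib]
  apply mul_le_mul_of_nonneg_left _ (by positivity)
  apply Finset.sum_le_sum
  intro t ht
  rw [ip_sub_right]
  exact logisticLoss_convex _ _ _

lemma inv_card_mul_sum_le {τ : Type*} {T : Finset τ} {f : τ → ℝ} {c : ℝ} (hc : 0 ≤ c)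
    (h : ∀ t ∈ T, f t ≤ c) : (T.card : ℝ)⁻¹ * ∑ t ∈ T, f t ≤ c := by
  have h1 := Finset.sum_le_card_nsmul T f c h
  rw [nsmul_eq_mul] at h1
  rcases (Nat.cast_nonneg (α := ℝ) T.card).eq_or_lt with h0 | h0
  · rw [← h0]; simpa using hc
  · rw [inv_mul_le_iff₀ h0]; exact h1

lemma norm_nllGrad_sub_le {R : ℝ} (hZ : ∀ t ∈ T, ‖zmat φ (ω t)‖ ≤ R)
    (Θ Θ' : Matrix (Fin dx) (Fin dφ) ℝ) :
    ‖nllGrad φ ω T Θ - nllGrad φ ω T Θ'‖ ≤ R ^ 2 / 4 * ‖Θ - Θ'‖ := by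
  have e : nllGrad φ ω T Θ - nllGrad φ ω T Θ' = (T.card : ℝ)⁻¹ • ∑ t ∈ T,
      (Real.sigmoid (ip (zmat φ (ω t)) Θ) - Real.sigmoid (ip (zmat φ (ω t)) Θ')) •
        zmat φ (ω t) := by
    rw [nllGrad, nllGrad, ← smul_sub, ← Finset.sum_sub_distrib]
    congr 1
    refine Finset.sum_congr rfl fun t _ => ?_
    rw [← sub_smul]; congr 1; ring
  rw [e, norm_smul, norm_inv, Real.norm_natCast]
  refine (mul_le_mul_of_nonneg_left (norm_sum_le _ _) (by positivity)).trans ?_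
  apply inv_card_mul_sum_le (by positivity)
  intro t ht
  have hR : 0 ≤ R := (norm_nonneg _).trans (hZ t ht)
  rw [norm_smul, Real.norm_eq_abs]
  have h1 := abs_sigmoid_sub_le (ip (zmat φ (ω t)) Θ) (ip (zmat φ (ω t)) Θ')
  rw [← ip_sub_right] at h1
  have h2 : |ip (zmat φ (ω t)) (Θ - Θ')| ≤ R * ‖Θ - Θ'‖ :=
    (abs_ip_le _ _).trans (mul_le_mul_of_nonneg_right (hZ t ht) (norm_nonneg _))
  calc _ ≤ (1 / 4 * (R * ‖Θ - Θ'‖)) * R :=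
        mul_le_mul (h1.trans (by linarith)) (hZ t ht) (norm_nonneg _) (by positivity)
    _ = _ := by ring

lemma quadEmp_le {R : ℝ} (hZ : ∀ t ∈ T, ‖zmat φ (ω t)‖ ≤ R) (Δ : Matrix (Fin dx) (Fin dφ) ℝ) :
    quadEmp φ ω T Δ ≤ R ^ 2 * ‖Δ‖ ^ 2 := by
  apply inv_card_mul_sum_le (by positivity)
  intro t ht
  rw [← mul_pow, ← sq_abs]
  exact pow_le_pow_left₀ (abs_nonneg _) ((abs_ip_le _ _).trans
    (mul_le_mul_of_nonneg_right (hZ t ht) (norm_nonneg _))) 2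

/-- Smoothness comes from the bound `1/4` on the slope of the sigmoid. Within distance `1` of `Θs`
the reward differences are at most `R * β`, so the slope is at least `exp (-(R * β)) / 4` there. -/
lemma nll_landscape {R β lam : ℝ} (hZ : ∀ t ∈ T, ‖zmat φ (ω t)‖ ≤ R)
    {Θs : Matrix (Fin dx) (Fin dφ) ℝ}
    (hβ : ∀ Θ : Matrix (Fin dx) (Fin dφ) ℝ, ‖Θ - Θs‖ ≤ 1 → ‖Θ‖ ≤ β)
    (hq : ∀ Δ, lam * ‖Δ‖ ^ 2 ≤ quadEmp φ ω T Δ) :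
    Landscape (nll φ ω T) (nllGrad φ ω T) Θs (R ^ 2 / 4)
      (Real.exp (-(R * β)) / 4 * lam) where
  smooth Θ H := by
    have h1 := nll_le (φ := φ) (ω := ω) (T := T) Θ (Θ + H)
    rw [add_sub_cancel_left] at h1
    have := quadEmp_le hZ H
    linarith
  lower Θ hΘ := by
    have h1 := le_nll_of_bound hZ (hβ Θs (by simp)) (hβ Θ hΘ)
    have := mul_le_mul_of_nonneg_left (hq (Θ - Θs))
      (show 0 ≤ Real.exp (-(R * β)) / 8 by positivity)
    linarith
  lower' Θ hΘ := by
    have h1 := le_nll_of_bound hZ (hβ Θ hΘ) (hβ Θs (by simp))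
    have := mul_le_mul_of_nonneg_left (hq (Θs - Θ))
      (show 0 ≤ Real.exp (-(R * β)) / 8 by positivity)
    rw [norm_sub_rev Θ]
    linarith
  lipschitz := norm_nllGrad_sub_le hZ

lemma hasDerivAt_nll (Θ D : Matrix (Fin dx) (Fin dφ) ℝ) :
    HasDerivAt (fun t : ℝ => nll φ ω T (Θ + t • D)) (ip (nllGrad φ ω T Θ) D) 0 := by
  rw [ip_nllGrad]
  simp only [nll_eq]
  apply HasDerivAt.const_mul
  apply HasDerivAt.fun_sum
  intro t _
  have h1 : HasDerivAt (fun s : ℝ => ip (zmat φ (ω t)) (Θ + s • D)) (ip (zmat φ (ω t)) D) 0 := by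
    simp only [ip_add_right, ip_smul_right]
    simpa using ((hasDerivAt_id (0 : ℝ)).mul_const (ip (zmat φ (ω t)) D)).const_add
      (ip (zmat φ (ω t)) Θ)
  have h2 := hasDerivAt_logisticLoss (ip (zmat φ (ω t)) (Θ + (0 : ℝ) • D)) (ω t).2
  have h3 := h2.comp (0 : ℝ) h1
  rw [zero_smul, add_zero] at h3
  exact h3

end Empirical

/-! ### Directional derivatives of the factored loss. -/

section Gradient

variable {m n ι : Type*} [Fintype m] [Fintype n] [Fintype ι]

lemma hasDerivAt_quartic (a b c d e : ℝ) :
    HasDerivAt (fun t : ℝ => a + b * t + c * t ^ 2 + d * t ^ 3 + e * t ^ 4) b 0 := by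
  have := ((((hasDerivAt_const (0 : ℝ) a).add ((hasDerivAt_id (0 : ℝ)).const_mul b)).add
    ((hasDerivAt_pow 2 (0 : ℝ)).const_mul c)).add ((hasDerivAt_pow 3 (0 : ℝ)).const_mul d)).add
    ((hasDerivAt_pow 4 (0 : ℝ)).const_mul e)
  exact this.congr_deriv (by simp)

/-- Along a line the squared imbalance is a quartic polynomial, so the derivative at `0` is its
linear coefficient. -/
lemma hasDerivAt_facObj_left {f : Matrix m n ℝ → ℝ} {G : Matrix m n ℝ → Matrix m n ℝ}
    (h : ∀ Θ D, HasDerivAt (fun t : ℝ => f (Θ + t • D)) (ip (G Θ) D) 0)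
    (U H : Matrix m ι ℝ) (V : Matrix n ι ℝ) :
    HasDerivAt (fun t : ℝ => facObj f (U + t • H) V) (ip (facGradU G U V) H) 0 := by
  have h1 : HasDerivAt (fun t : ℝ => f ((U + t • H) * Vᵀ)) (ip (G (U * Vᵀ) * V) H) 0 := by
    have := h (U * Vᵀ) (H * Vᵀ)
    rw [ip_comm, ip_mul_right, transpose_transpose, ip_comm] at this
    simpa only [Matrix.add_mul, Matrix.smul_mul] using this
  set E1 := Hᵀ * U + Uᵀ * H
  set E2 := Hᵀ * H
  have h2 : ∀ t : ℝ, ‖bal (U + t • H) V‖ ^ 2 = ip (bal U V) (bal U V) +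
      (4 * ip (U * bal U V) H) * t + (2 * ip (bal U V) E2 + ip E1 E1) * t ^ 2 +
      (2 * ip E1 E2) * t ^ 3 + ip E2 E2 * t ^ 4 := by
    intro t
    have e : bal (U + t • H) V = bal U V + (t • E1 + (t * t) • E2) := by
      rw [bal_add]
      simp only [E1, E2, transpose_smul, Matrix.smul_mul, Matrix.mul_smul, smul_add, smul_smul]
    have h5 : ip (bal U V) (Uᵀ * H) = ip (U * bal U V) H := by
      rw [ip_comm, ip_mul_left, transpose_transpose, ip_comm]
    have h6 : ip (bal U V) (Hᵀ * U) = ip (U * bal U V) H := by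
      rw [← h5, ← ip_transpose, bal_transpose, transpose_mul, transpose_transpose]
    have h7 : ip (bal U V) E1 = 2 * ip (U * bal U V) H := by
      simp only [E1, ip_add_right, h5, h6]; ring
    rw [e, norm_sq_eq_ip]
    simp only [ip_add_left, ip_add_right, ip_smul_left, ip_smul_right, ip_comm E1 (bal U V),
      ip_comm E2 (bal U V), ip_comm E2 E1, h7]
    ring
  have h3 : HasDerivAt (fun t : ℝ => ‖bal (U + t • H) V‖ ^ 2) (4 * ip (U * bal U V) H) 0 := by
    simp only [h2]
    exact hasDerivAt_quartic _ _ _ _ _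
  refine (h1.add (h3.const_mul (1 / 8))).congr_deriv ?_
  rw [facGradU, ip_add_left, ip_smul_left]; ring

lemma hasDerivAt_facObj_right {f : Matrix m n ℝ → ℝ} {G : Matrix m n ℝ → Matrix m n ℝ}
    (h : ∀ Θ D, HasDerivAt (fun t : ℝ => f (Θ + t • D)) (ip (G Θ) D) 0)
    (U : Matrix m ι ℝ) (V K : Matrix n ι ℝ) :
    HasDerivAt (fun t : ℝ => facObj f U (V + t • K)) (ip (facGradV G U V) K) 0 := by
  have := hasDerivAt_facObj_left (f := fun Θ => f Θᵀ) (G := fun Θ => (G Θᵀ)ᵀ)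
    (fun Θ D => by
      have := h Θᵀ Dᵀ
      rw [← ip_transpose, transpose_transpose] at this
      simpa only [transpose_add, transpose_smul] using this) V K U
  simpa only [facGradU_swap, facObj_swap] using this

lemma ip_single [DecidableEq m] [DecidableEq n] (A : Matrix m n ℝ) (i : m) (j : n) :
    ip A (Matrix.single i j 1) = A i j := by
  rw [ip_eq_sum, Finset.sum_eq_single i, Finset.sum_eq_single j]
  · simp
  · intro b _ hb; simp [hb.symm]
  · simp
  · intro b _ hb; simp [hb.symm]
  · simp

end Gradient

/-! ### The algorithm in terms of matrices. -/

section Step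

variable {dx dφ r N : ℕ} {S : Type u} {A : Type v} {φ : S → A → EuclideanSpace ℝ (Fin dφ)}
  {ω : Fin N → Obs dx S A} {T : Finset (Fin N)}

lemma matGrad_eq {m n : ℕ} {f : Matrix (Fin m) (Fin n) ℝ → ℝ} {M G : Matrix (Fin m) (Fin n) ℝ}
    (h : ∀ D, HasDerivAt (fun t : ℝ => f (M + t • D)) (ip G D) 0) : matGrad f M = G := by
  ext i j
  rw [matGrad, of_apply, (h (Matrix.single i j 1)).deriv, ip_single]

lemma fgdStep_eq (η : ℝ) : fgdStep φ ω T (r := r) η = altStep (nllGrad φ ω T) η := by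
  funext UV
  have h1 : ∀ (U : Matrix (Fin dx) (Fin r) ℝ) (V : Matrix (Fin dφ) (Fin r) ℝ),
      matGrad (fun U => facLoss φ ω T U V) U = facGradU (nllGrad φ ω T) U V :=
    fun U V => matGrad_eq fun D => hasDerivAt_facObj_left hasDerivAt_nll U D V
  have h2 : ∀ (U : Matrix (Fin dx) (Fin r) ℝ) (V : Matrix (Fin dφ) (Fin r) ℝ),
      matGrad (fun V => facLoss φ ω T U V) V = facGradV (nllGrad φ ω T) U V :=
    fun U V => matGrad_eq fun D => hasDerivAt_facObj_right hasDerivAt_nll U V D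
  simp only [fgdStep, altStep, h1, h2]

lemma rank_fgdEstimate_le (η : ℝ) (U₀ : Matrix (Fin dx) (Fin dx) ℝ) (d₀ : ℕ → ℝ)
    (V₀ : Matrix (Fin dφ) (Fin dφ) ℝ) (k : ℕ) :
    (fgdEstimate φ ω T r η U₀ d₀ V₀ k).rank ≤ r := by
  refine (Matrix.rank_mul_le_left _ _).trans ?_
  simpa using Matrix.rank_le_width ((fgdStep φ ω T η)^[k] (fgdInit r U₀ d₀ V₀)).1

variable {U : Matrix (Fin dx) (Fin dx) ℝ} {V : Matrix (Fin dφ) (Fin dφ) ℝ}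

lemma nllRtv_eq (θ : RtvIdx dx dφ r → ℝ) :
    nllRtv φ ω T r U V θ = nll φ ω T (emb U V θ) := by
  simp only [nllRtv, nll_eq, zRtv, rtv_dotProduct, zmat]

lemma dotProduct_empSecondMoment (v : RtvIdx dx dφ r → ℝ) :
    v ⬝ᵥ empSecondMoment φ ω T r U V *ᵥ v = quadEmp φ ω T (emb U V v) := by
  simp only [empSecondMoment, quadEmp, smul_mulVec, dotProduct_smul, smul_eq_mul, sum_mulVec,
    dotProduct_sum]
  congr 1
  refine Finset.sum_congr rfl fun t _ => ?_
  rw [vecMulVec_mulVec, dotProduct_smul, zRtv, rtv_dotProduct, dotProduct_comm, rtv_dotProduct]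
  simp [zmat, sq]

lemma empSecondMoment_isHermitian : (empSecondMoment φ ω T r U V).IsHermitian := by
  rw [Matrix.IsHermitian, empSecondMoment, conjTranspose_smul, conjTranspose_sum]
  simp only [conjTranspose_eq_transpose_of_trivial, transpose_vecMulVec, star_trivial]

end Step

/-! ### Hoeffding's inequality for sample averages. -/

section Hoeffding

open ProbabilityTheory

variable {X : Type*} [MeasurableSpace X] {μ : Measure X} [IsProbabilityMeasure μ] {N : ℕ}

/-- Hoeffding's inequality for the average of a bounded centred function of the coordinates. -/
lemma hoeffding_pi {h : X → ℝ} (hm : Measurable h) {B : ℝ}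
    (hb : ∀ᵐ x ∂μ, |h x| ≤ B) (h0 : ∫ x, h x ∂μ = 0) (T : Finset (Fin N)) {s : ℝ} (hs : 0 ≤ s) :
    (Measure.pi fun _ : Fin N => μ).real {ω | s < |(T.card : ℝ)⁻¹ * ∑ t ∈ T, h (ω t)|} ≤
      2 * Real.exp (-(T.card * s ^ 2 / (2 * B ^ 2))) := by
  have hsub : ∀ g : X → ℝ, Measurable g → (∀ᵐ x ∂μ, |g x| ≤ B) → ∫ x, g x ∂μ = 0 →
      (Measure.pi fun _ : Fin N => μ).real {ω | T.card * s ≤ ∑ t ∈ T, g (ω t)} ≤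
        Real.exp (-(T.card * s ^ 2 / (2 * B ^ 2))) := by
    intro g hg hgb hg0
    have h1 : HasSubgaussianMGF g ((‖B - -B‖₊ / 2) ^ 2) μ :=
      hasSubgaussianMGF_of_mem_Icc_of_integral_eq_zero hg.aemeasurable
        (hgb.mono fun x hx => abs_le.1 hx) hg0
    have h2 : ∀ t ∈ T, HasSubgaussianMGF (fun ω : Fin N → X => g (ω t)) ((‖B - -B‖₊ / 2) ^ 2)
        (Measure.pi fun _ : Fin N => μ) := by
      intro t _
      have hmp := measurePreserving_eval (fun _ : Fin N => μ) t
      exact HasSubgaussianMGF.of_map hmp.measurable.aemeasurable (by rwa [hmp.map_eq])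
    have h3 : iIndepFun (fun (t : Fin N) (ω : Fin N → X) => g (ω t))
        (Measure.pi fun _ : Fin N => μ) :=
      iIndepFun_pi (X := fun _ => g) fun _ => hg.aemeasurable
    refine (HasSubgaussianMGF.measure_sum_ge_le_of_iIndepFun h3 h2
      (mul_nonneg (Nat.cast_nonneg _) hs)).trans (Real.exp_le_exp.2 (le_of_eq ?_))
    have hc : (((‖B - -B‖₊ / 2) ^ 2 : NNReal) : ℝ) = B ^ 2 := by
      push_cast
      rw [Real.norm_eq_abs, div_pow, sq_abs]; ring
    rw [Finset.sum_const, nsmul_eq_mul]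
    push_cast
    push_cast at hc
    rw [hc]
    rcases (Nat.cast_nonneg (α := ℝ) T.card).eq_or_lt with h | h
    · rw [← h]; simp
    · by_cases hB : B = 0
      · rw [hB]; simp
      · field_simp
  have hneg := hsub (fun x => -h x) hm.neg (by simpa using hb) (by rw [integral_neg, h0, neg_zero])
  have hpos := hsub h hm hb h0
  have hset : {ω : Fin N → X | s < |(T.card : ℝ)⁻¹ * ∑ t ∈ T, h (ω t)|} ⊆
      {ω | T.card * s ≤ ∑ t ∈ T, h (ω t)} ∪ {ω | T.card * s ≤ ∑ t ∈ T, -h (ω t)} := by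
    intro ω hω
    simp only [Set.mem_ofPred_eq, Set.mem_union, Finset.sum_neg_distrib] at hω ⊢
    rcases (Nat.cast_nonneg (α := ℝ) T.card).eq_or_lt with h | h
    · rw [← h] at hω; simp at hω; linarith
    · rw [abs_mul, abs_inv, Nat.abs_cast, lt_inv_mul_iff₀ h] at hω
      exact (le_abs.1 hω.le)
  refine (measureReal_mono hset).trans ((measureReal_union_le _ _).trans ?_)
  linarith

end Hoeffding

/-! ### Self-normalized concentration by Gaussian mixtures. -/

section SelfNormalized

open ProbabilityTheory ENNReal

lemma integral_exp_linear_sub_sq (s : ℝ) :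
    ∫ x : ℝ, Real.exp (s * x - 2 * x ^ 2) = √(Real.pi / 2) * Real.exp (s ^ 2 / 8) := by
  have h : ∀ x : ℝ, Real.exp (s * x - 2 * x ^ 2) =
      Real.exp (-2 * (x - s / 4) ^ 2) * Real.exp (s ^ 2 / 8) := fun x => by
    rw [← Real.exp_add]; congr 1; ring
  simp only [h]
  rw [integral_mul_const, integral_sub_right_eq_self (fun x => Real.exp (-2 * x ^ 2)),
    integral_gaussian]

lemma integrable_exp_linear_sub_sq (s : ℝ) :
    Integrable fun x : ℝ => Real.exp (s * x - 2 * x ^ 2) := by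
  by_contra hc
  have h := integral_exp_linear_sub_sq s
  rw [integral_undef hc] at h
  have : 0 < √(Real.pi / 2) * Real.exp (s ^ 2 / 8) := by positivity
  linarith

variable {ι : Type*} [Fintype ι]

lemma lintegral_exp_linear_sub_sq (S : ι → ℝ) :
    ∫⁻ u : ι → ℝ, ENNReal.ofReal (Real.exp (S ⬝ᵥ u - 2 * (u ⬝ᵥ u))) =
      ENNReal.ofReal (√(Real.pi / 2) ^ Fintype.card ι * Real.exp (S ⬝ᵥ S / 8)) := by
  have h : ∀ u : ι → ℝ, Real.exp (S ⬝ᵥ u - 2 * (u ⬝ᵥ u)) =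
      ∏ j, Real.exp (S j * u j - 2 * u j ^ 2) := fun u => by
    rw [← Real.exp_sum, dotProduct, dotProduct, Finset.mul_sum, ← Finset.sum_sub_distrib]
    simp only [sq]
  simp only [h]
  have hint : Integrable fun u : ι → ℝ => ∏ j, Real.exp (S j * u j - 2 * u j ^ 2) :=
    Integrable.fintype_prod (μ := fun _ => volume) fun j => integrable_exp_linear_sub_sq (S j)
  rw [← ofReal_integral_eq_lintegral_ofReal hint
    (Filter.Eventually.of_forall fun u => Finset.prod_nonneg fun _ _ => (Real.exp_pos _).le),
    integral_fintype_prod_volume_eq_prod (fun j x => Real.exp (S j * x - 2 * x ^ 2))]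
  simp only [integral_exp_linear_sub_sq]
  rw [Finset.prod_mul_distrib, Finset.prod_const, Finset.card_univ, ← Real.exp_sum, dotProduct,
    Finset.sum_div]
  simp only [sq]

lemma lintegral_exp_neg_sq :
    ∫⁻ u : ι → ℝ, ENNReal.ofReal (Real.exp (-(u ⬝ᵥ u))) =
      ENNReal.ofReal (√Real.pi ^ Fintype.card ι) := by
  have h : ∀ u : ι → ℝ, Real.exp (-(u ⬝ᵥ u)) = ∏ j, Real.exp (-1 * u j ^ 2) := fun u => by
    rw [← Real.exp_sum, dotProduct, ← Finset.sum_neg_distrib]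
    congr 1; exact Finset.sum_congr rfl fun j _ => by ring
  simp only [h]
  have hint : Integrable fun u : ι → ℝ => ∏ j, Real.exp (-1 * u j ^ 2) :=
    Integrable.fintype_prod (μ := fun _ => volume) fun _ => integrable_exp_neg_mul_sq one_pos
  rw [← ofReal_integral_eq_lintegral_ofReal hint
    (Filter.Eventually.of_forall fun u => Finset.prod_nonneg fun _ _ => (Real.exp_pos _).le),
    integral_fintype_prod_volume_eq_prod (fun (_ : ι) x => Real.exp (-1 * x ^ 2))]
  simp only [integral_gaussian]
  rw [Finset.prod_const, Finset.card_univ, div_one]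

variable {X : Type*} [MeasurableSpace X] {μ : Measure X} [IsProbabilityMeasure μ] {N : ℕ}

/-- Self-normalized concentration by the method of mixtures. -/
lemma self_normalized {e : X → ℝ} (he : Measurable e) {w : X → ι → ℝ} (hw : Measurable w)
    (hexp : ∀ a : ι → ℝ, ∫⁻ x, ENNReal.ofReal
      (Real.exp (e x * (w x ⬝ᵥ a) - (w x ⬝ᵥ a) ^ 2 / 2)) ∂μ ≤ 1)
    (T : Finset (Fin N)) (hT : 0 < T.card) {ℓ : ℝ} :
    (Measure.pi fun _ : Fin N => μ) {ω |
      (∀ u : ι → ℝ, (T.card : ℝ)⁻¹ * ∑ t ∈ T, (w (ω t) ⬝ᵥ u) ^ 2 ≤ 2 * (u ⬝ᵥ u)) ∧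
      8 * (Fintype.card ι + ℓ) < (∑ t ∈ T, e (ω t) • w (ω t)) ⬝ᵥ
        (∑ t ∈ T, e (ω t) • w (ω t)) / T.card} ≤ ENNReal.ofReal (Real.exp (-ℓ)) := by
  set k := Fintype.card ι
  have hn : (0 : ℝ) < T.card := Nat.cast_pos.2 hT
  set n : ℝ := (T.card : ℝ)
  have hsn : √n * √n = n := Real.mul_self_sqrt hn.le
  have hsn0 : 0 < √n := Real.sqrt_pos.2 hn
  set ν := Measure.pi fun _ : Fin N => μ
  -- the exponential process at `u / √n`
  let g : (ι → ℝ) → X → ℝ := fun u x => e x * (w x ⬝ᵥ ((√n)⁻¹ • u)) -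
    (w x ⬝ᵥ ((√n)⁻¹ • u)) ^ 2 / 2
  have hgm : Measurable fun p : (ι → ℝ) × X => g p.1 p.2 := by
    have hwd : Measurable fun p : (ι → ℝ) × X => w p.2 ⬝ᵥ ((√n)⁻¹ • p.1) := by
      simp only [dotProduct, Pi.smul_apply, smul_eq_mul]
      refine Finset.measurable_sum _ fun j _ => ?_
      exact ((measurable_pi_apply j).comp (hw.comp measurable_snd)).mul
        (((measurable_pi_apply j).comp measurable_fst).const_mul _)
    exact ((he.comp measurable_snd).mul hwd).sub ((hwd.pow_const 2).div_const 2)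
  -- For fixed `u` the product has mean at most `1` by independence; weighted by the unnormalized
  -- Gaussian `exp (-(u ⬝ᵥ u))` and integrated over `u`, it has mean at most `√π ^ k`.
  let F : (Fin N → X) → (ι → ℝ) → ℝ≥0∞ := fun ω u =>
    ENNReal.ofReal (Real.exp (-(u ⬝ᵥ u))) * ∏ t ∈ T, ENNReal.ofReal (Real.exp (g u (ω t)))
  have hdm : Measurable fun u : ι → ℝ => u ⬝ᵥ u := by
    simp only [dotProduct]
    exact Finset.measurable_sum _ fun j _ =>
      (measurable_pi_apply j).mul (measurable_pi_apply j)
  have hFm : Measurable (Function.uncurry F) := by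
    refine Measurable.mul ?_ (Finset.measurable_prod _ fun t _ => ?_)
    · exact (Real.measurable_exp.comp (hdm.comp measurable_snd).neg).ennreal_ofReal
    · exact (Real.measurable_exp.comp (hgm.comp (measurable_snd.prodMk
        ((measurable_pi_apply t).comp measurable_fst)))).ennreal_ofReal
  have hupper : ∫⁻ ω, (∫⁻ u, F ω u) ∂ν ≤ ENNReal.ofReal (√Real.pi ^ k) := by
    rw [lintegral_lintegral_swap hFm.aemeasurable, ← lintegral_exp_neg_sq]
    apply lintegral_mono
    intro u
    have hgu : Measurable (g u) := hgm.comp (measurable_const.prodMk measurable_id)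
    have hmeas : Measurable fun x => ENNReal.ofReal (Real.exp (g u x)) :=
      (Real.measurable_exp.comp hgu).ennreal_ofReal
    have hind : iIndepFun (fun (t : Fin N) (ω : Fin N → X) =>
        ENNReal.ofReal (Real.exp (g u (ω t)))) ν :=
      iIndepFun_pi (X := fun _ x => ENNReal.ofReal (Real.exp (g u x)))
        fun _ => hmeas.aemeasurable
    have hmt : ∀ t, Measurable fun ω : Fin N → X => ENNReal.ofReal (Real.exp (g u (ω t))) :=
      fun t => hmeas.comp (measurable_pi_apply t)
    simp only [F]
    rw [lintegral_const_mul _ (Finset.measurable_prod _ fun t _ => hmt t),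
      lintegral_prod_eq_prod_lintegral_of_indepFun T _ hind hmt]
    refine mul_le_of_le_one_right' (Finset.prod_le_one' fun t _ => ?_)
    have := (measurePreserving_eval (fun _ : Fin N => μ) t).lintegral_comp hmeas
    exact this.le.trans (hexp _)
  -- On the event the quadratic terms cost at most `u ⬝ᵥ u`, so the mixture dominates a Gaussian
  -- integral equal to `√(π / 2) ^ k` times the exponential of `S ⬝ᵥ S / (8 n)`, which is at least
  -- `c`. Markov's inequality leaves `√2 ^ k * exp (-k - ℓ)`: the `k` in the threshold pays for the
  -- ratio of the normalizations.
  set c : ℝ := √(Real.pi / 2) ^ k * Real.exp (k + ℓ) with hc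
  have hc0 : 0 < c := by positivity
  have hsub : {ω : Fin N → X |
      (∀ u : ι → ℝ, n⁻¹ * ∑ t ∈ T, (w (ω t) ⬝ᵥ u) ^ 2 ≤ 2 * (u ⬝ᵥ u)) ∧
      8 * (k + ℓ) < (∑ t ∈ T, e (ω t) • w (ω t)) ⬝ᵥ (∑ t ∈ T, e (ω t) • w (ω t)) / n} ⊆
      {ω | ENNReal.ofReal c ≤ ∫⁻ u, F ω u} := by
    rintro ω ⟨h1, h2⟩
    set S : ι → ℝ := ∑ t ∈ T, e (ω t) • w (ω t)
    have hSS : ((√n)⁻¹ • S) ⬝ᵥ ((√n)⁻¹ • S) = S ⬝ᵥ S / n := by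
      rw [smul_dotProduct, dotProduct_smul, smul_eq_mul, smul_eq_mul, ← mul_assoc, ← mul_inv, hsn]
      ring
    have hlow : ∀ u, ENNReal.ofReal (Real.exp (((√n)⁻¹ • S) ⬝ᵥ u - 2 * (u ⬝ᵥ u))) ≤ F ω u := by
      intro u
      simp only [F]
      rw [← ENNReal.ofReal_prod_of_nonneg fun _ _ => (Real.exp_pos _).le,
        ← ENNReal.ofReal_mul (Real.exp_pos _).le, ← Real.exp_sum, ← Real.exp_add]
      apply ENNReal.ofReal_le_ofReal
      apply Real.exp_le_exp.2
      have e1 : ((√n)⁻¹ • S) ⬝ᵥ u = ∑ t ∈ T, e (ω t) * (w (ω t) ⬝ᵥ ((√n)⁻¹ • u)) := by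
        rw [smul_dotProduct, sum_dotProduct, Finset.smul_sum]
        refine Finset.sum_congr rfl fun t _ => ?_
        simp only [smul_dotProduct, dotProduct_smul, smul_eq_mul]; ring
      have e2 : ∑ t ∈ T, (w (ω t) ⬝ᵥ ((√n)⁻¹ • u)) ^ 2 / 2 ≤ u ⬝ᵥ u := by
        have : ∑ t ∈ T, (w (ω t) ⬝ᵥ ((√n)⁻¹ • u)) ^ 2 / 2 =
            (n⁻¹ * ∑ t ∈ T, (w (ω t) ⬝ᵥ u) ^ 2) / 2 := by
          rw [Finset.mul_sum, Finset.sum_div]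
          refine Finset.sum_congr rfl fun t _ => ?_
          rw [dotProduct_smul, smul_eq_mul, mul_pow, inv_pow, sq (√n), hsn]
        rw [this]
        linarith [h1 u]
      simp only [g, Finset.sum_sub_distrib]
      rw [← e1]
      linarith
    refine le_trans ?_ (lintegral_mono hlow)
    rw [lintegral_exp_linear_sub_sq, hSS]
    apply ENNReal.ofReal_le_ofReal
    apply mul_le_mul_of_nonneg_left _ (by positivity)
    apply Real.exp_le_exp.2
    linarith
  refine (measure_mono hsub).trans ?_
  refine (meas_ge_le_lintegral_div (hFm.lintegral_prod_right' ).aemeasurable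
    (by simpa using hc0) ENNReal.ofReal_ne_top).trans ?_
  refine (ENNReal.div_le_div_right hupper _).trans ?_
  rw [← ENNReal.ofReal_div_of_pos hc0]
  apply ENNReal.ofReal_le_ofReal
  rw [div_le_iff₀ hc0, hc]
  have hpi : √Real.pi = √2 * √(Real.pi / 2) := by
    rw [← Real.sqrt_mul (by norm_num)]; congr 1; ring
  have h2 : √2 ≤ Real.exp 1 := by
    have h3 : √2 ≤ 2 := by rw [Real.sqrt_le_left (by norm_num)]; norm_num
    linarith [Real.add_one_le_exp (1 : ℝ)]
  calc √Real.pi ^ k = √(Real.pi / 2) ^ k * √2 ^ k := by rw [hpi, mul_pow, mul_comm]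
    _ ≤ √(Real.pi / 2) ^ k * Real.exp 1 ^ k :=
        mul_le_mul_of_nonneg_left (pow_le_pow_left₀ (Real.sqrt_nonneg _) h2 k) (by positivity)
    _ = √(Real.pi / 2) ^ k * Real.exp k := by rw [← Real.exp_nat_mul, mul_one]
    _ = _ := by rw [Real.exp_add, Real.exp_neg]; field_simp

end SelfNormalized

/-! ### Whitening of a positive definite form. -/

section Whitening

/-- A positive definite matrix is the identity in suitable coordinates. -/
lemma exists_whitening {ι : Type*} [Fintype ι] [DecidableEq ι] {M : Matrix ι ι ℝ}
    (hM : M.PosDef) : ∃ B : Matrix ι ι ℝ, Bᵀ * M * B = 1 := by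
  have hH := hM.isHermitian
  set E : Matrix ι ι ℝ := hH.eigenvectorUnitary.1
  have hE : Eᵀ * E = 1 := by
    have := Unitary.coe_star_mul_self hH.eigenvectorUnitary
    rwa [star_eq_conjTranspose, conjTranspose_eq_transpose_of_trivial] at this
  have hspec : M = E * diagonal hH.eigenvalues * Eᵀ := by
    have := hH.spectral_theorem
    rw [Unitary.conjStarAlgAut_apply] at this
    simpa [star_eq_conjTranspose] using this
  obtain ⟨ev, hev, hpos⟩ : ∃ ev : ι → ℝ, M = E * diagonal ev * Eᵀ ∧ ∀ i, 0 < ev i :=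
    ⟨_, hspec, hM.eigenvalues_pos⟩
  refine ⟨E * diagonal fun i => (√(ev i))⁻¹, ?_⟩
  have e1 : (E * diagonal fun i => (√(ev i))⁻¹)ᵀ * M * (E * diagonal fun i => (√(ev i))⁻¹) =
      diagonal (fun i => (√(ev i))⁻¹) * (Eᵀ * E) * diagonal ev *
        (Eᵀ * E) * diagonal fun i => (√(ev i))⁻¹ := by
    rw [hev]
    simp only [transpose_mul, diagonal_transpose, Matrix.mul_assoc]
  rw [e1, hE, Matrix.mul_one, Matrix.mul_one, diagonal_mul_diagonal, diagonal_mul_diagonal,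
    ← diagonal_one]
  congr 1
  ext i
  have hs := Real.mul_self_sqrt (hpos i).le
  have h0 : √(ev i) ≠ 0 := (Real.sqrt_pos.2 (hpos i)).ne'
  field_simp
  rw [sq, hs]

end Whitening

/-! ### The law of one observation. -/

section ObsLaw

variable {dx dφ : ℕ} {S : Type u} {A : Type v} {φ : S → A → EuclideanSpace ℝ (Fin dφ)}

lemma bilin_sub (Θ : Matrix (Fin dx) (Fin dφ) ℝ) (x : EuclideanSpace ℝ (Fin dx))
    (v w : EuclideanSpace ℝ (Fin dφ)) : bilin Θ x (v - w) = bilin Θ x v - bilin Θ x w := by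
  simp only [bilin, ← Finset.sum_sub_distrib, PiLp.sub_apply, mul_sub]

lemma prefProb_eq_sigmoid (Θ : Matrix (Fin dx) (Fin dφ) ℝ) (o : Obs dx S A) :
    prefProb φ Θ o.1 = Real.sigmoid (ip (zmat φ o) Θ) := by
  rw [zmat, ← bilin_eq_ip, featDiff, bilin_sub, Real.sigmoid_def, prefProb]
  simp only [reward]
  rw [neg_sub, Real.exp_sub]
  field_simp
  ring

lemma prefProb_nonneg (Θ : Matrix (Fin dx) (Fin dφ) ℝ) (q : Query dx S A) :
    0 ≤ prefProb φ Θ q := by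
  unfold prefProb; positivity

lemma prefProb_le_one (Θ : Matrix (Fin dx) (Fin dφ) ℝ) (q : Query dx S A) :
    prefProb φ Θ q ≤ 1 := by
  rw [prefProb_eq_sigmoid Θ (q, true)]
  exact Real.sigmoid_le_one _

variable [MeasurableSpace S] [MeasurableSpace A] (hφ : Measurable fun p : S × A => φ p.1 p.2)

lemma measurable_euclidean_apply {n : ℕ} (i : Fin n) :
    Measurable fun x : EuclideanSpace ℝ (Fin n) => x i :=
  (EuclideanSpace.proj (𝕜 := ℝ) i).continuous.measurable

include hφ in
lemma measurable_featDiff (j : Fin dφ) :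
    Measurable fun q : Query dx S A => featDiff φ q j := by
  have h : ∀ g : Query dx S A → S × A, Measurable g →
      Measurable fun q => φ (g q).1 (g q).2 j := fun g hg =>
    (measurable_euclidean_apply j).comp (hφ.comp hg)
  have h1 := h (fun q => (q.2.1, q.2.2.2)) (by fun_prop)
  have h2 := h (fun q => (q.2.1, q.2.2.1)) (by fun_prop)
  exact h1.sub h2

include hφ in
lemma measurable_zKron (p : Fin dφ × Fin dx) :
    Measurable fun q : Query dx S A => zKron φ q p :=
  (measurable_featDiff hφ p.1).mul ((measurable_euclidean_apply p.2).comp measurable_fst)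

/-- The entries of a matrix, in the order used by `zKron`. -/
def matVec (Δ : Matrix (Fin dx) (Fin dφ) ℝ) : Fin dφ × Fin dx → ℝ := fun p => Δ p.2 p.1

lemma ip_zmat (o : Obs dx S A) (Δ : Matrix (Fin dx) (Fin dφ) ℝ) :
    ip (zmat φ o) Δ = zKron φ o.1 ⬝ᵥ matVec Δ := by
  rw [ip_eq_sum, Finset.sum_comm, dotProduct, Fintype.sum_prod_type]
  refine Finset.sum_congr rfl fun j _ => Finset.sum_congr rfl fun i _ => ?_
  simp only [zmat, outer, of_apply, zKron, matVec]; ring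

lemma matVec_dotProduct (Δ : Matrix (Fin dx) (Fin dφ) ℝ) :
    matVec Δ ⬝ᵥ matVec Δ = ‖Δ‖ ^ 2 := by
  rw [norm_sq_eq_ip, ip_eq_sum, Finset.sum_comm, dotProduct, Fintype.sum_prod_type]
  rfl

lemma abs_zKron_le (o : Obs dx S A) (p : Fin dφ × Fin dx) : |zKron φ o.1 p| ≤ ‖zmat φ o‖ := by
  apply abs_le_of_sq_le_sq _ (norm_nonneg _)
  have h : matVec (zmat φ o) p = zKron φ o.1 p := by
    simp only [zmat, outer, of_apply, zKron, matVec]; ring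
  rw [← matVec_dotProduct, ← h, dotProduct, sq]
  exact Finset.single_le_sum (f := fun p => matVec (zmat φ o) p * matVec (zmat φ o) p)
    (fun _ _ => mul_self_nonneg _) (Finset.mem_univ p)

include hφ in
lemma measurable_ip_zmat (Δ : Matrix (Fin dx) (Fin dφ) ℝ) :
    Measurable fun o : Obs dx S A => ip (zmat φ o) Δ := by
  simp only [ip_zmat, dotProduct]
  exact Finset.measurable_sum _ fun p _ =>
    ((measurable_zKron hφ p).comp measurable_fst).mul_const _

include hφ in
lemma measurable_prefProb (Θ : Matrix (Fin dx) (Fin dφ) ℝ) :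
    Measurable fun q : Query dx S A => prefProb φ Θ q := by
  simp only [fun q : Query dx S A => prefProb_eq_sigmoid (φ := φ) Θ (q, true)]
  exact continuous_sigmoid.measurable.comp
    ((measurable_ip_zmat hφ Θ).comp (measurable_id.prodMk measurable_const))

variable (Θ : Matrix (Fin dx) (Fin dφ) ℝ) (P : Measure (Query dx S A))

include hφ in
lemma lintegral_obsLaw {h : Obs dx S A → ENNReal} (hh : Measurable h) :
    ∫⁻ o, h o ∂obsLaw φ Θ P = ∫⁻ q, (ENNReal.ofReal (prefProb φ Θ q) * h (q, true) +
      ENNReal.ofReal (1 - prefProb φ Θ q) * h (q, false)) ∂P := by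
  have hp := measurable_prefProb hφ Θ
  have hb : ∀ y : Bool, Measurable fun q : Query dx S A => (q, y) := fun y =>
    measurable_id.prodMk measurable_const
  have h1 : Measurable fun q : Query dx S A => ENNReal.ofReal (prefProb φ Θ q) :=
    hp.ennreal_ofReal
  have h2 : Measurable fun q : Query dx S A => ENNReal.ofReal (1 - prefProb φ Θ q) :=
    (measurable_const.sub hp).ennreal_ofReal
  rw [obsLaw, lintegral_add_measure, lintegral_map hh (hb true), lintegral_map hh (hb false)]
  refine (congrArg₂ (· + ·) (lintegral_withDensity_eq_lintegral_mul P h1 (hh.comp (hb true)))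
    (lintegral_withDensity_eq_lintegral_mul P h2 (hh.comp (hb false)))).trans ?_
  exact (lintegral_add_left (h1.mul (hh.comp (hb true))) _).symm

include hφ in
lemma map_fst_obsLaw : (obsLaw φ Θ P).map Prod.fst = P := by
  ext s hs
  rw [Measure.map_apply measurable_fst hs, ← lintegral_indicator_one (measurable_fst hs),
    lintegral_obsLaw hφ Θ P (measurable_one.indicator (measurable_fst hs)),
    ← lintegral_indicator_one hs]
  refine lintegral_congr fun q => ?_
  have e : ∀ y : Bool, (Prod.fst ⁻¹' s).indicator (1 : Obs dx S A → ENNReal) (q, y) =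
      s.indicator 1 q := fun y => rfl
  rw [e, e, ← add_mul, ← ENNReal.ofReal_add (prefProb_nonneg _ _)
    (sub_nonneg.2 (prefProb_le_one _ _)), add_sub_cancel, ENNReal.ofReal_one, one_mul]

include hφ in
lemma isProbabilityMeasure_obsLaw [IsProbabilityMeasure P] :
    IsProbabilityMeasure (obsLaw φ Θ P) := by
  constructor
  have h := congrArg (fun μ => μ Set.univ) (map_fst_obsLaw hφ Θ P)
  simpa [Measure.map_apply measurable_fst MeasurableSet.univ] using h

include hφ in
lemma ae_obsLaw {p : Query dx S A → Prop} (h : ∀ᵐ q ∂P, p q) :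
    ∀ᵐ o ∂obsLaw φ Θ P, p o.1 := by
  rw [← map_fst_obsLaw hφ Θ P] at h
  exact ae_of_ae_map measurable_fst.aemeasurable h

include hφ in
lemma integral_obsLaw_fst {f : Query dx S A → ℝ} (hf : Measurable f) :
    ∫ o, f o.1 ∂obsLaw φ Θ P = ∫ q, f q ∂P := by
  conv_rhs => rw [← map_fst_obsLaw hφ Θ P]
  rw [integral_map measurable_fst.aemeasurable hf.aestronglyMeasurable]

lemma abs_boolVal_sub_le (o : Obs dx S A) : |boolVal o.2 - prefProb φ Θ o.1| ≤ 1 := by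
  have h0 := prefProb_nonneg (φ := φ) Θ o.1
  have h1 := prefProb_le_one (φ := φ) Θ o.1
  rw [abs_le]
  unfold boolVal
  split_ifs <;> constructor <;> linarith

include hφ in
lemma measurable_score :
    Measurable fun o : Obs dx S A => boolVal o.2 - prefProb φ Θ o.1 :=
  ((measurable_of_countable boolVal).comp measurable_snd).sub
    ((measurable_prefProb hφ Θ).comp measurable_fst)

include hφ in
/-- The score has mean zero given the query. -/
lemma integral_score_mul [IsProbabilityMeasure P] {f : Query dx S A → ℝ} (hf : Measurable f)
    {B : ℝ} (hB : ∀ᵐ q ∂P, |f q| ≤ B) :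
    ∫ o, (boolVal o.2 - prefProb φ Θ o.1) * f o.1 ∂obsLaw φ Θ P = 0 := by
  have := isProbabilityMeasure_obsLaw hφ Θ P
  have hp := measurable_prefProb hφ Θ
  have hm : Measurable fun o : Obs dx S A => (boolVal o.2 - prefProb φ Θ o.1) * f o.1 :=
    (measurable_score hφ Θ).mul (hf.comp measurable_fst)
  have hint : Integrable (fun o : Obs dx S A => (boolVal o.2 - prefProb φ Θ o.1) * f o.1)
      (obsLaw φ Θ P) := by
    apply Integrable.of_bound hm.aestronglyMeasurable B
    filter_upwards [ae_obsLaw hφ Θ P hB] with o ho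
    rw [Real.norm_eq_abs, abs_mul]
    calc _ ≤ 1 * |f o.1| := mul_le_mul_of_nonneg_right (abs_boolVal_sub_le Θ o) (abs_nonneg _)
      _ ≤ B := by rw [one_mul]; exact ho
  have hb : ∀ y : Bool, Measurable fun q : Query dx S A => (q, y) := fun y =>
    measurable_id.prodMk measurable_const
  have hp' : Measurable fun q : Query dx S A => ENNReal.ofReal (1 - prefProb φ Θ q) :=
    (measurable_const.sub hp).ennreal_ofReal
  unfold obsLaw at hint ⊢
  rw [integrable_add_measure] at hint
  rw [integral_add_measure hint.1 hint.2, integral_map (hb true).aemeasurable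
    hm.aestronglyMeasurable, integral_map (hb false).aemeasurable hm.aestronglyMeasurable,
    integral_withDensity_eq_integral_toReal_smul hp.ennreal_ofReal
      (Filter.Eventually.of_forall fun _ => ENNReal.ofReal_lt_top),
    integral_withDensity_eq_integral_toReal_smul hp'
      (Filter.Eventually.of_forall fun _ => ENNReal.ofReal_lt_top), ← sub_neg_eq_add,
    ← integral_neg, sub_eq_zero]
  refine integral_congr_ae (Filter.Eventually.of_forall fun q => ?_)
  simp only [smul_eq_mul, boolVal, ENNReal.toReal_ofReal (prefProb_nonneg Θ q),
    ENNReal.toReal_ofReal (sub_nonneg.2 (prefProb_le_one Θ q))]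
  simp
  ring

/-- Hoeffding's lemma for a Bernoulli variable. -/
lemma bernoulli_exp_le {p a : ℝ} (h0 : 0 ≤ p) (h1 : p ≤ 1) :
    p * Real.exp ((1 - p) * a - a ^ 2 / 2) + (1 - p) * Real.exp ((0 - p) * a - a ^ 2 / 2) ≤ 1 := by
  -- This is the chord of `exp` between `a` and `-a`. The part linear in `t` cancels in the mean,
  -- and the rest is `cosh a ≤ exp (a ^ 2 / 2)`.
  have hconv : ∀ t : ℝ, -1 ≤ t → t ≤ 1 →
      Real.exp (t * a) ≤ (1 + t) / 2 * Real.exp a + (1 - t) / 2 * Real.exp (-a) := by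
    intro t ht1 ht2
    have := convexOn_exp.2 (Set.mem_univ a) (Set.mem_univ (-a))
      (show 0 ≤ (1 + t) / 2 by linarith) (show 0 ≤ (1 - t) / 2 by linarith) (by ring)
    simp only [smul_eq_mul] at this
    rwa [show (1 + t) / 2 * a + (1 - t) / 2 * -a = t * a by ring] at this
  have c1 := mul_le_mul_of_nonneg_left (hconv (1 - p) (by linarith) (by linarith)) h0
  have c2 := mul_le_mul_of_nonneg_left (hconv (0 - p) (by linarith) (by linarith))
    (sub_nonneg.2 h1)
  have c3 := Real.cosh_le_exp_half_sq a
  rw [Real.cosh_eq] at c3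
  rw [Real.exp_sub, Real.exp_sub, ← mul_div_assoc, ← mul_div_assoc, ← add_div,
    div_le_one (Real.exp_pos _)]
  linear_combination c1 + c2 + c3

include hφ in
-- Given the query, the score is a centred Bernoulli variable, so `bernoulli_exp_le` applies
-- pointwise. This is the exponential moment that `self_normalized` asks for.
lemma lintegral_exp_score_le [IsProbabilityMeasure P] (Δ : Matrix (Fin dx) (Fin dφ) ℝ) :
    ∫⁻ o, ENNReal.ofReal (Real.exp ((boolVal o.2 - prefProb φ Θ o.1) * ip (zmat φ o) Δ -
      ip (zmat φ o) Δ ^ 2 / 2)) ∂obsLaw φ Θ P ≤ 1 := by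
  have hm := measurable_ip_zmat (dx := dx) hφ Δ
  have hmeas : Measurable fun o : Obs dx S A => ENNReal.ofReal (Real.exp
      ((boolVal o.2 - prefProb φ Θ o.1) * ip (zmat φ o) Δ - ip (zmat φ o) Δ ^ 2 / 2)) :=
    (Real.measurable_exp.comp
      (((measurable_score hφ Θ).mul hm).sub ((hm.pow_const 2).div_const 2))).ennreal_ofReal
  rw [lintegral_obsLaw hφ Θ P hmeas]
  calc _ ≤ ∫⁻ _q, 1 ∂P := by
        refine lintegral_mono fun q => ?_
        have h0 := prefProb_nonneg (φ := φ) Θ q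
        have h1 := sub_nonneg.2 (prefProb_le_one (φ := φ) Θ q)
        have e : zmat φ (q, false) = zmat φ (q, true) := rfl
        dsimp only
        rw [← ENNReal.ofReal_mul h0, ← ENNReal.ofReal_mul h1,
          ← ENNReal.ofReal_add (by positivity) (by positivity), ENNReal.ofReal_le_one, e]
        have := bernoulli_exp_le (a := ip (zmat φ (q, true)) Δ) h0 (prefProb_le_one Θ q)
        simpa only [boolVal, if_true, Bool.false_eq_true, if_false] using this
    _ = 1 := by simp

end ObsLaw

/-! ### Second moments as quadratic forms on matrices. -/

section QuadForm

variable {dx dφ r : ℕ} {S : Type u} {A : Type v} (φ : S → A → EuclideanSpace ℝ (Fin dφ))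
  [MeasurableSpace S] [MeasurableSpace A] (P : Measure (Query dx S A))

/-- The population second moment as a quadratic form on matrices. -/
noncomputable def quadP (Δ : Matrix (Fin dx) (Fin dφ) ℝ) : ℝ :=
  matVec Δ ⬝ᵥ popSecondMoment φ P *ᵥ matVec Δ

variable {φ P}

lemma quadP_smul (c : ℝ) (Δ : Matrix (Fin dx) (Fin dφ) ℝ) :
    quadP φ P (c • Δ) = c ^ 2 * quadP φ P Δ := by
  have : matVec (c • Δ) = c • matVec Δ := rfl
  rw [quadP, this, mulVec_smul, smul_dotProduct, dotProduct_smul, quadP, smul_eq_mul,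
    smul_eq_mul]
  ring

lemma quadP_add_add_sub (Δ Δ' : Matrix (Fin dx) (Fin dφ) ℝ) :
    quadP φ P (Δ + Δ') + quadP φ P (Δ - Δ') = 2 * quadP φ P Δ + 2 * quadP φ P Δ' := by
  have h1 : matVec (Δ + Δ') = matVec Δ + matVec Δ' := rfl
  have h2 : matVec (Δ - Δ') = matVec Δ - matVec Δ' := rfl
  simp only [quadP, h1, h2, mulVec_add, mulVec_sub, dotProduct_add, dotProduct_sub,
    add_dotProduct, sub_dotProduct]
  ring

lemma le_quadP {lam : ℝ} (h : (popSecondMoment φ P - lam • 1).PosSemidef)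
    (Δ : Matrix (Fin dx) (Fin dφ) ℝ) : lam * ‖Δ‖ ^ 2 ≤ quadP φ P Δ := by
  have := h.dotProduct_mulVec_nonneg (matVec Δ)
  rw [star_trivial, sub_mulVec, smul_mulVec, one_mulVec, dotProduct_sub, dotProduct_smul,
    matVec_dotProduct, smul_eq_mul] at this
  unfold quadP
  linarith

lemma posDef_popSecondMoment {lam : ℝ} (h : (popSecondMoment φ P - lam • 1).PosSemidef)
    (hl : 0 < lam) : (popSecondMoment φ P).PosDef := by
  have h2 := PosDef.smul (PosDef.one (n := Fin dφ × Fin dx) (R := ℝ)) hl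
  have := h2.posSemidef_add h
  rwa [sub_add_cancel] at this

lemma abs_dotProduct_mulVec_le {ι : Type*} [Fintype ι] {M : Matrix ι ι ℝ} {t : ℝ}
    (hM : ∀ i j, |M i j| ≤ t) (v : ι → ℝ) :
    |v ⬝ᵥ M *ᵥ v| ≤ t * (Fintype.card ι * (v ⬝ᵥ v)) := by
  have h1 : |v ⬝ᵥ M *ᵥ v| ≤ ∑ i, ∑ j, t * (|v i| * |v j|) := by
    simp only [dotProduct, mulVec, Finset.mul_sum]
    refine (Finset.abs_sum_le_sum_abs _ _).trans (Finset.sum_le_sum fun i _ => ?_)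
    refine (Finset.abs_sum_le_sum_abs _ _).trans (Finset.sum_le_sum fun j _ => ?_)
    rw [abs_mul, abs_mul, mul_left_comm]
    exact mul_le_mul_of_nonneg_right (hM i j) (by positivity)
  have h2 : ∑ i, ∑ j, t * (|v i| * |v j|) = t * (∑ i, |v i|) ^ 2 := by
    rw [sq, Finset.sum_mul_sum]
    simp only [Finset.mul_sum]
  have h3 := sq_sum_le_card_mul_sum_sq (s := Finset.univ) (f := fun i => |v i|)
  have h4 : ∑ i, |v i| ^ 2 = v ⬝ᵥ v := Finset.sum_congr rfl fun i _ => by rw [sq_abs, sq]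
  rw [h4, Finset.card_univ] at h3
  rcases isEmpty_or_nonempty ι with h0 | ⟨⟨i⟩⟩
  · simp
  · rw [h2] at h1
    exact h1.trans (mul_le_mul_of_nonneg_left h3 ((abs_nonneg _).trans (hM i i)))

variable {N : ℕ} {ω : Fin N → Obs dx S A} {T : Finset (Fin N)}

lemma quadEmp_eq (Δ : Matrix (Fin dx) (Fin dφ) ℝ) : quadEmp φ ω T Δ =
    matVec Δ ⬝ᵥ (Matrix.of fun p p' => (T.card : ℝ)⁻¹ *
      ∑ t ∈ T, zKron φ (ω t).1 p * zKron φ (ω t).1 p') *ᵥ matVec Δ := by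
  have h : (Matrix.of fun p p' => (T.card : ℝ)⁻¹ *
      ∑ t ∈ T, zKron φ (ω t).1 p * zKron φ (ω t).1 p') = (T.card : ℝ)⁻¹ •
      ∑ t ∈ T, vecMulVec (zKron φ (ω t).1) (zKron φ (ω t).1) := by
    ext p p'
    rw [Matrix.smul_apply, Matrix.sum_apply]
    simp only [of_apply, vecMulVec_apply, smul_eq_mul]
  rw [h, smul_mulVec, dotProduct_smul, sum_mulVec, dotProduct_sum, quadEmp, smul_eq_mul]
  congr 1
  refine Finset.sum_congr rfl fun t _ => ?_
  rw [vecMulVec_mulVec, ip_zmat, dotProduct_smul, dotProduct_comm (matVec Δ)]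
  simp only [MulOpposite.smul_eq_mul_unop, MulOpposite.unop_op, sq]

lemma abs_quadEmp_sub_quadP_le {t : ℝ} (h : ∀ p p', |(T.card : ℝ)⁻¹ *
      ∑ t ∈ T, zKron φ (ω t).1 p * zKron φ (ω t).1 p' - popSecondMoment φ P p p'| ≤ t)
    (Δ : Matrix (Fin dx) (Fin dφ) ℝ) :
    |quadEmp φ ω T Δ - quadP φ P Δ| ≤ t * (((dx : ℝ) * dφ) * ‖Δ‖ ^ 2) := by
  rw [quadEmp_eq, quadP, ← dotProduct_sub, ← sub_mulVec]
  refine (abs_dotProduct_mulVec_le (t := t) h _).trans_eq ?_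
  rw [matVec_dotProduct, Fintype.card_prod, Fintype.card_fin, Fintype.card_fin]
  push_cast; ring

end QuadForm

/-! ### The score in directions tangent to the true subspaces. -/

section Score

variable {dx dφ r : ℕ} {S : Type u} {A : Type v} {φ : S → A → EuclideanSpace ℝ (Fin dφ)}
  [MeasurableSpace S] [MeasurableSpace A] {P : Measure (Query dx S A)} [IsProbabilityMeasure P]
  {Θs : Matrix (Fin dx) (Fin dφ) ℝ} {Us : Matrix (Fin dx) (Fin dx) ℝ}
  {Vs : Matrix (Fin dφ) (Fin dφ) ℝ} {N : ℕ}

/-- Concentration of the score, in the directions tangent to the true singular subspaces. -/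
lemma score_concentration (hφ : Measurable fun p : S × A => φ p.1 p.2) {lam : ℝ} (hl : 0 < lam)
    (hS : (popSecondMoment φ P - lam • 1).PosSemidef)
    (hU : Us ∈ Matrix.orthogonalGroup (Fin dx) ℝ) (hV : Vs ∈ Matrix.orthogonalGroup (Fin dφ) ℝ)
    (T : Finset (Fin N)) (hT : 0 < T.card) (ℓ : ℝ) :
    dataLaw φ Θs P N {ω | (∀ Δ, quadEmp φ ω T Δ ≤ 2 * quadP φ P Δ) ∧
      ¬ ∀ Δ, perp r Us * Δ * perp r Vs = 0 → T.card * ip (nllGrad φ ω T Θs) Δ ^ 2 ≤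
        8 * (Fintype.card (RtvIdx dx dφ r) + ℓ) * quadP φ P Δ} ≤
      ENNReal.ofReal (Real.exp (-ℓ)) := by
  have := isProbabilityMeasure_obsLaw hφ Θs P
  -- `f` parametrizes the tangent directions at the true subspaces, a fixed space of dimension `card
  -- (RtvIdx dx dφ r)`; this is the dimension that appears in the rate. The matrix `B` below whitens
  -- the population form on this space, as `self_normalized` requires.
  let f : (RtvIdx dx dφ r → ℝ) →ₗ[ℝ] (Fin dφ × Fin dx → ℝ) :=
    { toFun := fun u => matVec (emb Us Vs u)
      map_add' := fun u v => by rw [emb_add]; rfl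
      map_smul' := fun c u => by rw [emb_smul]; rfl }
  set F := LinearMap.toMatrix' f
  have hF : ∀ u, F *ᵥ u = matVec (emb Us Vs u) := fun u => LinearMap.toMatrix'_mulVec f u
  have hinj : Function.Injective F.mulVec := by
    intro u v huv
    rw [hF, hF] at huv
    have h0 : emb Us Vs u = emb Us Vs v := by
      ext i j; exact congrFun huv (j, i)
    rw [← rtv_emb hU hV u, ← rtv_emb hU hV v, h0]
  have hM := (posDef_popSecondMoment hS hl).conjTranspose_mul_mul_same hinj
  rw [conjTranspose_eq_transpose_of_trivial] at hM
  obtain ⟨B, hB⟩ := exists_whitening hM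
  have hquad : ∀ u, quadP φ P (emb Us Vs (B *ᵥ u)) = u ⬝ᵥ u := by
    intro u
    have h1 : u ⬝ᵥ ((Bᵀ * (Fᵀ * popSecondMoment φ P * F) * B) *ᵥ u) = u ⬝ᵥ u := by
      rw [hB, one_mulVec]
    rw [← h1, quadP, ← hF]
    simp only [← mulVec_mulVec]
    rw [dotProduct_mulVec u, vecMul_transpose, dotProduct_mulVec (B *ᵥ u), vecMul_transpose]
  have hB' : B * (Bᵀ * (Fᵀ * popSecondMoment φ P * F)) = 1 := mul_eq_one_comm.1 hB
  let w : Obs dx S A → RtvIdx dx dφ r → ℝ := fun o => (F * B)ᵀ *ᵥ zKron φ o.1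
  have hw : ∀ o a, w o ⬝ᵥ a = ip (zmat φ o) (emb Us Vs (B *ᵥ a)) := by
    intro o a
    rw [ip_zmat, ← hF, mulVec_mulVec, dotProduct_mulVec, ← mulVec_transpose]
  have hwm : Measurable w := by
    refine measurable_pi_iff.2 fun j => ?_
    have : Measurable fun o : Obs dx S A => ∑ p, (F * B)ᵀ j p * zKron φ o.1 p :=
      Finset.measurable_sum _ fun p _ =>
        ((measurable_zKron hφ p).comp measurable_fst).const_mul _
    exact this
  have key := self_normalized (μ := obsLaw φ Θs P) (measurable_score hφ Θs) hwm
    (fun a => by simp only [hw]; exact lintegral_exp_score_le hφ Θs P _) T hT (ℓ := ℓ)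
  refine (measure_mono ?_).trans key
  rintro ω ⟨h1, h2⟩
  refine ⟨fun u => ?_, ?_⟩
  · simp only [hw]
    rw [← hquad u]
    exact h1 _
  · by_contra h3
    refine h2 fun Δ hΔ => ?_
    have hn : (0 : ℝ) < T.card := Nat.cast_pos.2 hT
    rw [not_lt, div_le_iff₀ hn] at h3
    obtain ⟨u, rfl⟩ : ∃ u, Δ = emb Us Vs (B *ᵥ u) := by
      refine ⟨(Bᵀ * (Fᵀ * popSecondMoment φ P * F)) *ᵥ rtv r Us Vs Δ, ?_⟩
      rw [mulVec_mulVec, hB', one_mulVec, emb_rtv_of_perp hU hV hΔ]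
    rw [hquad]
    set s := ∑ t ∈ T, (boolVal (ω t).2 - prefProb φ Θs (ω t).1) • w (ω t)
    have h4 : ip (nllGrad φ ω T Θs) (emb Us Vs (B *ᵥ u)) = -((T.card : ℝ)⁻¹ * (s ⬝ᵥ u)) := by
      rw [ip_nllGrad, ← mul_neg, sum_dotProduct, ← Finset.sum_neg_distrib]
      congr 1
      refine Finset.sum_congr rfl fun t _ => ?_
      rw [smul_dotProduct, hw, prefProb_eq_sigmoid, smul_eq_mul]
      ring
    have h5 : (s ⬝ᵥ u) ^ 2 ≤ (s ⬝ᵥ s) * (u ⬝ᵥ u) := by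
      have := Finset.sum_mul_sq_le_sq_mul_sq Finset.univ s u
      simpa only [dotProduct, sq] using this
    have h6 : 0 ≤ u ⬝ᵥ u := Finset.sum_nonneg fun i _ => mul_self_nonneg (u i)
    have h7 := h5.trans (mul_le_mul_of_nonneg_right h3 h6)
    rw [h4, neg_sq, mul_pow, inv_pow, ← mul_assoc]
    have e : (T.card : ℝ) * ((T.card : ℝ) ^ 2)⁻¹ = (T.card : ℝ)⁻¹ := by field_simp
    rw [e, inv_mul_le_iff₀ hn]
    linarith

end Score

/-! ### Sizes of the two splits. -/

section Splits

lemma card_firstSplit {N N₀ : ℕ} (h : N₀ ≤ N) : (firstSplit N N₀).card = N₀ := by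
  unfold firstSplit
  rw [Fin.card_filter_val_lt, min_eq_right h]

lemma card_secondSplit {N N₀ : ℕ} (h : N₀ ≤ N) : ((secondSplit N N₀).card : ℝ) = N - N₀ := by
  have h1 := Finset.card_filter_add_card_filter_not (s := (Finset.univ : Finset (Fin N)))
    (fun t => t.val < N₀)
  have h2 : (Finset.univ.filter fun t : Fin N => ¬ t.val < N₀) = secondSplit N N₀ := by
    unfold secondSplit; simp only [not_lt]
  have h3 := card_firstSplit h
  unfold firstSplit at h3
  rw [h2, h3, Finset.card_univ, Fintype.card_fin] at h1
  rw [eq_sub_iff_add_eq, add_comm]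
  exact_mod_cast h1

end Splits

/-! ### Union bounds. -/

section Uniform

variable {X : Type*} [MeasurableSpace X] {μ : Measure X} [IsProbabilityMeasure μ] {N : ℕ}

/-- Hoeffding's inequality for finitely many functions. -/
lemma hoeffding_pi_finite {ι : Type*} [Fintype ι] {h : ι → X → ℝ} (hm : ∀ i, Measurable (h i))
    {B : ℝ} (hb : ∀ i, ∀ᵐ x ∂μ, |h i x| ≤ B) (h0 : ∀ i, ∫ x, h i x ∂μ = 0) (T : Finset (Fin N))
    {s : ℝ} (hs : 0 ≤ s) :
    (Measure.pi fun _ : Fin N => μ)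
      {ω | ¬ ∀ i, |(T.card : ℝ)⁻¹ * ∑ t ∈ T, h i (ω t)| ≤ s} ≤
      ENNReal.ofReal (Fintype.card ι * (2 * Real.exp (-(T.card * s ^ 2 / (2 * B ^ 2))))) := by
  have e : {ω : Fin N → X | ¬ ∀ i, |(T.card : ℝ)⁻¹ * ∑ t ∈ T, h i (ω t)| ≤ s} =
      ⋃ i, {ω | s < |(T.card : ℝ)⁻¹ * ∑ t ∈ T, h i (ω t)|} := by
    ext ω; simp
  rw [e]
  refine (measure_iUnion_fintype_le _ _).trans ?_
  have h1 : ∀ i, (Measure.pi fun _ : Fin N => μ)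
      {ω | s < |(T.card : ℝ)⁻¹ * ∑ t ∈ T, h i (ω t)|} ≤
      ENNReal.ofReal (2 * Real.exp (-(T.card * s ^ 2 / (2 * B ^ 2)))) := fun i => by
    rw [← ofReal_measureReal]
    exact ENNReal.ofReal_le_ofReal (hoeffding_pi (hm i) (hb i) (h0 i) T hs)
  refine (Finset.sum_le_sum fun i _ => h1 i).trans ?_
  rw [Finset.sum_const, Finset.card_univ, nsmul_eq_mul,
    ENNReal.ofReal_mul (p := (Fintype.card ι : ℝ)) (by positivity), ENNReal.ofReal_natCast]

/-- The exponent `x` exceeds `a + L`: the part `a` pays for the number `D` of events, through `a *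
exp (-a) ≤ 1`, and the part `L` for the confidence level. -/
lemma card_mul_exp_le {D a x L ε : ℝ} (hD : 0 ≤ D) (hL : 0 ≤ L) (hε : 0 < ε)
    (ha : D * 2 / ε ≤ a) (hx : (a + 1) * (1 + L) ≤ x) :
    D * (2 * Real.exp (-x)) ≤ ε * Real.exp (-L) := by
  have ha0 : 0 ≤ a := le_trans (by positivity) ha
  have h1 : Real.exp (-x) ≤ Real.exp (-a) * Real.exp (-L) := by
    rw [← Real.exp_add]
    apply Real.exp_le_exp.2
    nlinarith [mul_nonneg ha0 hL]
  have h2 : a * Real.exp (-a) ≤ 1 := by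
    rw [Real.exp_neg, mul_inv_le_iff₀ (Real.exp_pos a)]
    linarith [Real.add_one_le_exp a]
  have h3 : D * 2 ≤ ε * a := by rw [div_le_iff₀ hε] at ha; linarith
  calc D * (2 * Real.exp (-x)) ≤ D * (2 * (Real.exp (-a) * Real.exp (-L))) := by gcongr
    _ = D * 2 * Real.exp (-a) * Real.exp (-L) := by ring
    _ ≤ ε * a * Real.exp (-a) * Real.exp (-L) := by gcongr
    _ = ε * (a * Real.exp (-a)) * Real.exp (-L) := by ring
    _ ≤ ε * 1 * Real.exp (-L) := by gcongr
    _ = _ := by ring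

end Uniform

/-! ### Concentration of the second moment and of the gradient. -/

section Events

variable {dx dφ : ℕ} {S : Type u} {A : Type v} {φ : S → A → EuclideanSpace ℝ (Fin dφ)}
  [MeasurableSpace S] [MeasurableSpace A] {P : Measure (Query dx S A)} [IsProbabilityMeasure P]
  {Θs : Matrix (Fin dx) (Fin dφ) ℝ} {N : ℕ}

lemma norm_zmat_concentration (hφ : Measurable fun p : S × A => φ p.1 p.2) {R : ℝ}
    (hR : ∀ᵐ q ∂P, ∀ y, ‖zmat φ (q, y)‖ ≤ R) :
    dataLaw φ Θs P N {ω | ¬ ∀ t, ‖zmat φ (ω t)‖ ≤ R} = 0 := by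
  have := isProbabilityMeasure_obsLaw hφ Θs P
  have h := ae_obsLaw hφ Θs P hR
  have h2 : ∀ᵐ ω ∂(Measure.pi fun _ : Fin N => obsLaw φ Θs P), ∀ t, ‖zmat φ (ω t)‖ ≤ R := by
    rw [ae_all_iff]
    intro t
    have := (Measure.quasiMeasurePreserving_eval (μ := fun _ : Fin N => obsLaw φ Θs P) t).ae h
    filter_upwards [this] with ω hω using hω (ω t).2
  exact h2

/-- Hoeffding's inequality entry by entry, at deviation `lam / (2 * D)`: then the two forms differ
by at most `lam * ‖Δ‖ ^ 2 / 2`, hence by half of the population form, for all directions at once. -/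
lemma quadEmp_concentration (hφ : Measurable fun p : S × A => φ p.1 p.2) {R lam D : ℝ}
    (hl : 0 < lam) (hD : 0 < D) (hdim : (dx : ℝ) * dφ ≤ D)
    (hS : (popSecondMoment φ P - lam • 1).PosSemidef)
    (hR : ∀ᵐ q ∂P, ∀ y, ‖zmat φ (q, y)‖ ≤ R) (T : Finset (Fin N))
    (hT : 0 < T.card) :
    dataLaw φ Θs P N {ω | ¬ ∀ Δ, quadP φ P Δ / 2 ≤ quadEmp φ ω T Δ ∧
        quadEmp φ ω T Δ ≤ 2 * quadP φ P Δ} ≤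
      ENNReal.ofReal (D ^ 2 * (2 * Real.exp
        (-(T.card * (lam / (2 * D)) ^ 2 / (2 * (2 * R ^ 2) ^ 2))))) := by
  have := isProbabilityMeasure_obsLaw hφ Θs P
  have hbd : ∀ p p' : Fin dφ × Fin dx, ∀ᵐ q ∂P, |zKron φ q p * zKron φ q p'| ≤ R ^ 2 := by
    intro p p'
    filter_upwards [hR] with q hq
    rw [abs_mul, sq]
    have h1 := (abs_zKron_le (φ := φ) (q, true) p).trans (hq true)
    have h2 := (abs_zKron_le (φ := φ) (q, true) p').trans (hq true)
    exact mul_le_mul h1 h2 (abs_nonneg _) ((abs_nonneg _).trans h1)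
  have hmz : ∀ p p' : Fin dφ × Fin dx,
      Measurable fun q : Query dx S A => zKron φ q p * zKron φ q p' := fun p p' =>
    (measurable_zKron hφ p).mul (measurable_zKron hφ p')
  have hint : ∀ p p' : Fin dφ × Fin dx, Integrable (fun q => zKron φ q p * zKron φ q p') P :=
    fun p p' => Integrable.of_bound (hmz p p').aestronglyMeasurable (R ^ 2) (hbd p p')
  have hpop : ∀ p p' : Fin dφ × Fin dx, |popSecondMoment φ P p p'| ≤ R ^ 2 := by
    intro p p'
    have := norm_integral_le_of_norm_le_const (μ := P)
      (f := fun q => zKron φ q p * zKron φ q p') (hbd p p')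
    simpa [popSecondMoment] using this
  have key := hoeffding_pi_finite (μ := obsLaw φ Θs P) (ι := (Fin dφ × Fin dx) × (Fin dφ × Fin dx))
    (h := fun i o => zKron φ o.1 i.1 * zKron φ o.1 i.2 - popSecondMoment φ P i.1 i.2)
    (fun i => ((hmz i.1 i.2).comp measurable_fst).sub_const _) (B := 2 * R ^ 2)
    (fun i => by
      filter_upwards [ae_obsLaw hφ Θs P (hbd i.1 i.2)] with o ho
      refine (abs_sub _ _).trans ?_
      linarith [hpop i.1 i.2])
    (fun i => by
      rw [integral_obsLaw_fst hφ Θs P (f := fun q => zKron φ q i.1 * zKron φ q i.2 -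
        popSecondMoment φ P i.1 i.2) ((hmz i.1 i.2).sub_const _),
        integral_sub (hint _ _) (integrable_const _)]
      simp [popSecondMoment]) T (s := lam / (2 * D)) (by positivity)
  refine (measure_mono ?_).trans (key.trans (ENNReal.ofReal_le_ofReal ?_))
  · intro ω hω h
    refine hω fun Δ => ?_
    have hn : (0 : ℝ) < T.card := Nat.cast_pos.2 hT
    have h1 := abs_quadEmp_sub_quadP_le (φ := φ) (P := P) (ω := ω) (T := T)
      (t := lam / (2 * D)) (fun p p' => by
        have := h (p, p')
        rw [Finset.sum_sub_distrib, Finset.sum_const, nsmul_eq_mul, mul_sub, inv_mul_cancel_left₀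
          hn.ne'] at this
        exact this) Δ
    have h2 := le_quadP hS Δ
    have h3 : lam / (2 * D) * (((dx : ℝ) * dφ) * ‖Δ‖ ^ 2) ≤ quadP φ P Δ / 2 := by
      calc _ ≤ lam / (2 * D) * (D * ‖Δ‖ ^ 2) := by gcongr
        _ = lam * ‖Δ‖ ^ 2 / 2 := by field_simp
        _ ≤ _ := by linarith
    rw [abs_le] at h1
    have h4 : 0 ≤ quadP φ P Δ := le_trans (by positivity) h2
    constructor <;> linarith
  · rw [Fintype.card_prod, Fintype.card_prod, Fintype.card_fin, Fintype.card_fin]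
    refine mul_le_mul_of_nonneg_right ?_ (by positivity)
    push_cast
    rw [sq, mul_comm (dφ : ℝ)]
    gcongr

/-- A crude bound over all `dx * dφ` entries is enough: it only sets the accuracy of gradient
descent and terms of lower order. -/
lemma nllGrad_concentration (hφ : Measurable fun p : S × A => φ p.1 p.2) {R D s : ℝ}
    (hdim : (dx : ℝ) * dφ ≤ D) (hs : 0 ≤ s)
    (hR : ∀ᵐ q ∂P, ∀ y, ‖zmat φ (q, y)‖ ≤ R) (T : Finset (Fin N)) :
    dataLaw φ Θs P N {ω | ¬ ‖nllGrad φ ω T Θs‖ ^ 2 ≤ D * s ^ 2} ≤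
      ENNReal.ofReal (D * (2 * Real.exp (-(T.card * s ^ 2 / (2 * R ^ 2))))) := by
  have := isProbabilityMeasure_obsLaw hφ Θs P
  have hbd : ∀ p : Fin dφ × Fin dx, ∀ᵐ q ∂P, |zKron φ q p| ≤ R := by
    intro p
    filter_upwards [hR] with q hq
    exact (abs_zKron_le (φ := φ) (q, true) p).trans (hq true)
  have key := hoeffding_pi_finite (μ := obsLaw φ Θs P) (ι := Fin dφ × Fin dx)
    (h := fun p o => (boolVal o.2 - prefProb φ Θs o.1) * zKron φ o.1 p)
    (fun p => (measurable_score hφ Θs).mul ((measurable_zKron hφ p).comp measurable_fst)) (B := R)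
    (fun p => by
      filter_upwards [ae_obsLaw hφ Θs P (hbd p)] with o ho
      rw [abs_mul]
      exact (mul_le_of_le_one_left (abs_nonneg _) (abs_boolVal_sub_le Θs o)).trans ho)
    (fun p => integral_score_mul hφ Θs P (measurable_zKron hφ p) (hbd p)) T hs
  refine (measure_mono ?_).trans (key.trans (ENNReal.ofReal_le_ofReal ?_))
  · intro ω hω h
    refine hω ?_
    rw [← matVec_dotProduct, dotProduct]
    have h1 : ∀ p, matVec (nllGrad φ ω T Θs) p * matVec (nllGrad φ ω T Θs) p ≤ s ^ 2 := by
      intro p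
      have e : matVec (nllGrad φ ω T Θs) p = -((T.card : ℝ)⁻¹ *
          ∑ t ∈ T, (boolVal (ω t).2 - prefProb φ Θs (ω t).1) * zKron φ (ω t).1 p) := by
        rw [matVec, nllGrad, Matrix.smul_apply, Matrix.sum_apply, ← mul_neg,
          ← Finset.sum_neg_distrib, smul_eq_mul]
        congr 1
        refine Finset.sum_congr rfl fun t _ => ?_
        rw [Matrix.smul_apply, prefProb_eq_sigmoid, smul_eq_mul]
        simp only [zmat, outer, of_apply, zKron]; ring
      rw [e, neg_mul_neg, ← sq, ← sq_abs]
      exact pow_le_pow_left₀ (abs_nonneg _) (h p) 2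
    refine (Finset.sum_le_sum fun p _ => h1 p).trans ?_
    rw [Finset.sum_const, nsmul_eq_mul, Finset.card_univ, Fintype.card_prod, Fintype.card_fin,
      Fintype.card_fin, Nat.cast_mul, mul_comm (dφ : ℝ)]
    gcongr
  · rw [Fintype.card_prod, Fintype.card_fin, Fintype.card_fin]
    refine mul_le_mul_of_nonneg_right ?_ (by positivity)
    push_cast
    rw [mul_comm (dφ : ℝ)]
    exact hdim

end Events

/-! ### The good event. -/

section GoodEvent

variable {dx dφ : ℕ} {S : Type u} {A : Type v} [MeasurableSpace S] [MeasurableSpace A]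

/-- The properties of the data on which the analysis of the algorithm rests. -/
structure GoodData (φ : S → A → EuclideanSpace ℝ (Fin dφ)) (Θs : Matrix (Fin dx) (Fin dφ) ℝ)
    (P : Measure (Query dx S A)) (r : ℕ) (Us : Matrix (Fin dx) (Fin dx) ℝ)
    (Vs : Matrix (Fin dφ) (Fin dφ) ℝ) {N : ℕ} (N₀ : ℕ) (R γ χ : ℝ)
    (ω : Fin N → Obs dx S A) : Prop where
  norm_le : ∀ t, ‖zmat φ (ω t)‖ ≤ R
  le_quadEmp : ∀ T, T = firstSplit N N₀ ∨ T = secondSplit N N₀ →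
    ∀ Δ, quadP φ P Δ / 2 ≤ quadEmp φ ω T Δ
  quadEmp_le : ∀ T, T = firstSplit N N₀ ∨ T = secondSplit N N₀ →
    ∀ Δ, quadEmp φ ω T Δ ≤ 2 * quadP φ P Δ
  norm_grad_le : ∀ T, T = firstSplit N N₀ ∨ T = secondSplit N N₀ →
    ‖nllGrad φ ω T Θs‖ ^ 2 ≤ γ
  score_le : ∀ Δ, perp r Us * Δ * perp r Vs = 0 →
    ip (nllGrad φ ω (secondSplit N N₀) Θs) Δ ^ 2 ≤ χ * quadP φ P Δ

variable {φ : S → A → EuclideanSpace ℝ (Fin dφ)}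
  {P : Measure (Query dx S A)} [IsProbabilityMeasure P] {r : ℕ}
  {Θs : Matrix (Fin dx) (Fin dφ) ℝ} {Us : Matrix (Fin dx) (Fin dx) ℝ}
  {Vs : Matrix (Fin dφ) (Fin dφ) ℝ}

/-- Replacing the bad event by a measurable hull avoids any question of measurability of the good
one. -/
lemma exists_measurableSet_of_compl_le {X : Type*} [MeasurableSpace X] {μ : Measure X}
    [IsProbabilityMeasure μ] {p : X → Prop} {δ : ℝ} (hδ : 0 ≤ δ)
    (h : μ {x | ¬ p x} ≤ ENNReal.ofReal δ) :
    ∃ E, MeasurableSet E ∧ ENNReal.ofReal (1 - δ) ≤ μ E ∧ ∀ x ∈ E, p x := by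
  refine ⟨(toMeasurable μ {x | ¬ p x})ᶜ, (measurableSet_toMeasurable _ _).compl, ?_, ?_⟩
  · rw [prob_compl_eq_one_sub (measurableSet_toMeasurable _ _), measure_toMeasurable,
      ENNReal.ofReal_sub _ hδ, ENNReal.ofReal_one]
    exact tsub_le_tsub_left h _
  · intro x hx
    by_contra hp
    exact hx (subset_toMeasurable _ _ hp)

/-- Besides a null set, five events of probability at most `δ / 8` are excluded: second moment and
gradient on either split, and the score on the second. The sharp rate has a constant depending on
`c` only, whereas `C` and `N₁` may depend on the dimensions. -/
lemma exists_goodData (hφ : Measurable fun p : S × A => φ p.1 p.2) {R lam D c : ℝ}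
    (hR0 : 0 < R) (hl : 0 < lam) (hD : 0 < D) (hc : 0 < c) (hdim : (dx : ℝ) * dφ ≤ D)
    (h2 : 2 ≤ ((dx : ℝ) + dφ) * r)
    (hS : (popSecondMoment φ P - lam • 1).PosSemidef)
    (hU : Us ∈ Matrix.orthogonalGroup (Fin dx) ℝ) (hV : Vs ∈ Matrix.orthogonalGroup (Fin dφ) ℝ)
    (hR : ∀ᵐ q ∂P, ∀ y, ‖zmat φ (q, y)‖ ≤ R) :
    ∃ C > 0, ∃ N₁ ≥ 1, ∀ δ : ℝ, 0 < δ → δ < 1 → ∀ N N₀ : ℕ,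
      N₁ * (1 + Real.log (1 / δ)) ≤ N → c * N ≤ N₀ → c * N ≤ (N : ℝ) - N₀ →
      ∃ E : Set (Fin N → Obs dx S A), MeasurableSet E ∧
        ENNReal.ofReal (1 - δ) ≤ dataLaw φ Θs P N E ∧
        ∀ ω ∈ E, GoodData φ Θs P r Us Vs N₀ R (C * (1 + Real.log (1 / δ)) / N)
          (24 / c * ((((dx : ℝ) + dφ) * r + Real.log (1 / δ)) / N)) ω := by
  have := isProbabilityMeasure_obsLaw hφ Θs P
  -- Both constants are solved from the exponents in the Hoeffding bounds: `16 * D` and `16 * D ^ 2`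
  -- are the values of `a` in `card_mul_exp_le` for `D` and `D ^ 2` entries at level `δ / 8`.
  refine ⟨D * (2 * R ^ 2 * (16 * D + 1) / c), by positivity,
    max 1 ((16 * D ^ 2 + 1) * (2 * (2 * R ^ 2) ^ 2) / (c * (lam / (2 * D)) ^ 2)), le_max_left _ _,
    ?_⟩
  intro δ hδ hδ1 N N₀ hN hN1 hN2
  set L := Real.log (1 / δ) with hLdef
  have hL : 0 < L := Real.log_pos (by rw [one_div]; exact (one_lt_inv₀ hδ).2 hδ1)
  have heL : Real.exp (-L) = δ := by
    rw [hLdef, one_div, Real.log_inv, neg_neg, Real.exp_log hδ]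
  have hN1' : (1 : ℝ) ≤ N := by
    have := mul_le_mul_of_nonneg_right (le_max_left (1 : ℝ) ((16 * D ^ 2 + 1) *
      (2 * (2 * R ^ 2) ^ 2) / (c * (lam / (2 * D)) ^ 2))) (show 0 ≤ 1 + L by linarith)
    linarith
  have hN3 : (16 * D ^ 2 + 1) * (1 + L) ≤ c * N * (lam / (2 * D)) ^ 2 / (2 * (2 * R ^ 2) ^ 2) := by
    have h1 := (mul_le_mul_of_nonneg_right (le_max_right (1 : ℝ) ((16 * D ^ 2 + 1) *
      (2 * (2 * R ^ 2) ^ 2) / (c * (lam / (2 * D)) ^ 2))) (show 0 ≤ 1 + L by linarith)).trans hN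
    rw [div_mul_eq_mul_div, div_le_iff₀ (by positivity)] at h1
    rw [le_div_iff₀ (by positivity)]
    linarith
  have hN0 : (0 : ℝ) < N := by linarith
  have hcN : 0 < c * N := by positivity
  have hNN : N₀ ≤ N := by
    have : (N₀ : ℝ) ≤ N := by linarith
    exact_mod_cast this
  have hcard : ∀ T, T = firstSplit N N₀ ∨ T = secondSplit N N₀ → c * N ≤ (T.card : ℝ) := by
    rintro T (rfl | rfl)
    · rw [card_firstSplit hNN]; exact hN1
    · rw [card_secondSplit hNN]; exact hN2
  have hcard0 : ∀ T, T = firstSplit N N₀ ∨ T = secondSplit N N₀ → 0 < T.card := fun T hT => by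
    have := hcN.trans_le (hcard T hT)
    exact_mod_cast this
  have e0 := norm_zmat_concentration (Θs := Θs) (N := N) hφ hR
  have e1 : ∀ T, T = firstSplit N N₀ ∨ T = secondSplit N N₀ → dataLaw φ Θs P N
      {ω | ¬ ∀ Δ, quadP φ P Δ / 2 ≤ quadEmp φ ω T Δ ∧ quadEmp φ ω T Δ ≤ 2 * quadP φ P Δ} ≤
      ENNReal.ofReal (1 / 8 * δ) := by
    intro T hT
    refine (quadEmp_concentration hφ hl hD hdim hS hR T (hcard0 T hT)).trans
      (ENNReal.ofReal_le_ofReal ?_)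
    rw [← heL]
    refine card_mul_exp_le (a := 16 * D ^ 2) (by positivity) hL.le (by norm_num) (by linarith)
      (hN3.trans ?_)
    have := hcard T hT
    gcongr
  set s := √(2 * R ^ 2 * (16 * D + 1) / c * (1 + L) / N) with hs
  have hs2 : s ^ 2 = 2 * R ^ 2 * (16 * D + 1) / c * (1 + L) / N := Real.sq_sqrt (by positivity)
  have e2 : ∀ T, T = firstSplit N N₀ ∨ T = secondSplit N N₀ → dataLaw φ Θs P N
      {ω | ¬ ‖nllGrad φ ω T Θs‖ ^ 2 ≤ D * s ^ 2} ≤ ENNReal.ofReal (1 / 8 * δ) := by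
    intro T hT
    refine (nllGrad_concentration hφ hdim (Real.sqrt_nonneg _) hR T).trans
      (ENNReal.ofReal_le_ofReal ?_)
    rw [← heL]
    refine card_mul_exp_le (a := 16 * D) (by positivity) hL.le (by norm_num) (by linarith) ?_
    have h1 : (16 * D + 1) * (1 + L) = c * N * s ^ 2 / (2 * R ^ 2) := by
      rw [hs2]; field_simp
    rw [h1]
    have := hcard T hT
    gcongr
  have e3 := score_concentration (Θs := Θs) (r := r) hφ hl hS hU hV (secondSplit N N₀)
    (hcard0 _ (Or.inr rfl)) (L + Real.log 8)
  have hexp : Real.exp (-(L + Real.log 8)) = 1 / 8 * δ := by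
    rw [neg_add, Real.exp_add, heL, Real.exp_neg, Real.exp_log (by norm_num)]; ring
  rw [hexp] at e3
  -- The price of the level `δ / 8`; it is absorbed by `(dx + dφ) r ≥ 2` when the factor `8` is
  -- raised to `24`.
  have hlog : Real.log 8 ≤ 3 := by
    have : Real.log 8 = 3 * Real.log 2 := by
      rw [show (8 : ℝ) = 2 ^ 3 by norm_num, Real.log_pow]; norm_num
    rw [this]
    linarith [Real.log_two_lt_d9]
  have : IsProbabilityMeasure (dataLaw φ Θs P N) := by unfold dataLaw; infer_instance
  refine exists_measurableSet_of_compl_le hδ.le ?_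
  set F := firstSplit N N₀
  set G := secondSplit N N₀
  have hsub : {ω : Fin N → Obs dx S A | ¬ GoodData φ Θs P r Us Vs N₀ R
      (D * (2 * R ^ 2 * (16 * D + 1) / c) * (1 + L) / N)
      (24 / c * ((((dx : ℝ) + dφ) * r + L) / N)) ω} ⊆
      {ω | ¬ ∀ t, ‖zmat φ (ω t)‖ ≤ R} ∪
      (({ω | ¬ ∀ Δ, quadP φ P Δ / 2 ≤ quadEmp φ ω F Δ ∧ quadEmp φ ω F Δ ≤ 2 * quadP φ P Δ} ∪
      {ω | ¬ ∀ Δ, quadP φ P Δ / 2 ≤ quadEmp φ ω G Δ ∧ quadEmp φ ω G Δ ≤ 2 * quadP φ P Δ}) ∪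
      (({ω | ¬ ‖nllGrad φ ω F Θs‖ ^ 2 ≤ D * s ^ 2} ∪ {ω | ¬ ‖nllGrad φ ω G Θs‖ ^ 2 ≤ D * s ^ 2}) ∪
      {ω | (∀ Δ, quadEmp φ ω G Δ ≤ 2 * quadP φ P Δ) ∧
      ¬ ∀ Δ, perp r Us * Δ * perp r Vs = 0 → G.card * ip (nllGrad φ ω G Θs) Δ ^ 2 ≤
        8 * (Fintype.card (RtvIdx dx dφ r) + (L + Real.log 8)) * quadP φ P Δ})) := by
    intro ω hω
    by_contra hcon
    simp only [Set.mem_union, Set.mem_ofPred_eq, not_or, not_not, not_and] at hcon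
    obtain ⟨g0, ⟨g1, g2⟩, ⟨g3, g4⟩, g5⟩ := hcon
    refine hω ⟨g0, ?_, ?_, ?_, ?_⟩
    · rintro T (rfl | rfl) Δ
      exacts [(g1 Δ).1, (g2 Δ).1]
    · rintro T (rfl | rfl) Δ
      exacts [(g1 Δ).2, (g2 Δ).2]
    · have e : D * (2 * R ^ 2 * (16 * D + 1) / c) * (1 + L) / N = D * s ^ 2 := by
        rw [hs2]; ring
      rw [e]
      rintro T (rfl | rfl)
      exacts [g3, g4]
    · intro Δ hΔ
      have h3 := g5 (fun Δ => (g2 Δ).2) Δ hΔ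
      have h4 := hcard G (Or.inr rfl)
      have h5 : 0 ≤ quadP φ P Δ := le_trans (by positivity) (le_quadP hS Δ)
      have h6 := card_rtvIdx_le (m := dx) (n := dφ) (r := r)
      have h7 : 8 * ((Fintype.card (RtvIdx dx dφ r) : ℝ) + (L + Real.log 8)) ≤
          24 * (((dx : ℝ) + dφ) * r + L) := by linarith
      have h8 : c * N * ip (nllGrad φ ω G Θs) Δ ^ 2 ≤
          24 * (((dx : ℝ) + dφ) * r + L) * quadP φ P Δ :=
        (mul_le_mul_of_nonneg_right h4 (sq_nonneg _)).trans
          (h3.trans (mul_le_mul_of_nonneg_right h7 h5))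
      have e : 24 / c * ((((dx : ℝ) + dφ) * r + L) / N) * quadP φ P Δ =
          24 * (((dx : ℝ) + dφ) * r + L) * quadP φ P Δ / (c * N) := by field_simp
      rw [e, le_div_iff₀ hcN]
      linarith
  have hδ8 : 0 ≤ 1 / 8 * δ := by positivity
  calc _ ≤ _ := measure_mono hsub
    _ ≤ 0 + ((ENNReal.ofReal (1 / 8 * δ) + ENNReal.ofReal (1 / 8 * δ)) +
        ((ENNReal.ofReal (1 / 8 * δ) + ENNReal.ofReal (1 / 8 * δ)) +
          ENNReal.ofReal (1 / 8 * δ))) := by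
        refine (measure_union_le _ _).trans (add_le_add e0.le ?_)
        refine (measure_union_le _ _).trans (add_le_add ?_ ?_)
        · exact (measure_union_le _ _).trans
            (add_le_add (e1 F (Or.inl rfl)) (e1 G (Or.inr rfl)))
        refine (measure_union_le _ _).trans (add_le_add ?_ e3)
        exact (measure_union_le _ _).trans (add_le_add (e2 F (Or.inl rfl)) (e2 G (Or.inr rfl)))
    _ = ENNReal.ofReal (5 / 8 * δ) := by
        rw [zero_add, ← ENNReal.ofReal_add hδ8 hδ8, ← ENNReal.ofReal_add (by positivity) hδ8,
          ← ENNReal.ofReal_add (by positivity) (by positivity)]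
        congr 1; ring
    _ ≤ ENNReal.ofReal δ := ENNReal.ofReal_le_ofReal (by linarith)

end GoodEvent

/-! ### Perturbation of the truncation. -/

section Subspaces

variable {m n r : ℕ} {U Us : Matrix (Fin m) (Fin m) ℝ} {V Vs : Matrix (Fin n) (Fin n) ℝ}

lemma norm_perp_mul_perp_sub_le (hV : V ∈ Matrix.orthogonalGroup (Fin n) ℝ)
    (hUs : Us ∈ Matrix.orthogonalGroup (Fin m) ℝ) {a : ℝ} (hu : ‖perp r U - perp r Us‖ ≤ a)
    (hv : ‖perp r V - perp r Vs‖ ≤ a) (M : Matrix (Fin m) (Fin n) ℝ) :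
    ‖perp r U * M * perp r V - perp r Us * M * perp r Vs‖ ≤ 2 * (a * ‖M‖) := by
  have e : perp r U * M * perp r V - perp r Us * M * perp r Vs =
      (perp r U - perp r Us) * (M * perp r V) + perp r Us * (M * (perp r V - perp r Vs)) := by
    simp only [Matrix.sub_mul, Matrix.mul_sub, Matrix.mul_assoc]; abel
  rw [e]
  refine (norm_add_le _ _).trans ?_
  have h1 : ‖(perp r U - perp r Us) * (M * perp r V)‖ ≤ a * ‖M‖ :=
    norm_mul_le_of_le hu (norm_mul_perp_le hV M)
  have h2 : ‖perp r Us * (M * (perp r V - perp r Vs))‖ ≤ ‖M‖ * a :=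
    (norm_perp_mul_le hUs _).trans (norm_mul_le_of_le le_rfl hv)
  linarith

/-- The part of the true parameter that the estimated subspaces miss is of second order. -/
lemma norm_perp_mul_perp_le {M Θs : Matrix (Fin m) (Fin n) ℝ} {Xs : Matrix (Fin n) (Fin m) ℝ}
    {d : ℕ → ℝ} (h : IsSVD M U d V) (hr : M.rank ≤ r) (hX : Θs * Xs * Θs = Θs) {x ε : ℝ}
    (hx : ‖Xs‖ ≤ x) (hε : ‖M - Θs‖ ≤ ε) : ‖perp r U * Θs * perp r V‖ ≤ ε ^ 2 * x := by
  -- After inserting `Θs = Θs * Xs * Θs`, the projection on either side kills `M`, so both outer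
  -- factors are of the size of the error.
  have e : perp r U * Θs * perp r V =
      (perp r U * (M - Θs)) * Xs * ((M - Θs) * perp r V) := by
    rw [Matrix.mul_sub (perp r U), Matrix.sub_mul M, h.perp_mul hr, h.mul_perp hr, zero_sub,
      zero_sub]
    conv_lhs => rw [← hX]
    simp only [Matrix.neg_mul, Matrix.mul_neg, neg_neg, Matrix.mul_assoc]
  rw [e, show ε ^ 2 * x = ε * x * ε by ring]
  exact norm_mul_le_of_le (norm_mul_le_of_le
    ((norm_perp_mul_le h.left_orthogonal _).trans hε) hx)
    ((norm_mul_perp_le h.right_orthogonal _).trans hε)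

end Subspaces

/-! ### Duality of weighted norms. -/

section WeightedNorm

variable {ι : Type*} [Fintype ι] [DecidableEq ι] {W : Matrix ι ι ℝ}

/-- Cauchy–Schwarz for the inner product of `W`, from the discriminant of the squared `W`-norm of `v
- t • W⁻¹ *ᵥ m` as a polynomial in `t`. -/
lemma abs_dotProduct_le_wNorm (hW : W.PosDef) (m v : ι → ℝ) :
    |m ⬝ᵥ v| ≤ wNorm W⁻¹ m * wNorm W v := by
  have hdet : IsUnit W.det := hW.det_pos.ne'.isUnit
  have hT : Wᵀ = W := by
    have := hW.isHermitian
    rwa [IsHermitian, conjTranspose_eq_transpose_of_trivial] at this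
  set u := W⁻¹ *ᵥ m
  have hu : W *ᵥ u = m := by rw [mulVec_mulVec, mul_nonsing_inv _ hdet, one_mulVec]
  have h1 : ∀ t : ℝ, 0 ≤ (u ⬝ᵥ m) * (t * t) + (-2 * (m ⬝ᵥ v)) * t + v ⬝ᵥ W *ᵥ v := by
    intro t
    have h := hW.posSemidef.dotProduct_mulVec_nonneg (v - t • u)
    have h2 : u ⬝ᵥ W *ᵥ v = m ⬝ᵥ v := by
      rw [dotProduct_mulVec, ← mulVec_transpose, hT, hu]
    rw [star_trivial, mulVec_sub, mulVec_smul, hu] at h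
    simp only [sub_dotProduct, dotProduct_sub, smul_dotProduct, dotProduct_smul, smul_eq_mul,
      h2] at h
    rw [dotProduct_comm v m] at h
    linarith
  have h2 := discrim_le_zero h1
  unfold discrim at h2
  rw [wNorm, wNorm, dotProduct_comm m (W⁻¹ *ᵥ m), ← Real.sqrt_mul' _ (by
    simpa using hW.posSemidef.dotProduct_mulVec_nonneg v)]
  apply Real.abs_le_sqrt
  linarith

end WeightedNorm

/-! ### Maximum likelihood in the reduced space. -/

section MLE

variable {dx dφ r N : ℕ} {S : Type u} {A : Type v} [MeasurableSpace S] [MeasurableSpace A]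
  {φ : S → A → EuclideanSpace ℝ (Fin dφ)} {P : Measure (Query dx S A)}
  {U : Matrix (Fin dx) (Fin dx) ℝ} {V : Matrix (Fin dφ) (Fin dφ) ℝ}
  {ω : Fin N → Obs dx S A} {T : Finset (Fin N)}

lemma continuous_nllRtv : Continuous (nllRtv φ ω T r U V) := by
  unfold nllRtv logisticLoss
  refine continuous_const.mul (continuous_finsetSum _ fun t _ => ?_)
  have h : Continuous fun θ : RtvIdx dx dφ r → ℝ => zRtv φ r U V (ω t) ⬝ᵥ θ := by
    unfold dotProduct; fun_prop
  refine Continuous.add ?_ (by split_ifs <;> fun_prop)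
  exact (continuous_const.add (Real.continuous_exp.comp h.neg)).log
    fun θ => (add_pos zero_lt_one (Real.exp_pos _)).ne'

variable {θp : RtvIdx dx dφ r → ℝ} {b ψ lam : ℝ}

/-- On the sphere of radius `1 / 2` curvature beats the score, by `hsmall`, so the loss exceeds its
value at the centre; by convexity it cannot decrease further out on the same ray. This makes the
local bound `hlow` sufficient. -/
lemma nll_lt_of_far (hl : 0 < lam) (hq : ∀ Δ, lam * ‖Δ‖ ^ 2 ≤ quadP φ P Δ) (hψ : 0 < ψ)
    {Θp : Matrix (Fin dx) (Fin dφ) ℝ}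
    (hlow : ∀ Δ, ‖Δ‖ ≤ 1 / 2 → nll φ ω T Θp + ip (nllGrad φ ω T Θp) Δ +
      ψ * quadP φ P Δ ≤ nll φ ω T (Θp + Δ))
    (hb : ∀ v : RtvIdx dx dφ r → ℝ, |ip (nllGrad φ ω T Θp) (emb U V v)| ≤ b * √(quadP φ P (emb U V v)))
    (hsmall : 2 * b < ψ * √lam) (v : RtvIdx dx dφ r → ℝ) (hv : 1 / 2 ≤ ‖emb U V v‖) :
    nll φ ω T Θp < nll φ ω T (Θp + emb U V v) := by
  set Δ := emb U V v
  have hΔ : 0 < ‖Δ‖ := by linarith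
  set s := 1 / (2 * ‖Δ‖) with hs
  have hs0 : 0 < s := by positivity
  have hs1 : s ≤ 1 := by rw [hs, div_le_one (by positivity)]; linarith
  have hn : ‖s • Δ‖ = 1 / 2 := by
    rw [norm_smul, Real.norm_eq_abs, abs_of_pos hs0, hs]; field_simp
  have h1 := hlow (s • Δ) hn.le
  have h2 := hb (s • v)
  rw [emb_smul] at h2
  have h3 := hq (s • Δ)
  rw [hn] at h3
  set Q := √(quadP φ P (s • Δ)) with hQ
  have hQ2 : Q * Q = quadP φ P (s • Δ) :=
    Real.mul_self_sqrt (le_trans (by positivity) h3)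
  have hQl : √lam / 2 ≤ Q := by
    rw [hQ]
    refine Real.le_sqrt_of_sq_le ?_
    rw [div_pow, Real.sq_sqrt hl.le]
    linarith
  have hQ0 : 0 < Q := lt_of_lt_of_le (by positivity) hQl
  have h4 : 0 < Q * (ψ * Q - b) := by
    refine mul_pos hQ0 ?_
    have := mul_le_mul_of_nonneg_left hQl hψ.le
    linarith
  have h5 := (abs_le.1 h2).1
  have h6 : nll φ ω T Θp < nll φ ω T (Θp + s • Δ) := by
    rw [← hQ2] at h1
    linarith
  have h7 := nll_convex (φ := φ) (ω := ω) (T := T) (Θp + s • Δ) Θp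
  have h8 := nll_convex (φ := φ) (ω := ω) (T := T) (Θp + s • Δ) (Θp + Δ)
  rw [show Θp - (Θp + s • Δ) = (-s) • Δ by rw [neg_smul]; abel, ip_smul_right] at h7
  rw [show Θp + Δ - (Θp + s • Δ) = (1 - s) • Δ by rw [sub_smul, one_smul]; abel,
    ip_smul_right] at h8
  have h9 : 0 < ip (nllGrad φ ω T (Θp + s • Δ)) Δ := by
    by_contra hcon
    have := mul_nonneg hs0.le (neg_nonneg.2 (not_lt.1 hcon))
    linarith
  have := mul_nonneg (sub_nonneg.2 hs1) h9.le
  linarith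

/-- A minimizer of the reduced loss exists, and all minimizers are close to the target. -/
lemma exists_isMinOn_nllRtv (hU : U ∈ Matrix.orthogonalGroup (Fin dx) ℝ)
    (hV : V ∈ Matrix.orthogonalGroup (Fin dφ) ℝ) (hl : 0 < lam)
    (hq : ∀ Δ, lam * ‖Δ‖ ^ 2 ≤ quadP φ P Δ) (hψ : 0 < ψ)
    (hlow : ∀ Δ, ‖Δ‖ ≤ 1 / 2 → nll φ ω T (emb U V θp) + ip (nllGrad φ ω T (emb U V θp)) Δ +
      ψ * quadP φ P Δ ≤ nll φ ω T (emb U V θp + Δ))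
    (hb0 : 0 ≤ b)
    (hb : ∀ v : RtvIdx dx dφ r → ℝ, |ip (nllGrad φ ω T (emb U V θp)) (emb U V v)| ≤
      b * √(quadP φ P (emb U V v)))
    (hsmall : 2 * b < ψ * √lam) :
    (∃ θ, IsMinOn (nllRtv φ ω T r U V) Set.univ θ) ∧
    ∀ θ, IsMinOn (nllRtv φ ω T r U V) Set.univ θ →
      √(quadP φ P (emb U V (θ - θp))) ≤ b / ψ := by
  have hfar := nll_lt_of_far hl hq hψ hlow hb hsmall
  have hval : ∀ θ, nllRtv φ ω T r U V θ = nll φ ω T (emb U V θp + emb U V (θ - θp)) := fun θ => by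
    rw [← emb_add, add_sub_cancel, nllRtv_eq]
  have hval0 : nllRtv φ ω T r U V θp = nll φ ω T (emb U V θp) := nllRtv_eq _
  constructor
  -- A minimizer over the ball of radius `1 / 2` around the target is global, because the loss
  -- outside is larger than at the target.
  · set K : Set (RtvIdx dx dφ r → ℝ) := {θ | ‖emb U V (θ - θp)‖ ^ 2 ≤ 1 / 4} with hK
    have hKc : IsCompact K := by
      apply Metric.isCompact_of_isClosed_isBounded
      · have : Continuous fun θ : RtvIdx dx dφ r → ℝ => ‖emb U V (θ - θp)‖ ^ 2 := by
          simp only [norm_emb_sq hU hV, dotProduct]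
          fun_prop
        exact isClosed_le this continuous_const
      · refine (Metric.isBounded_closedBall (x := θp) (r := 1)).subset fun θ hθ => ?_
        rw [hK, Set.mem_ofPred_eq, norm_emb_sq hU hV, dotProduct] at hθ
        rw [Metric.mem_closedBall, dist_pi_le_iff zero_le_one]
        intro i
        rw [Real.dist_eq]
        apply abs_le_of_sq_le_sq _ zero_le_one
        have := Finset.single_le_sum (f := fun i => (θ - θp) i * (θ - θp) i)
          (fun _ _ => mul_self_nonneg _) (Finset.mem_univ i)
        rw [sq, ← Pi.sub_apply]
        linarith
    have hθK : θp ∈ K := by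
      rw [hK, Set.mem_ofPred_eq, norm_emb_sq hU hV, sub_self, zero_dotProduct]
      norm_num
    obtain ⟨θ, hθ, hmin⟩ := hKc.exists_isMinOn ⟨θp, hθK⟩
      (continuous_nllRtv (φ := φ) (ω := ω) (T := T) (U := U) (V := V)).continuousOn
    refine ⟨θ, fun θ' _ => ?_⟩
    by_cases h : θ' ∈ K
    · exact hmin h
    · rw [hK, Set.mem_ofPred_eq, not_le] at h
      have h1 : 1 / 2 ≤ ‖emb U V (θ' - θp)‖ := by
        by_contra hcon
        have := pow_le_pow_left₀ (norm_nonneg _) (not_le.1 hcon).le 2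
        norm_num at this h
        linarith
      have h2 := hmin hθK
      have h3 := hfar _ h1
      rw [← hval, ← hval0] at h3
      exact le_trans h2 h3.le
  · intro θ hθ
    have h0 := hθ (Set.mem_univ θp)
    rw [Set.mem_ofPred_eq, hval0, hval] at h0
    have h1 : ‖emb U V (θ - θp)‖ ≤ 1 / 2 := by
      by_contra hcon
      exact absurd (hfar _ (not_le.1 hcon).le) (not_lt.2 h0)
    have h2 := hlow _ h1
    have h3 := (abs_le.1 (hb (θ - θp))).1
    have h4 := hq (emb U V (θ - θp))
    set Q := √(quadP φ P (emb U V (θ - θp))) with hQ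
    have hQ2 : Q * Q = quadP φ P (emb U V (θ - θp)) :=
      Real.mul_self_sqrt (le_trans (by positivity) h4)
    rw [← hQ2] at h2
    have h5 : Q * (ψ * Q) ≤ Q * b := by linarith
    rw [le_div_iff₀ hψ]
    rcases (Real.sqrt_nonneg (quadP φ P (emb U V (θ - θp)))).eq_or_lt with hz | hz
    · rw [← hQ] at hz
      rw [← hz]; linarith
    · have := le_of_mul_le_mul_left h5 hz
      linarith

end MLE

/-! ### Policy values and pessimism. -/

section PolicyMean

variable {dx dφ r : ℕ} {S : Type u} {A : Type v} [MeasurableSpace S] [MeasurableSpace A]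
  (φ : S → A → EuclideanSpace ℝ (Fin dφ)) (ρ : Measure (EuclideanSpace ℝ (Fin dx) × S))

/-- The mean feature matrix `E_{(x,s) ∼ ρ} x φ(s, π(x, s))ᵀ` of a policy. -/
noncomputable def polMean (π : Policy dx S A) : Matrix (Fin dx) (Fin dφ) ℝ :=
  Matrix.of fun i j => ∫ p, outer p.1 (φ p.2 (π p)) i j ∂ρ

variable {φ ρ} (hφ : Measurable fun p : S × A => φ p.1 p.2) {B : ℝ} (hB : ∀ s a, ‖φ s a‖ ≤ B)
  (hx : Integrable (fun p => p.1) ρ) {π : Policy dx S A} (hπ : Measurable π)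

include hφ hB hx hπ in
lemma integrable_outer (i : Fin dx) (j : Fin dφ) :
    Integrable (fun p => outer p.1 (φ p.2 (π p)) i j) ρ := by
  have hm : Measurable fun p : EuclideanSpace ℝ (Fin dx) × S => φ p.2 (π p) :=
    hφ.comp (measurable_snd.prodMk hπ)
  have hm2 : Measurable fun p : EuclideanSpace ℝ (Fin dx) × S => p.1 i * φ p.2 (π p) j :=
    ((measurable_euclidean_apply i).comp measurable_fst).mul
      ((measurable_euclidean_apply j).comp hm)
  refine Integrable.mono' (hx.norm.mul_const B) hm2.aestronglyMeasurable
    (Filter.Eventually.of_forall fun p => ?_)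
  simp only [outer, of_apply, norm_mul]
  exact mul_le_mul (PiLp.norm_apply_le _ _) ((PiLp.norm_apply_le _ _).trans (hB _ _))
    (norm_nonneg _) (norm_nonneg _)

include hφ hB hx hπ in
lemma ip_polMean (H : Matrix (Fin dx) (Fin dφ) ℝ) :
    ip (polMean φ ρ π) H = ∫ p, ip (outer p.1 (φ p.2 (π p))) H ∂ρ := by
  simp only [ip_eq_sum]
  have h := fun i j => (integrable_outer hφ hB hx hπ i j).mul_const (H i j)
  rw [integral_finsetSum _ fun i _ => integrable_finsetSum _ fun j _ => h i j]
  refine Finset.sum_congr rfl fun i _ => ?_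
  rw [integral_finsetSum _ fun j _ => h i j]
  refine Finset.sum_congr rfl fun j _ => ?_
  rw [integral_mul_const]
  rfl

include hφ hB hx hπ in
lemma abs_ip_polMean_le (H : Matrix (Fin dx) (Fin dφ) ℝ) :
    |ip (polMean φ ρ π) H| ≤ B * (∫ p, ‖p.1‖ ∂ρ) * ‖H‖ := by
  have e : B * (∫ p, ‖p.1‖ ∂ρ) * ‖H‖ = ∫ p, ‖p.1‖ * (B * ‖H‖) ∂ρ := by
    rw [integral_mul_const]; ring
  rw [ip_polMean hφ hB hx hπ, ← Real.norm_eq_abs, e]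
  refine norm_integral_le_of_norm_le (hx.norm.mul_const _)
    (Filter.Eventually.of_forall fun p => ?_)
  rw [Real.norm_eq_abs, ← mul_assoc]
  refine (abs_ip_le _ _).trans (mul_le_mul_of_nonneg_right ?_ (norm_nonneg _))
  rw [norm_outer]
  exact mul_le_mul_of_nonneg_left (hB _ _) (norm_nonneg _)

include hφ hB hx hπ in
lemma norm_polMean_le : ‖polMean φ ρ π‖ ≤ B * ∫ p, ‖p.1‖ ∂ρ := by
  have h := (le_abs_self _).trans (abs_ip_polMean_le hφ hB hx hπ (polMean φ ρ π))
  rw [← norm_sq_eq_ip, sq] at h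
  rcases (norm_nonneg (polMean φ ρ π)).eq_or_lt with h0 | h0
  · rw [← h0]
    by_cases hne : Nonempty (EuclideanSpace ℝ (Fin dx) × S)
    · obtain ⟨p⟩ := hne
      exact mul_nonneg ((norm_nonneg _).trans (hB p.2 (π p)))
        (integral_nonneg fun _ => norm_nonneg _)
    · rw [not_nonempty_iff] at hne
      simp [integral_of_isEmpty]
  · exact le_of_mul_le_mul_right h h0

include hφ hB hx hπ in
lemma value_eq_ip (Θs : Matrix (Fin dx) (Fin dφ) ℝ) :
    value φ Θs ρ π = ip (polMean φ ρ π) Θs := by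
  rw [ip_polMean hφ hB hx hπ]
  simp only [value, reward, bilin_eq_ip]

variable {U : Matrix (Fin dx) (Fin dx) ℝ} {V : Matrix (Fin dφ) (Fin dφ) ℝ}

include hφ hB hx hπ in
lemma integral_rtv_dotProduct (θ : RtvIdx dx dφ r → ℝ) :
    ∫ p, rtv r U V (outer p.1 (φ p.2 (π p))) ⬝ᵥ θ ∂ρ = rtv r U V (polMean φ ρ π) ⬝ᵥ θ := by
  simp only [rtv_dotProduct]
  exact (ip_polMean hφ hB hx hπ _).symm

include hφ hB hx hπ in
lemma meanRtv_eq : meanRtv φ r U V ρ π = rtv r U V (polMean φ ρ π) := by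
  ext i
  have h := integral_rtv_dotProduct hφ hB hx hπ (r := r) (U := U) (V := V) (Pi.single i 1)
  simp only [dotProduct_single, mul_one] at h
  exact h

include hφ hB hx in
/-- The pessimistic policy loses at most twice the half-width of the confidence interval. -/
lemma pessimism_gap {Pol : Set (Policy dx S A)} (hPol : ∀ π ∈ Pol, Measurable π)
    {W : Matrix (RtvIdx dx dφ r) (RtvIdx dx dφ r) ℝ} (hW : W.PosDef)
    {θp θhat : RtvIdx dx dφ r → ℝ} {C : ℝ} (hC : wNorm W (θp - θhat) ≤ C)
    {πs πhat : Policy dx S A} (hs : πs ∈ Pol) (hh : πhat ∈ Pol)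
    (hmax : IsMaxOn (pessValue φ r U V ρ W θhat C) Pol πhat) :
    ip (polMean φ ρ πs) (emb U V θp) - ip (polMean φ ρ πhat) (emb U V θp) ≤
      2 * (wNorm W⁻¹ (meanRtv φ r U V ρ πs) * C) := by
  have hC0 : 0 ≤ C := (Real.sqrt_nonneg _).trans hC
  have hpess : ∀ π ∈ Pol, pessValue φ r U V ρ W θhat C π =
      sInf ((fun θ => rtv r U V (polMean φ ρ π) ⬝ᵥ θ) '' {θ | wNorm W (θ - θhat) ≤ C}) := by
    intro π hπ
    unfold pessValue
    simp only [integral_rtv_dotProduct hφ hB hx (hPol π hπ)]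
  have hlow : ∀ (m θ : RtvIdx dx dφ r → ℝ), wNorm W (θ - θhat) ≤ C →
      |m ⬝ᵥ θ - m ⬝ᵥ θhat| ≤ wNorm W⁻¹ m * C := by
    intro m θ hθ
    rw [← dotProduct_sub]
    exact (abs_dotProduct_le_wNorm hW m _).trans
      (mul_le_mul_of_nonneg_left hθ (Real.sqrt_nonneg _))
  have h1 := hmax hs
  rw [Set.mem_ofPred_eq, hpess _ hs, hpess _ hh] at h1
  have h2 : rtv r U V (polMean φ ρ πs) ⬝ᵥ θhat - wNorm W⁻¹ (rtv r U V (polMean φ ρ πs)) * C ≤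
      sInf ((fun θ => rtv r U V (polMean φ ρ πs) ⬝ᵥ θ) '' {θ | wNorm W (θ - θhat) ≤ C}) := by
    refine le_csInf ⟨_, θp, hC, rfl⟩ ?_
    rintro _ ⟨θ, hθ, rfl⟩
    have := (abs_le.1 (hlow (rtv r U V (polMean φ ρ πs)) θ hθ)).1
    dsimp only
    linarith
  -- `θp` is feasible, so the pessimistic value is at most the value under `θp`. An explicit lower
  -- bound is supplied because `sInf` of a set unbounded below is the default value `0`.
  have h3 : sInf ((fun θ => rtv r U V (polMean φ ρ πhat) ⬝ᵥ θ) ''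
      {θ | wNorm W (θ - θhat) ≤ C}) ≤ rtv r U V (polMean φ ρ πhat) ⬝ᵥ θp := by
    refine csInf_le ⟨rtv r U V (polMean φ ρ πhat) ⬝ᵥ θhat -
      wNorm W⁻¹ (rtv r U V (polMean φ ρ πhat)) * C, ?_⟩ ⟨θp, hC, rfl⟩
    rintro _ ⟨θ, hθ, rfl⟩
    have := (abs_le.1 (hlow (rtv r U V (polMean φ ρ πhat)) θ hθ)).1
    dsimp only
    linarith
  have h4 := (abs_le.1 (hlow (rtv r U V (polMean φ ρ πs)) θp hC)).2
  rw [meanRtv_eq hφ hB hx (hPol _ hs), ← rtv_dotProduct, ← rtv_dotProduct]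
  linarith

end PolicyMean

/-! ### Consequences of the good event. -/

section Deterministic

variable {dx dφ r N N₀ : ℕ} {S : Type u} {A : Type v} [MeasurableSpace S] [MeasurableSpace A]
  {φ : S → A → EuclideanSpace ℝ (Fin dφ)} {P : Measure (Query dx S A)}
  {Θs : Matrix (Fin dx) (Fin dφ) ℝ} {Us U : Matrix (Fin dx) (Fin dx) ℝ}
  {Vs V : Matrix (Fin dφ) (Fin dφ) ℝ} {ω : Fin N → Obs dx S A} {R γ χ lam : ℝ}

lemma sqrt_mul_norm_le (hl : 0 < lam) (hq : ∀ Δ, lam * ‖Δ‖ ^ 2 ≤ quadP φ P Δ)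
    (Δ : Matrix (Fin dx) (Fin dφ) ℝ) : √lam * ‖Δ‖ ≤ √(quadP φ P Δ) := by
  apply Real.le_sqrt_of_sq_le
  rw [mul_pow, Real.sq_sqrt hl.le]
  exact hq Δ

lemma GoodData.quadP_le (hg : GoodData φ Θs P r Us Vs N₀ R γ χ ω)
    (Δ : Matrix (Fin dx) (Fin dφ) ℝ) : quadP φ P Δ ≤ 2 * R ^ 2 * ‖Δ‖ ^ 2 := by
  have h1 := hg.le_quadEmp _ (Or.inl rfl) Δ
  have h2 := PRS.quadEmp_le (T := firstSplit N N₀) (fun t _ => hg.norm_le t) Δ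
  linarith

/-- The score at the reduced parameter, in the directions tangent to the estimated subspaces. -/
lemma GoodData.abs_ip_nllGrad_le (hg : GoodData φ Θs P r Us Vs N₀ R γ χ ω) (hl : 0 < lam)
    (hq : ∀ Δ, lam * ‖Δ‖ ^ 2 ≤ quadP φ P Δ) (hχ : 0 ≤ χ)
    (hV : V ∈ Matrix.orthogonalGroup (Fin dφ) ℝ)
    (hUs : Us ∈ Matrix.orthogonalGroup (Fin dx) ℝ)
    (hVs : Vs ∈ Matrix.orthogonalGroup (Fin dφ) ℝ) {a : ℝ}
    (hu : ‖perp r U - perp r Us‖ ≤ a) (hv : ‖perp r V - perp r Vs‖ ≤ a)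
    (hsm : 2 * R ^ 2 * (2 * a) ^ 2 ≤ lam) {Θp : Matrix (Fin dx) (Fin dφ) ℝ} {ζ : ℝ}
    (hζ : ‖Θp - Θs‖ ≤ ζ) {Δ : Matrix (Fin dx) (Fin dφ) ℝ}
    (hΔ : perp r U * Δ * perp r V = 0) :
    |ip (nllGrad φ ω (secondSplit N N₀) Θp) Δ| ≤
      (2 * √χ + (√γ * (2 * a) + R ^ 2 / 4 * ζ) / √lam) * √(quadP φ P Δ) := by
  have ha : 0 ≤ a := (norm_nonneg _).trans hu
  have hl' : 0 < √lam := Real.sqrt_pos.2 hl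
  have hq0 : ∀ Δ, 0 ≤ quadP φ P Δ := fun Δ => le_trans (by positivity) (hq Δ)
  -- `Δ₂` is the part of an estimated tangent direction that is not truly tangent. It is small with
  -- the subspace error, so the crude gradient bound suffices on it; `Δ - Δ₂` is truly tangent and
  -- gets the sharp score bound.
  set Δ₂ := perp r Us * Δ * perp r Vs with hΔ₂
  have h2 : ‖Δ₂‖ ≤ 2 * a * ‖Δ‖ := by
    have := norm_perp_mul_perp_sub_le hV hUs hu hv Δ
    rw [hΔ, zero_sub, norm_neg] at this
    linarith
  have h1 : perp r Us * (Δ - Δ₂) * perp r Vs = 0 := by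
    have : perp r Us * Δ₂ * perp r Vs = Δ₂ := by
      rw [hΔ₂, ← Matrix.mul_assoc, ← Matrix.mul_assoc, perp_mul_perp hUs, Matrix.mul_assoc,
        perp_mul_perp hVs]
    rw [Matrix.mul_sub, Matrix.sub_mul, this, ← hΔ₂, sub_self]
  have hq2 : quadP φ P Δ₂ ≤ quadP φ P Δ := by
    refine (hg.quadP_le Δ₂).trans (le_trans ?_ (hq Δ))
    calc 2 * R ^ 2 * ‖Δ₂‖ ^ 2 ≤ 2 * R ^ 2 * (2 * a * ‖Δ‖) ^ 2 := by gcongr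
      _ = 2 * R ^ 2 * (2 * a) ^ 2 * ‖Δ‖ ^ 2 := by ring
      _ ≤ _ := by gcongr
  have hq1 : quadP φ P (Δ - Δ₂) ≤ 4 * quadP φ P Δ := by
    have := quadP_add_add_sub (φ := φ) (P := P) Δ Δ₂
    linarith [hq0 (Δ + Δ₂)]
  have t1 : |ip (nllGrad φ ω (secondSplit N N₀) Θs) (Δ - Δ₂)| ≤ 2 * √χ * √(quadP φ P Δ) := by
    apply abs_le_of_sq_le_sq _ (by positivity)
    rw [mul_pow, mul_pow, Real.sq_sqrt hχ, Real.sq_sqrt (hq0 Δ)]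
    refine (hg.score_le _ h1).trans ((mul_le_mul_of_nonneg_left hq1 hχ).trans_eq ?_)
    ring
  have t2 : |ip (nllGrad φ ω (secondSplit N N₀) Θs) Δ₂| ≤ √γ * (2 * a) * ‖Δ‖ := by
    refine (abs_ip_le _ _).trans ?_
    rw [mul_assoc]
    exact mul_le_mul (Real.le_sqrt_of_sq_le (hg.norm_grad_le _ (Or.inr rfl))) h2
      (norm_nonneg _) (Real.sqrt_nonneg _)
  have t3 : |ip (nllGrad φ ω (secondSplit N N₀) Θp - nllGrad φ ω (secondSplit N N₀) Θs) Δ| ≤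
      R ^ 2 / 4 * ζ * ‖Δ‖ := by
    refine (abs_ip_le _ _).trans (mul_le_mul_of_nonneg_right ?_ (norm_nonneg _))
    exact (norm_nllGrad_sub_le (fun t _ => hg.norm_le t) _ _).trans
      (mul_le_mul_of_nonneg_left hζ (by positivity))
  have hn : ‖Δ‖ ≤ √(quadP φ P Δ) / √lam := by
    rw [le_div_iff₀ hl', mul_comm]
    exact sqrt_mul_norm_le hl hq Δ
  have hζ0 : 0 ≤ ζ := (norm_nonneg _).trans hζ
  have e : ip (nllGrad φ ω (secondSplit N N₀) Θp) Δ =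
      ip (nllGrad φ ω (secondSplit N N₀) Θs) (Δ - Δ₂) +
      ip (nllGrad φ ω (secondSplit N N₀) Θs) Δ₂ +
      ip (nllGrad φ ω (secondSplit N N₀) Θp - nllGrad φ ω (secondSplit N N₀) Θs) Δ := by
    rw [ip_sub_right, ip_sub_left]; ring
  rw [e]
  refine (abs_add_three _ _ _).trans ?_
  have hc : (√γ * (2 * a) + R ^ 2 / 4 * ζ) * ‖Δ‖ ≤
      (√γ * (2 * a) + R ^ 2 / 4 * ζ) * (√(quadP φ P Δ) / √lam) :=
    mul_le_mul_of_nonneg_left hn (by positivity)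
  have e2 : (2 * √χ + (√γ * (2 * a) + R ^ 2 / 4 * ζ) / √lam) * √(quadP φ P Δ) =
      2 * √χ * √(quadP φ P Δ) +
      (√γ * (2 * a) + R ^ 2 / 4 * ζ) * (√(quadP φ P Δ) / √lam) := by ring
  rw [e2]
  linarith

lemma GoodData.posDef_empSecondMoment (hg : GoodData φ Θs P r Us Vs N₀ R γ χ ω) (hl : 0 < lam)
    (hq : ∀ Δ, lam * ‖Δ‖ ^ 2 ≤ quadP φ P Δ) (hU : U ∈ Matrix.orthogonalGroup (Fin dx) ℝ)
    (hV : V ∈ Matrix.orthogonalGroup (Fin dφ) ℝ) {T : Finset (Fin N)}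
    (hT : T = firstSplit N N₀ ∨ T = secondSplit N N₀) :
    (empSecondMoment φ ω T r U V).PosDef := by
  refine PosDef.of_dotProduct_mulVec_pos empSecondMoment_isHermitian fun v hv => ?_
  rw [star_trivial, dotProduct_empSecondMoment]
  have h1 := hg.le_quadEmp T hT (emb U V v)
  have h2 := hq (emb U V v)
  rw [norm_emb_sq hU hV] at h2
  have h3 : 0 < v ⬝ᵥ v := by
    rw [← star_trivial v]
    exact dotProduct_star_self_pos_iff.2 hv
  have := mul_pos hl h3
  linarith

lemma GoodData.wNorm_le (hg : GoodData φ Θs P r Us Vs N₀ R γ χ ω) {T : Finset (Fin N)}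
    (hT : T = firstSplit N N₀ ∨ T = secondSplit N N₀) (v : RtvIdx dx dφ r → ℝ) :
    wNorm (empSecondMoment φ ω T r U V) v ≤ 2 * √(quadP φ P (emb U V v)) := by
  rw [wNorm, dotProduct_empSecondMoment]
  have h := hg.quadEmp_le T hT (emb U V v)
  have h1 := hg.le_quadEmp T hT (emb U V v)
  have h0 : 0 ≤ quadP φ P (emb U V v) := by linarith
  rw [show (2 : ℝ) = √(2 ^ 2) by rw [Real.sqrt_sq]; norm_num, ← Real.sqrt_mul (by norm_num)]
  apply Real.sqrt_le_sqrt
  linarith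

/-- The concentratability coefficient is at least a multiple of the length of the mean feature. -/
lemma GoodData.norm_le_mul_wNorm_inv (hg : GoodData φ Θs P r Us Vs N₀ R γ χ ω) (hR : 0 < R)
    (hU : U ∈ Matrix.orthogonalGroup (Fin dx) ℝ) (hV : V ∈ Matrix.orthogonalGroup (Fin dφ) ℝ)
    {T : Finset (Fin N)} (hW : (empSecondMoment φ ω T r U V).PosDef)
    (v : RtvIdx dx dφ r → ℝ) :
    ‖emb U V v‖ ≤ wNorm (empSecondMoment φ ω T r U V)⁻¹ v * R := by
  have h1 := (le_abs_self _).trans (abs_dotProduct_le_wNorm hW v v)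
  rw [← norm_emb_sq hU hV] at h1
  have h2 : wNorm (empSecondMoment φ ω T r U V) v ≤ R * ‖emb U V v‖ := by
    rw [wNorm, dotProduct_empSecondMoment]
    refine Real.sqrt_le_iff.2 ⟨by positivity, ?_⟩
    rw [mul_pow]
    exact PRS.quadEmp_le (fun t _ => hg.norm_le t) _
  have h0 : 0 ≤ wNorm (empSecondMoment φ ω T r U V)⁻¹ v := Real.sqrt_nonneg _
  have h3 := h1.trans (mul_le_mul_of_nonneg_left h2 h0)
  rcases (norm_nonneg (emb U V v)).eq_or_lt with hz | hz
  · rw [← hz]; positivity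
  · rw [sq, ← mul_assoc] at h3
    exact le_of_mul_le_mul_right h3 hz

end Deterministic

/-! ### The deterministic guarantee for the pessimistic policy. -/

section Endgame

variable {dx dφ r N N₀ : ℕ} {S : Type u} {A : Type v} [MeasurableSpace S] [MeasurableSpace A]
  {φ : S → A → EuclideanSpace ℝ (Fin dφ)} {P : Measure (Query dx S A)}
  {Θs M : Matrix (Fin dx) (Fin dφ) ℝ} {Us U : Matrix (Fin dx) (Fin dx) ℝ}
  {Vs V : Matrix (Fin dφ) (Fin dφ) ℝ} {ω : Fin N → Obs dx S A} {R γ χ lam : ℝ}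
  {ρ : Measure (EuclideanSpace ℝ (Fin dx) × S)}

lemma norm_perp_sub_perp_right_le {d : ℕ → ℝ} {Xs : Matrix (Fin dφ) (Fin dx) ℝ} {x ε : ℝ}
    (h : IsSVD M U d V) (hr : M.rank ≤ r) (hVs : Vs ∈ Matrix.orthogonalGroup (Fin dφ) ℝ)
    (hXs : Xs * Θs = 1 - perp r Vs) (hx : ‖Xs‖ ≤ x) (hε : ‖M - Θs‖ ≤ ε) :
    ‖perp r V - perp r Vs‖ ≤ 2 * (ε * x) := by
  refine norm_perp_sub_perp_le h.transpose (by rwa [rank_transpose]) hVs (Θs := Θsᵀ)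
    (Xs := Xsᵀ) ?_ (norm_transpose_le hx) ?_
  · rw [← transpose_mul, hXs, transpose_sub, transpose_one, perp_transpose]
  · rw [← transpose_sub]; exact norm_transpose_le hε

/-- The guarantee on the pessimistic policy, for data with the good properties and an estimate
close to the true parameter. -/
lemma GoodData.suboptimality (hg : GoodData φ Θs P r Us Vs N₀ R γ χ ω)
    (hφ : Measurable fun p : S × A => φ p.1 p.2) {B : ℝ} (hB : ∀ s a, ‖φ s a‖ ≤ B)
    (hx : Integrable (fun p => p.1) ρ) {Pol : Set (Policy dx S A)}
    (hPol : ∀ π ∈ Pol, Measurable π) {πs : Policy dx S A} (hs : πs ∈ Pol)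
    (hR : 0 < R) (hl : 0 < lam) (hq : ∀ Δ, lam * ‖Δ‖ ^ 2 ≤ quadP φ P Δ) (hχ : 0 ≤ χ)
    (hUs : Us ∈ Matrix.orthogonalGroup (Fin dx) ℝ) (hVs : Vs ∈ Matrix.orthogonalGroup (Fin dφ) ℝ)
    {β : ℝ} (hβ : ∀ Θ : Matrix (Fin dx) (Fin dφ) ℝ, ‖Θ - Θs‖ ≤ 1 → ‖Θ‖ ≤ β) {d : ℕ → ℝ}
    (hM : IsSVD M U d V) (hr : M.rank ≤ r) {ε x : ℝ} (hε : ‖M - Θs‖ ≤ ε)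
    {Xs : Matrix (Fin dφ) (Fin dx) ℝ} (hX1 : Θs * Xs = 1 - perp r Us)
    (hX2 : Xs * Θs = 1 - perp r Vs) (hX : Θs * Xs * Θs = Θs) (hXx : ‖Xs‖ ≤ x)
    (c1 : ε ^ 2 * x ≤ 1 / 2) (c2 : 2 * R ^ 2 * (2 * (2 * (ε * x))) ^ 2 ≤ lam) {b C m₀ : ℝ}
    (hb : 2 * √χ + (√γ * (2 * (2 * (ε * x))) + R ^ 2 / 4 * (ε ^ 2 * x)) / √lam ≤ b)
    (c3 : 2 * b < Real.exp (-(R * β)) / 16 * √lam)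
    (hC : 2 * (b / (Real.exp (-(R * β)) / 16)) ≤ C)
    (hm : m₀ ≤ ‖emb Us Vs (rtv r Us Vs (polMean φ ρ πs))‖)
    (c4 : 2 * (2 * (ε * x) * ‖polMean φ ρ πs‖) ≤ m₀ / 2)
    (c5 : 2 * (B * ∫ p, ‖p.1‖ ∂ρ) * (ε ^ 2 * x) * (2 * R) ≤ C * m₀)
    {T : Finset (Fin N)} (hT : T = firstSplit N N₀ ∨ T = secondSplit N N₀) :
    (empSecondMoment φ ω T r U V).PosDef ∧
    (∃ θ, IsMinOn (nllRtv φ ω (secondSplit N N₀) r U V) Set.univ θ) ∧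
    ∀ θhat, IsMinOn (nllRtv φ ω (secondSplit N N₀) r U V) Set.univ θhat → ∀ πhat ∈ Pol,
      IsMaxOn (pessValue φ r U V ρ (empSecondMoment φ ω T r U V) θhat C) Pol πhat →
      value φ Θs ρ πs - value φ Θs ρ πhat ≤
        3 * C * wNorm (empSecondMoment φ ω T r U V)⁻¹ (meanRtv φ r U V ρ πs) := by
  have hU := hM.left_orthogonal
  have hV := hM.right_orthogonal
  have hu := norm_perp_sub_perp_le hM hr hUs hX1 hXx hε
  have hv := norm_perp_sub_perp_right_le hM hr hVs hX2 hXx hε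
  have hW := hg.posDef_empSecondMoment hl hq hU hV hT
  have hbias := norm_perp_mul_perp_le hM hr hX hXx hε
  have hεx : 0 ≤ ε * x := by linarith [(norm_nonneg _).trans hu]
  -- The target of the reduced estimator: embedded, it is `Θs` without its block `22`, at
  -- second-order distance from `Θs`.
  set θp := rtv r U V Θs with hθp
  have hΘp : emb U V θp = Θs - perp r U * Θs * perp r V := emb_rtv hU hV Θs
  have hdist : ‖emb U V θp - Θs‖ ≤ ε ^ 2 * x := by
    rw [hΘp, sub_sub_cancel_left, norm_neg]; exact hbias
  have hψ : 0 < Real.exp (-(R * β)) / 16 := by positivity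
  have hζ : 0 ≤ ε ^ 2 * x := (norm_nonneg _).trans hdist
  have hb0 : 0 ≤ b := le_trans (by positivity) hb
  -- The curvature `exp (-(R * β)) / 8` is halved on passing from the empirical to the population
  -- moment. The target is within `1 / 2` of `Θs`, so steps of length `1 / 2` stay in the unit ball
  -- where `β` bounds the norm.
  have hmle := exists_isMinOn_nllRtv (φ := φ) (P := P) (ω := ω) (T := secondSplit N N₀)
    (θp := θp) (b := b) (ψ := Real.exp (-(R * β)) / 16) hU hV hl hq hψ
    (fun Δ hΔ => by
      have h1 := le_nll_of_bound (φ := φ) (ω := ω) (T := secondSplit N N₀)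
        (fun t _ => hg.norm_le t) (hβ (emb U V θp) (by linarith)) (hβ (emb U V θp + Δ) (by
          rw [add_sub_right_comm]
          exact (norm_add_le _ _).trans (by linarith)))
      rw [add_sub_cancel_left] at h1
      have h2 := mul_le_mul_of_nonneg_left (hg.le_quadEmp _ (Or.inr rfl) Δ) hψ.le
      linarith) hb0
    (fun v => (hg.abs_ip_nllGrad_le hl hq hχ hV hUs hVs hu hv c2 hdist
      (perp_emb_perp hU hV v)).trans (mul_le_mul_of_nonneg_right hb (Real.sqrt_nonneg _))) c3
  refine ⟨hW, hmle.1, fun θhat hθ πhat hπ hmax => ?_⟩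
  have hCW : wNorm (empSecondMoment φ ω T r U V) (θp - θhat) ≤ C := by
    refine (hg.wNorm_le hT _).trans (le_trans ?_ hC)
    have h1 := hmle.2 θhat hθ
    have h2 : quadP φ P (emb U V (θp - θhat)) = quadP φ P (emb U V (θhat - θp)) := by
      rw [← neg_sub θhat θp, ← neg_one_smul ℝ (θhat - θp), emb_smul, quadP_smul]
      norm_num
    rw [h2]
    linarith
  have hgap := pessimism_gap hφ hB hx hPol hW hCW hs hπ hmax
  set Cs := wNorm (empSecondMoment φ ω T r U V)⁻¹ (meanRtv φ r U V ρ πs) with hCs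
  have hbd : ∀ π ∈ Pol, |ip (polMean φ ρ π) (emb U V θp - Θs)| ≤
      (B * ∫ p, ‖p.1‖ ∂ρ) * (ε ^ 2 * x) := fun π hπ =>
    (abs_ip_polMean_le hφ hB hx (hPol π hπ) _).trans (mul_le_mul_of_nonneg_left hdist
      ((norm_nonneg _).trans (norm_polMean_le hφ hB hx (hPol π hπ))))
  have b1 := (abs_le.1 (hbd πs hs)).1
  have b2 := (abs_le.1 (hbd πhat hπ)).2
  rw [ip_sub_right] at b1 b2
  -- `W` has operator norm at most `R ^ 2`, and in the estimated subspaces the mean feature keeps at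
  -- least `m₀ / 2` of its length.
  have hlow : m₀ / 2 ≤ Cs * R := by
    have h1 := hg.norm_le_mul_wNorm_inv hR hU hV hW (meanRtv φ r U V ρ πs)
    have h2 := norm_perp_mul_perp_sub_le hV hUs hu hv (polMean φ ρ πs)
    rw [emb_rtv hUs hVs] at hm
    rw [← hCs, meanRtv_eq hφ hB hx (hPol _ hs), emb_rtv hU hV] at h1
    have h3 := norm_sub_norm_le (polMean φ ρ πs - perp r Us * polMean φ ρ πs * perp r Vs)
      (polMean φ ρ πs - perp r U * polMean φ ρ πs * perp r V)
    rw [sub_sub_sub_cancel_left] at h3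
    linarith
  have hC0 : 0 ≤ C := (Real.sqrt_nonneg _).trans hCW
  -- The truncation bias of the two values costs one more `C * Cs` beside the two from pessimism,
  -- whence the factor `3`.
  have h6 : 2 * (B * ∫ p, ‖p.1‖ ∂ρ) * (ε ^ 2 * x) ≤ C * Cs := by
    have := mul_le_mul_of_nonneg_left hlow hC0
    refine le_of_mul_le_mul_right ?_ (show 0 < 2 * R by positivity)
    linarith
  rw [value_eq_ip hφ hB hx (hPol _ hs), value_eq_ip hφ hB hx (hPol _ hπ)]
  linarith

end Endgame

/-! ### Smallness of the error terms. -/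

section Constants

/-- All smallness conditions hold when the rate `τ` is small. -/
lemma exists_rate_bound {R lam β x e g c w Bm Mn m₀ c₃ : ℝ} (hR : 0 < R) (hl : 0 < lam)
    (hc : 0 < c) (hx : 0 ≤ x) (he : 0 ≤ e) (hg : 0 ≤ g) (hm : 0 < m₀) (h3 : 0 < c₃) :
    ∃ τ₀ > 0, ∀ τ s κ, 0 < τ → τ ≤ τ₀ → τ ≤ s → s ≤ w * τ →
      2 * (2 * √(24 / c) + 1) / (Real.exp (-(R * β)) / 16) ≤ κ →
      √g * τ ≤ c₃ ∧ (e * τ) ^ 2 * x ≤ 1 / 2 ∧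
      2 * R ^ 2 * (2 * (2 * (e * τ * x))) ^ 2 ≤ lam ∧
      2 * √(24 / c * s ^ 2) + (√(g * τ ^ 2) * (2 * (2 * (e * τ * x))) +
        R ^ 2 / 4 * ((e * τ) ^ 2 * x)) / √lam ≤ (2 * √(24 / c) + 1) * s ∧
      2 * ((2 * √(24 / c) + 1) * s) < Real.exp (-(R * β)) / 16 * √lam ∧
      2 * ((2 * √(24 / c) + 1) * s / (Real.exp (-(R * β)) / 16)) ≤ κ * s ∧
      2 * (2 * (e * τ * x) * Mn) ≤ m₀ / 2 ∧
      2 * Bm * ((e * τ) ^ 2 * x) * (2 * R) ≤ κ * s * m₀ := by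
  set ψ := Real.exp (-(R * β)) / 16
  have hψ : 0 < ψ := by positivity
  set h := 2 * √(24 / c) + 1 with hh
  have hh0 : 0 < h := by positivity
  have hl' : 0 < √lam := Real.sqrt_pos.2 hl
  set A := (√g * (2 * (2 * (e * x))) + R ^ 2 / 4 * (e ^ 2 * x)) / √lam with hA
  -- With spare factors of `τ` bounded by `1` or cancelled against `s`, all conditions become linear
  -- in `τ` and hold near `0`. The threshold for `κ` involves only `c`, `R` and `β`.
  have hev : ∀ᶠ τ in nhdsWithin (0 : ℝ) (Set.Ioi 0),
      (√g * τ ≤ c₃ ∧ 1 * τ ≤ 1 ∧ e ^ 2 * x * τ ≤ 1 / 2 ∧ 8 * R * e * x * τ ≤ √lam ∧ A * τ ≤ 1 ∧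
      2 * h * w * τ ≤ ψ * √lam / 2) ∧ 4 * e * x * Mn * τ ≤ m₀ / 2 ∧
      4 * Bm * e ^ 2 * x * R * τ ≤ 2 * h / ψ * m₀ :=
    ((eventually_mul_le _ h3).and <| (eventually_mul_le _ one_pos).and <|
      (eventually_mul_le _ (by norm_num)).and <| (eventually_mul_le _ hl').and <|
      (eventually_mul_le _ one_pos).and (eventually_mul_le _ (by positivity))).and <|
      (eventually_mul_le _ (by positivity)).and (eventually_mul_le _ (by positivity))
  obtain ⟨τ₀, hτ₀, hsub⟩ := mem_nhdsGT_iff_exists_Ioc_subset.1 hev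
  refine ⟨τ₀, hτ₀, fun τ s κ hτ hττ hs hsw hκ => ?_⟩
  obtain ⟨⟨k0, k1, k2, k3, k4, k5⟩, k6, k7⟩ := hsub (Set.mem_Ioc.2 ⟨hτ, hττ⟩)
  rw [one_mul] at k1
  have hs0 : 0 < s := hτ.trans_le hs
  refine ⟨k0, ?_, ?_, ?_, ?_, ?_, ?_, ?_⟩
  · have : e ^ 2 * x * τ * τ ≤ 1 / 2 * 1 := mul_le_mul k2 k1 hτ.le (by norm_num)
    linarith
  · have h1 := pow_le_pow_left₀ (by positivity) k3 2
    rw [Real.sq_sqrt hl.le] at h1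
    have h2 : 0 ≤ 32 * (R * e * x * τ) ^ 2 := by positivity
    linear_combination h1 + h2
  · rw [Real.sqrt_mul (by positivity), Real.sqrt_sq hs0.le, Real.sqrt_mul hg, Real.sqrt_sq hτ.le]
    have h1 : (√g * τ * (2 * (2 * (e * τ * x))) + R ^ 2 / 4 * ((e * τ) ^ 2 * x)) / √lam =
        A * τ * τ := by rw [hA]; ring
    have h2 := mul_le_mul_of_nonneg_right k4 hτ.le
    rw [h1, hh]
    linarith
  · have h1 := mul_le_mul_of_nonneg_left hsw (show 0 ≤ 2 * h by positivity)
    have h2 : 0 < ψ * √lam := by positivity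
    linarith
  · have h1 := mul_le_mul_of_nonneg_right hκ hs0.le
    refine le_trans (le_of_eq ?_) h1
    ring
  · linarith
  · have h1 := mul_le_mul_of_nonneg_right k7 hτ.le
    have h2 : 2 * h / ψ * m₀ * τ ≤ 2 * h / ψ * m₀ * s :=
      mul_le_mul_of_nonneg_left hs (by positivity)
    have h3 := mul_le_mul_of_nonneg_right hκ (mul_pos hs0 hm).le
    linarith

end Constants

/-! ### A bound on the rank. -/

section Dimensions

variable {m n r : ℕ}

/-- The first `r` singular values are at least `d (r - 1)`. For the true parameter this bounds `r`
by `(β / σr) ^ 2`. -/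
lemma IsSVD.mul_sq_le_norm_sq {M : Matrix (Fin m) (Fin n) ℝ} {U : Matrix (Fin m) (Fin m) ℝ}
    {d : ℕ → ℝ} {V : Matrix (Fin n) (Fin n) ℝ} (h : IsSVD M U d V) (hm : r ≤ m) (hn : r ≤ n) :
    r * d (r - 1) ^ 2 ≤ ‖M‖ ^ 2 := by
  rw [h.eq, norm_mul_isometry (orthogonal_transpose_mul h.right_orthogonal),
    norm_isometry_mul (orthogonal_transpose_mul h.left_orthogonal), norm_sq_eq_ip, ip_eq_sum]
  have h1 : ∀ k : Fin r, d (r - 1) ^ 2 ≤ ∑ j, rectDiag m n d (Fin.castLE hm k) j *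
      rectDiag m n d (Fin.castLE hm k) j := by
    intro k
    refine le_trans ?_ (Finset.single_le_sum (fun j _ => mul_self_nonneg _)
      (Finset.mem_univ (Fin.castLE hn k)))
    simp only [rectDiag, of_apply, Fin.val_castLE, if_true, ← sq]
    exact pow_le_pow_left₀ (h.nonneg _) (h.antitone (by omega)) 2
  calc r * d (r - 1) ^ 2 = ∑ _k : Fin r, d (r - 1) ^ 2 := by simp
    _ ≤ ∑ k : Fin r, ∑ j, rectDiag m n d (Fin.castLE hm k) j *
      rectDiag m n d (Fin.castLE hm k) j := Finset.sum_le_sum fun k _ => h1 k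
    _ = ∑ i ∈ Finset.univ.map (Fin.castLEEmb hm), ∑ j, rectDiag m n d i j *
      rectDiag m n d i j := by rw [Finset.sum_map]; rfl
    _ ≤ _ := Finset.sum_le_sum_of_subset_of_nonneg (Finset.subset_univ _)
      fun i _ _ => Finset.sum_nonneg fun j _ => mul_self_nonneg _

end Dimensions

/-! ### Dimension bound and error of the low-rank estimate. -/

section Estimate

variable {dx dφ r N N₀ : ℕ} {S : Type u} {A : Type v} [MeasurableSpace S] [MeasurableSpace A]
  {φ : S → A → EuclideanSpace ℝ (Fin dφ)} {P : Measure (Query dx S A)}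
  {Θs : Matrix (Fin dx) (Fin dφ) ℝ} {Us : Matrix (Fin dx) (Fin dx) ℝ}
  {Vs : Matrix (Fin dφ) (Fin dφ) ℝ} {ω : Fin N → Obs dx S A} {R γ χ lam : ℝ}

/-- The positive definiteness of the second moment bounds the dimensions. -/
lemma GoodData.dim_le (hg : GoodData φ Θs P r Us Vs N₀ R γ χ ω)
    (hq : ∀ Δ, lam * ‖Δ‖ ^ 2 ≤ quadP φ P Δ) : lam * ((dx : ℝ) * dφ) ≤ 2 * R ^ 2 := by
  set T := firstSplit N N₀
  -- Testing with matrix units and summing compares `lam * dx * dφ` with the trace of the second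
  -- moment.
  have h1 : ∀ (i : Fin dx) (j : Fin dφ), lam ≤
      2 * ((T.card : ℝ)⁻¹ * ∑ t ∈ T, zmat φ (ω t) i j ^ 2) := by
    intro i j
    have h2 := hq (Matrix.single i j 1)
    have h3 := hg.le_quadEmp T (Or.inl rfl) (Matrix.single i j 1)
    rw [norm_sq_eq_ip, ip_single] at h2
    simp only [quadEmp, ip_single, Matrix.single_apply_same, mul_one] at h2 h3
    linarith
  have h4 : ∀ t ∈ T, ∑ i, ∑ j, zmat φ (ω t) i j ^ 2 ≤ R ^ 2 := fun t _ => by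
    have := pow_le_pow_left₀ (norm_nonneg _) (hg.norm_le t) 2
    rw [norm_sq_eq_ip, ip_eq_sum] at this
    simpa only [sq] using this
  have h5 := inv_card_mul_sum_le (sq_nonneg R) h4
  calc lam * ((dx : ℝ) * dφ) = ∑ _i : Fin dx, ∑ _j : Fin dφ, lam := by simp; ring
    _ ≤ ∑ i : Fin dx, ∑ j : Fin dφ, 2 * ((T.card : ℝ)⁻¹ * ∑ t ∈ T, zmat φ (ω t) i j ^ 2) :=
      Finset.sum_le_sum fun i _ => Finset.sum_le_sum fun j _ => h1 i j
    _ = 2 * ((T.card : ℝ)⁻¹ * ∑ t ∈ T, ∑ i, ∑ j, zmat φ (ω t) i j ^ 2) := by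
      simp only [← Finset.mul_sum]
      congr 2
      rw [Finset.sum_comm (s := T)]
      exact Finset.sum_congr rfl fun i _ => Finset.sum_comm
    _ ≤ _ := by linarith

end Estimate

/-- The error of factored gradient descent. -/
lemma fgdEstimate_converges {R lam β σr : ℝ} (hl : 0 < lam) (hβ0 : 0 ≤ β)
    (hσ : 0 < σr) :
    ∃ c₁ > 0, ∃ c₂ > 0, ∃ c₃ > 0, ∃ C > 0, ∃ q > 0, q * c₁ ≤ 1 / 2 ∧
    ∀ {dx dφ r N N₀ : ℕ} {S : Type u} {A : Type v} [MeasurableSpace S] [MeasurableSpace A]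
      {φ : S → A → EuclideanSpace ℝ (Fin dφ)} {P : Measure (Query dx S A)}
      {Θs : Matrix (Fin dx) (Fin dφ) ℝ} {Us : Matrix (Fin dx) (Fin dx) ℝ} {σ : ℕ → ℝ}
      {Vs : Matrix (Fin dφ) (Fin dφ) ℝ} {ω : Fin N → Obs dx S A} {γ χ : ℝ},
    GoodData φ Θs P r Us Vs N₀ R γ χ ω → (∀ Δ, lam * ‖Δ‖ ^ 2 ≤ quadP φ P Δ) →
    (∀ Θ : Matrix (Fin dx) (Fin dφ) ℝ, ‖Θ - Θs‖ ≤ 1 → ‖Θ‖ ≤ β) →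
    Θs.rank = r → IsSVD Θs Us σ Vs → σ (r - 1) = σr → √γ ≤ c₃ →
    ∀ η, 0 < η → η ≤ c₁ → ∀ Θ₀ U₀ d₀ V₀, ‖Θ₀ - Θs‖ ≤ c₂ → IsSVD Θ₀ U₀ d₀ V₀ → ∀ k,
    ‖fgdEstimate φ ω (firstSplit N N₀) r η U₀ d₀ V₀ k - Θs‖ ^ 2 ≤ C * ((1 - q * η) ^ k + γ) := by
  -- The rank enters through `rb`, the dimensions through `D` below; both are replaced by bounds in
  -- `R`, `lam`, `β` and `σr`, so the constants are common to all problems.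
  obtain ⟨c₁, hc₁, c₂, hc₂, c₃, hc₃, C, hC, q, hq, hqc, H⟩ := altStep_converges
    (L := R ^ 2 / 4) (μ := Real.exp (-(R * β)) / 4 * (lam / 2)) (σ := σr) (β := β)
    (rb := β / σr + 1) (by positivity) (by positivity) hσ hβ0 (by positivity)
  set D := √(2 * R ^ 2 / lam) with hD
  have hD0 : 0 ≤ D := Real.sqrt_nonneg _
  refine ⟨c₁, hc₁, c₂ / (1 + D), by positivity, c₃, hc₃, C, hC, q, hq, hqc, ?_⟩
  intro dx dφ r N N₀ S A _ _ φ P Θs Us σ Vs ω γ χ hg hquad hβ hrank hsvd hσr hγ η hη hη1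
    Θ₀ U₀ d₀ V₀ hΘ₀ hsvd₀ k
  have hdx : r ≤ dx := by simpa [hrank] using Θs.rank_le_height
  have hdφ : r ≤ dφ := by simpa [hrank] using Θs.rank_le_width
  have hΘs : ‖Θs‖ ≤ β := hβ Θs (by simp)
  have hland := nll_landscape (φ := φ) (ω := ω) (T := firstSplit N N₀) (lam := lam / 2)
    (fun t _ => hg.norm_le t) hβ (fun Δ => by
      have h1 := hg.le_quadEmp _ (Or.inl rfl) Δ
      have h2 := hquad Δ
      linarith)
  have hthin := hsvd.thin hrank.le hdx hdφ
  rw [hσr] at hthin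
  have hr : (Fintype.card (Fin r) : ℝ) ≤ (β / σr + 1) ^ 2 := by
    rw [Fintype.card_fin]
    have h1 := hsvd.mul_sq_le_norm_sq hdx hdφ
    rw [hσr] at h1
    have h2 := h1.trans (pow_le_pow_left₀ (norm_nonneg _) hΘs 2)
    rw [← le_div_iff₀ (by positivity), ← div_pow] at h2
    exact h2.trans (pow_le_pow_left₀ (by positivity) (by linarith) 2)
  have hgrad := Real.le_sqrt_of_sq_le (hg.norm_grad_le _ (Or.inl rfl))
  have hγ0 : 0 ≤ γ := (sq_nonneg _).trans (hg.norm_grad_le _ (Or.inl rfl))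
  have hinit := norm_fgdInit_sub_le (Θs := Θs) hsvd₀ hrank.le hD0 (by
    rw [hD, Real.sq_sqrt (by positivity), le_div_iff₀ hl, mul_comm]
    exact hg.dim_le hquad)
  have hinit2 := hinit.trans (mul_le_mul_of_nonneg_left hΘ₀ (by positivity))
  rw [mul_div_cancel₀ _ (by positivity)] at hinit2
  have h := H hland hthin hΘs hr (hgrad.trans hγ) η hη hη1 (fgdInit r U₀ d₀ V₀)
    (bal_fgdInit hsvd₀.left_orthogonal hsvd₀.right_orthogonal hdx hdφ) hinit2 k
  rw [← fgdStep_eq] at h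
  refine h.trans (mul_le_mul_of_nonneg_left ?_ hC.le)
  have := hg.norm_grad_le _ (Or.inl rfl)
  linarith

end PRS

/-! ### The main theorem. -/

theorem mainTheorem1 (Bx Bφ Bθ c : ℝ) (hc : 0 < c) :
    -- the constants of the confidence radius and of the rate
    ∃ κ₀ > 0, ∃ K > 0,
    ∀ lam σ₁ σr : ℝ, 0 < lam →
    -- the constants of the learning rate and of the initial estimate
    ∃ c₁ > 0, ∃ c₂ > 0,
    ∀ (dx dφ r : ℕ) (S : Type u) (A : Type v) [MeasurableSpace S] [MeasurableSpace A]
      (φ : S → A → EuclideanSpace ℝ (Fin dφ)) (Θs : Matrix (Fin dx) (Fin dφ) ℝ)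
      (Us : Matrix (Fin dx) (Fin dx) ℝ) (σ : ℕ → ℝ) (Vs : Matrix (Fin dφ) (Fin dφ) ℝ)
      (P : Measure (PRS.Query dx S A)) [IsProbabilityMeasure P]
      (ρ : Measure (EuclideanSpace ℝ (Fin dx) × S)) [IsProbabilityMeasure ρ]
      (Pol : Set (PRS.Policy dx S A)) (πs : PRS.Policy dx S A),
    Measurable (fun p : S × A => φ p.1 p.2) →
    -- the true parameter has rank `r ≥ 1`, and extreme non-zero singular values `σ₁` and `σr`
    1 ≤ r → Θs.rank = r → PRS.IsSVD Θs Us σ Vs → σ 0 = σ₁ → σ (r - 1) = σr →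
    -- boundedness
    (∀ᵐ q ∂P, ‖q.1‖ ≤ Bx) → (∀ s a, ‖φ s a‖ ≤ Bφ) →
    (∀ Θ : Matrix (Fin dx) (Fin dφ) ℝ, ‖Θ - Θs‖ ≤ 1 → ‖Θ‖ ≤ Bθ) →
    -- positive definite second moment
    (PRS.popSecondMoment φ P - lam • 1).PosSemidef →
    -- the value is well defined, and `πs` is an optimal policy
    Integrable (fun p => p.1) ρ →
    (∀ π ∈ Pol, Measurable π) → πs ∈ Pol → IsMaxOn (PRS.value φ Θs ρ) Pol πs →
    -- the concentratability coefficient in the true subspaces does not vanish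
    PRS.meanRtv φ r Us Vs ρ πs ≠ 0 →
    ∀ η : ℝ, 0 < η → η ≤ c₁ / σ₁ →
    ∃ N₁ : ℝ, ∀ (δ : ℝ), 0 < δ → δ < 1 → ∀ κ ≥ κ₀, ∀ N N₀ : ℕ,
    N₁ * (1 + Real.log (1 / δ)) ≤ N →
    -- both splits have size `Ω(N)`
    c * N ≤ N₀ → c * N ≤ (N : ℝ) - N₀ →
    ∃ k₀ : ℕ, ∃ E : Set (Fin N → PRS.Obs dx S A), MeasurableSet E ∧
      ENNReal.ofReal (1 - δ) ≤ PRS.dataLaw φ Θs P N E ∧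
      ∀ ω ∈ E,
      -- an initial estimate, and a sufficiently large number of gradient steps
      ∀ (Θ₀ : Matrix (Fin dx) (Fin dφ) ℝ) (U₀ : Matrix (Fin dx) (Fin dx) ℝ) (d₀ : ℕ → ℝ)
        (V₀ : Matrix (Fin dφ) (Fin dφ) ℝ),
      ‖Θ₀ - Θs‖ ≤ c₂ * √σr → PRS.IsSVD Θ₀ U₀ d₀ V₀ →
      ∀ k ≥ k₀,
      ∀ (U : Matrix (Fin dx) (Fin dx) ℝ) (d : ℕ → ℝ) (V : Matrix (Fin dφ) (Fin dφ) ℝ),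
      PRS.IsSVD (PRS.fgdEstimate φ ω (PRS.firstSplit N N₀) r η U₀ d₀ V₀ k) U d V →
      -- the empirical second moment may be formed over either split
      ∀ T : Finset (Fin N), T = PRS.firstSplit N N₀ ∨ T = PRS.secondSplit N N₀ →
      ∀ (W : Matrix (PRS.RtvIdx dx dφ r) (PRS.RtvIdx dx dφ r) ℝ),
      W = PRS.empSecondMoment φ ω T r U V →
      W.PosDef ∧
      (∃ θ, IsMinOn (PRS.nllRtv φ ω (PRS.secondSplit N N₀) r U V) Set.univ θ) ∧
      ∀ θhat, IsMinOn (PRS.nllRtv φ ω (PRS.secondSplit N N₀) r U V) Set.univ θhat →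
      ∀ πhat ∈ Pol,
      IsMaxOn (PRS.pessValue φ r U V ρ W θhat
        (κ * √((((dx : ℝ) + dφ) * r + Real.log (1 / δ)) / N))) Pol πhat →
      PRS.value φ Θs ρ πs - PRS.value φ Θs ρ πhat ≤
        K * κ * PRS.wNorm W⁻¹ (PRS.meanRtv φ r U V ρ πs) *
          √((((dx : ℝ) + dφ) * r + Real.log (1 / δ)) / N) := by
  -- A bound for the data matrices; absolute values and `+ 1` make it positive whatever the given
  -- constants.
  set R : ℝ := |Bx| * (2 * |Bφ|) + 1
  have hR : 0 < R := by positivity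
  set β : ℝ := |Bθ|
  have hβ0 : 0 ≤ β := abs_nonneg _
  refine ⟨2 * (2 * √(24 / c) + 1) / (Real.exp (-(R * β)) / 16), by positivity, 3, by norm_num,
    fun lam σ₁ σr hl => ?_⟩
  -- Otherwise no problem has these singular values, and any constants will do.
  by_cases hσ : 0 < σr ∧ 0 < σ₁
  swap
  · refine ⟨1, one_pos, 1, one_pos, ?_⟩
    intro dx dφ r S A _ _ φ Θs Us σ Vs P _ ρ _ Pol πs _ hr1 hrank hsvd h0 hσr
    have h1 := hsvd.pos_of_rank_eq hrank hr1
    have h2 := hsvd.antitone (Nat.zero_le (r - 1))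
    rw [hσr] at h1 h2
    rw [h0] at h2
    exact absurd ⟨h1, h1.trans_le h2⟩ hσ
  obtain ⟨hσr0, hσ₁0⟩ := hσ
  obtain ⟨c₁, hc₁, c₂, hc₂, c₃, hc₃, C, hC, q, hq0, hqc, hconv⟩ :=
    PRS.fgdEstimate_converges (R := R) (lam := lam) (β := β) (σr := σr) hl hβ0 hσr0
  have hsr : 0 < √σr := Real.sqrt_pos.2 hσr0
  refine ⟨c₁ * σ₁, by positivity, c₂ / √σr, by positivity, ?_⟩
  intro dx dφ r S A _ _ φ Θs Us σ Vs P _ ρ _ Pol πs hφ hr1 hrank hsvd h0 hσr hBx hBφ hBθ hS hx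
    hPol hπs _ hm η hη hηc
  rw [mul_div_cancel_right₀ _ hσ₁0.ne'] at hηc
  have hUs := hsvd.left_orthogonal
  have hVs := hsvd.right_orthogonal
  have hq := PRS.le_quadP hS
  have hβ : ∀ Θ : Matrix (Fin dx) (Fin dφ) ℝ, ‖Θ - Θs‖ ≤ 1 → ‖Θ‖ ≤ β := fun Θ hΘ =>
    (hBθ Θ hΘ).trans (le_abs_self _)
  have hdx : r ≤ dx := by simpa [hrank] using Θs.rank_le_height
  have hdφ : r ≤ dφ := by simpa [hrank] using Θs.rank_le_width
  have hr1' : (1 : ℝ) ≤ r := by exact_mod_cast hr1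
  have hdx' : (r : ℝ) ≤ dx := by exact_mod_cast hdx
  have hdφ' : (r : ℝ) ≤ dφ := by exact_mod_cast hdφ
  set dim : ℝ := ((dx : ℝ) + dφ) * r with hdim
  have hdim2 : 2 ≤ dim := by
    have : (2 : ℝ) * 1 ≤ ((dx : ℝ) + dφ) * r := mul_le_mul (by linarith) hr1' zero_le_one
      (by linarith)
    linarith
  have hRz : ∀ᵐ x ∂P, ∀ y, ‖PRS.zmat φ (x, y)‖ ≤ R := by
    filter_upwards [hBx] with x hx y
    have h1 := PRS.norm_zmat_le (φ := φ) hBφ (o := (x, y)) hx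
    have h2 : Bx * (2 * Bφ) ≤ |Bx| * (2 * |Bφ|) := by
      have := le_abs_self (Bx * (2 * Bφ))
      rwa [abs_mul, abs_mul, abs_two] at this
    linarith
  obtain ⟨Xs, hX1, hX2, hX, -⟩ := (hsvd.thin hrank.le hdx hdφ).exists_pinv (rb := √r)
    (by rw [hσr]; exact hσr0) (by rw [Fintype.card_fin, Real.sq_sqrt (by positivity)])
    (Real.sqrt_nonneg _)
  rw [PRS.firstCols_mul_transpose hUs] at hX1
  rw [PRS.firstCols_mul_transpose hVs] at hX2
  obtain ⟨Cg, hCg, N₁, hN₁, hgood⟩ := PRS.exists_goodData (φ := φ) (P := P) (Θs := Θs) (r := r)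
    hφ hR hl (show 0 < (dx : ℝ) * dφ from mul_pos (by linarith) (by linarith)) hc le_rfl hdim2
    hS hUs hVs hRz
  -- Positive by non-degeneracy of the mean feature; its size influences only the threshold `N₁`.
  set m₀ := ‖PRS.emb Us Vs (PRS.rtv r Us Vs (PRS.polMean φ ρ πs))‖ with hm₀
  have hm₀0 : 0 < m₀ := by
    rw [PRS.meanRtv_eq hφ hBφ hx (hPol _ hπs)] at hm
    have h1 := dotProduct_star_self_pos_iff.2 hm
    rw [star_trivial, ← PRS.norm_emb_sq hUs hVs] at h1
    exact lt_of_pow_lt_pow_left₀ 2 (norm_nonneg _) (by rw [hm₀]; simpa using h1)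
  obtain ⟨τ₀, hτ₀, hsmall⟩ := PRS.exists_rate_bound (R := R) (lam := lam) (β := β) (x := ‖Xs‖)
    (e := √(C * (1 + Cg))) (g := Cg) (c := c) (w := √dim) (Bm := Bφ * ∫ p, ‖p.1‖ ∂ρ)
    (Mn := ‖PRS.polMean φ ρ πs‖) (m₀ := m₀) (c₃ := c₃) hR hl hc (norm_nonneg _)
    (Real.sqrt_nonneg _) hCg.le hm₀0 hc₃
  refine ⟨max N₁ (1 / τ₀ ^ 2), ?_⟩
  intro δ hδ hδ1 κ hκ N N₀ hN hN0 hN1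
  have hL : 0 < Real.log (1 / δ) := Real.log_pos (by rw [one_div]; exact (one_lt_inv₀ hδ).2 hδ1)
  obtain ⟨E, hE, hEδ, hEg⟩ := hgood δ hδ hδ1 N N₀
    ((mul_le_mul_of_nonneg_right (le_max_left _ _) (by linarith)).trans hN) hN0 hN1
  set L := Real.log (1 / δ)
  have hN2 : 1 / τ₀ ^ 2 * (1 + L) ≤ N :=
    (mul_le_mul_of_nonneg_right (le_max_right _ _) (by linarith)).trans hN
  have hNpos : (0 : ℝ) < N := lt_of_lt_of_le (by positivity) hN2
  set τ := √((1 + L) / N) with hτ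
  have hτ2 : τ ^ 2 = (1 + L) / N := Real.sq_sqrt (by positivity)
  have hτpos : 0 < τ := Real.sqrt_pos.2 (by positivity)
  set s := √((dim + L) / N) with hs
  have hs2 : s ^ 2 = (dim + L) / N := Real.sq_sqrt (by positivity)
  have hττ₀ : τ ≤ τ₀ := by
    refine Real.sqrt_le_iff.2 ⟨hτ₀.le, ?_⟩
    rw [one_div, inv_mul_le_iff₀ (by positivity)] at hN2
    rwa [div_le_iff₀ hNpos]
  have hτs : τ ≤ s := by
    apply Real.sqrt_le_sqrt
    gcongr
    linarith
  have hsw : s ≤ √dim * τ := by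
    rw [hs, hτ, ← Real.sqrt_mul (by linarith), ← mul_div_assoc]
    apply Real.sqrt_le_sqrt
    gcongr
    have := mul_le_mul_of_nonneg_right (show 1 ≤ dim by linarith) hL.le
    linarith
  obtain ⟨k1, k2, k3, k4, k5, k6, k7, k8⟩ := hsmall τ s κ hτpos hττ₀ hτs hsw hκ
  have hqη : 0 < q * η := mul_pos hq0 hη
  have hqη1 : q * η ≤ 1 / 2 := (mul_le_mul_of_nonneg_left hηc hq0.le).trans hqc
  -- After `k₀` steps the optimization error is below the statistical level `τ ^ 2`; this number
  -- depends neither on the data nor on the initial estimate.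
  obtain ⟨k₀, hk₀⟩ := exists_pow_lt_of_lt_one (show 0 < τ ^ 2 by positivity)
    (show 1 - q * η < 1 by linarith)
  refine ⟨k₀, E, hE, hEδ, fun ω hω Θ₀ U₀ d₀ V₀ hΘ₀ hsvd₀ k hk U d V hUV T hT W hW => ?_⟩
  subst hW
  have hg := hEg ω hω
  rw [mul_div_assoc, ← hτ2, ← hs2] at hg
  rw [div_mul_cancel₀ _ hsr.ne'] at hΘ₀
  have herr := hconv hg hq hβ hrank hsvd hσr (by
    rwa [Real.sqrt_mul hCg.le, Real.sqrt_sq hτpos.le]) η hη hηc Θ₀ U₀ d₀ V₀ hΘ₀ hsvd₀ k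
  have hε : ‖PRS.fgdEstimate φ ω (PRS.firstSplit N N₀) r η U₀ d₀ V₀ k - Θs‖ ≤
      √(C * (1 + Cg)) * τ := by
    refine le_of_sq_le_sq (herr.trans ?_) (by positivity)
    rw [mul_pow, Real.sq_sqrt (show 0 ≤ C * (1 + Cg) by positivity), mul_assoc]
    refine mul_le_mul_of_nonneg_left ?_ hC.le
    have := (pow_le_pow_of_le_one (by linarith) (by linarith) hk).trans hk₀.le
    linarith
  obtain ⟨r1, r2, r3⟩ := hg.suboptimality hφ hBφ hx hPol hπs hR hl hq (by positivity) hUs hVs hβ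
    hUV (PRS.rank_fgdEstimate_le _ _ _ _ _) hε hX1 hX2 hX le_rfl k2 k3 k4 k5 k6 le_rfl k7 k8 hT
  refine ⟨r1, r2, fun θhat hθ πhat hπ hmax => (r3 θhat hθ πhat hπ hmax).trans_eq ?_⟩
  ring
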